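/- Consider the KdV equation $u_t+uu_x+u_{xxx}=0$ on $\mathbb{R}\times[0,T]$ with $u(\cdot,0)=u_0\in H^3(\mathbb{R})$ (continuous representative). For a mesh width $\Delta x>0$ put $x_j=j\Delta x$, and for grid functions $v=(v_j)_{j\in\mathbb{Z}}$ let $D_\pm v_j=\pm(v_{j\pm1}-v_j)/\Delta x$, $D=\tfrac12(D_++D_-)$, $\tilde v_j=\tfrac13(v_{j+1}+v_j+v_{j-1})$, $\|v\|=(\Delta x\sum_j v_j^2)^{1/2}$ and $\|v\|_{h^3}=\|v\|+\|D_+v\|+\|D_+D_-v\|+\|D_-DD_+v\|$; $\|u_0\|_{h^3}$ is the $h^3$ norm of $(u_0(x_j))_j$. For a time step $\Delta t>0$ put $t_n=n\Delta t$. An approximation on $[0,T]$ is a family of square summable grid functions $u^n$ with $u^0_j=u_0(x_j)$ and $$u^{n+1}_j=u^n_j-\Delta t\,\tilde u^{n+1/2}_jDu^{n+1/2}_j-\Delta t\,D_-DD_+u^{n+1/2}_j,\qquad u^{n+1/2}=\tfrac12(u^n+u^{n+1}),$$ for all $j$ and all $n\ge 0$ with $t_n\le T$. It is interpolated by $$u^n(x)=u^n_j+(x-x_j)D_+u^n_j+\tfrac12(x-x_j)^2D_+D_-u^n_j+\tfrac16(x-x_j)^3D_+DD_-u^n_j,\quad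 x\in[x_j,x_{j+1}),$$ $$u_{\Delta x}(x,t)=u^n(x)+(t-t_n)\frac{u^{n+1}(x)-u^n(x)}{\Delta t},\quad t\in[t_n,t_{n+1}).$$ Below, $\partial_xu_{\Delta x}$ and $\partial_x^3u_{\Delta x}$ are the derivatives in the interior of the cells $(x_j,x_{j+1})$, and $\partial_tu_{\Delta x}$ is the right derivative in time. **Theorem.** For every $u_0\in H^3(\mathbb{R})$ the norms $\|u_0\|_{h^3}$ stay bounded as $\Delta x\to0^+$. For every $R$ there are a time $T>0$ and a constant $C>0$, depending only on $R$, such that for every $\lambda>0$ the following holds. (a) There is $\delta>0$ (depending on $R$ and $\lambda$) such that for all $u_0\in H^3(\mathbb{R})$, all $0<\Delta x\le\delta$ and all $0<\Delta t\le\lambda\Delta x$ with $\|u_0\|_{h^3}\le R$, the approximation on $[0,T]$ exists, is unique, and satisfies for all $t\in[0,T]$ $$\|\partial_xu_{\Delta x}(\cdot,t)\|_{L^2(\mathbb{R})}\le C,\qquad\|\partial_tu_{\Delta x}(\cdot,t)\|_{L^2(\mathbb{R})}\le C,\qquad\|\partial_x^3u_{\Delta x}(\cdot,t)\|_{L^2(\mathbb{R})}\le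 C.$$ (b) Let $u_0\in H^3(\mathbb{R})$ with $\|u_0\|_{h^3}\le R$ for all sufficiently small $\Delta x$. Then there is $\delta>0$ (depending on $u_0$ and $\lambda$) such that for all $0<\Delta x\le\delta$ and $0<\Delta t\le\lambda\Delta x$, $$\|u_{\Delta x}(\cdot,t)\|_{L^2(\mathbb{R})}\le\|u_0\|_{L^2(\mathbb{R})}\qquad\text{for all }t\in[0,T].$$ Moreover, there is a unique solution $u$ of the KdV equation on $[0,T]$ with initial data $u_0$, and $u_{\Delta x}\to u$ uniformly on $\mathbb{R}\times[0,T]$ as $\Delta x\to0$, uniformly in $0<\Delta t\le\lambda\Delta x$. Here a solution is a function $u$ that is continuous on $\mathbb{R}\times[0,T]$, bounded in $H^3(\mathbb{R})$ and Lipschitz in time with values in $L^2(\mathbb{R})$, with $u(\cdot,0)=u_0$, such that for almost every $t\in(0,T)$ the time derivative of $t\mapsto u(\cdot,t)$ in $L^2(\mathbb{R})$ exists and equals $-(uu_x+u_{xxx})(\cdot,t)$. -/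

import Mathlib

open Set Filter Topology MeasureTheory

noncomputable section

namespace KdV

/-! ### Sobolev space on the line -/

/-- `g` is the `k`-th weak derivative of `f` on the real line (used for square integrable
`f` and `g` only). -/
def HasWeakDeriv (k : ℕ) (f g : ℝ → ℝ) : Prop :=
  ∀ φ : ℝ → ℝ, ContDiff ℝ (⊤ : ℕ∞) φ → HasCompactSupport φ →
    ∫ x, f x * iteratedDeriv k φ x = (-1) ^ k * ∫ x, g x * φ x

/-- `f` and its weak derivatives up to order three are square integrable, with norms at
most `M`. -/
def H3Bound (M : ℝ) (f : ℝ → ℝ) : Prop :=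
  MemLp f 2 volume ∧ ∀ k ≤ 3, ∃ g : ℝ → ℝ,
    MemLp g 2 volume ∧ HasWeakDeriv k f g ∧ eLpNorm g 2 volume ≤ ENNReal.ofReal M

/-- The Sobolev space `H³(ℝ)`. -/
def MemH3 (f : ℝ → ℝ) : Prop := ∃ M : ℝ, H3Bound M f

/-! ### Grid functions and difference operators with mesh width `dx` -/

/-- Forward difference quotient `D₊`. -/
def Dp (dx : ℝ) (v : ℤ → ℝ) (j : ℤ) : ℝ := (v (j + 1) - v j) / dx

/-- Backward difference quotient `D₋`. -/
def Dm (dx : ℝ) (v : ℤ → ℝ) (j : ℤ) : ℝ := (v j - v (j - 1)) / dx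

/-- Central difference quotient `D = (D₊ + D₋) / 2`. -/
def Dc (dx : ℝ) (v : ℤ → ℝ) (j : ℤ) : ℝ := (Dp dx v j + Dm dx v j) / 2

/-- Three point average. -/
def avg (v : ℤ → ℝ) (j : ℤ) : ℝ := (v (j + 1) + v j + v (j - 1)) / 3

/-- Square summable grid functions. -/
def MemL2 (v : ℤ → ℝ) : Prop := Summable fun j => v j ^ 2

/-- The discrete norm `(Δx ∑ vⱼ²)^(1/2)`. -/
def gridNorm (dx : ℝ) (v : ℤ → ℝ) : ℝ := √(dx * ∑' j, v j ^ 2)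

/-- The discrete Sobolev norm `h³`. -/
def h3Norm (dx : ℝ) (v : ℤ → ℝ) : ℝ :=
  gridNorm dx v + gridNorm dx (Dp dx v) + gridNorm dx (Dp dx (Dm dx v))
    + gridNorm dx (Dm dx (Dc dx (Dp dx v)))

/-- Values of a function at the grid points `xⱼ = j Δx`. -/
def sample (dx : ℝ) (f : ℝ → ℝ) (j : ℤ) : ℝ := f (j * dx)

/-! ### The Crank-Nicolson scheme -/

/-- The midpoint `u^{n+1/2} = (u^n + u^{n+1}) / 2`. -/
def half (u : ℕ → ℤ → ℝ) (n : ℕ) (j : ℤ) : ℝ := (u n j + u (n + 1) j) / 2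

/-- `u` is a square summable solution of the Crank-Nicolson scheme with initial values
sampled from `u₀`; all steps that start at a time `tₙ = n Δt ≤ T` are carried out, so that
the interpolant below is determined on `[0, T]`. -/
structure IsApproximation (dx dt T : ℝ) (u₀ : ℝ → ℝ) (u : ℕ → ℤ → ℝ) : Prop where
  initial : u 0 = sample dx u₀
  memL2 : ∀ n : ℕ, n * dt ≤ T → MemL2 (u n) ∧ MemL2 (u (n + 1))
  step : ∀ n : ℕ, n * dt ≤ T → ∀ j : ℤ,
    u (n + 1) j = u n j - dt * (avg (half u n) j * Dc dx (half u n) j)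
      - dt * Dm dx (Dc dx (Dp dx (half u n))) j

/-- Interpolation in space: on each cell `[xⱼ, xⱼ₊₁)`, where `j = ⌊x / Δx⌋`, a cubic
polynomial in `x - xⱼ`. -/
def spaceInterp (dx : ℝ) (v : ℤ → ℝ) (x : ℝ) : ℝ :=
  let j : ℤ := ⌊x / dx⌋
  v j + (x - j * dx) * Dp dx v j + 1 / 2 * (x - j * dx) ^ 2 * Dp dx (Dm dx v) j
    + 1 / 6 * (x - j * dx) ^ 3 * Dp dx (Dc dx (Dm dx v)) j

/-- Interpolation in space and time: for `t ∈ [tₙ, tₙ₊₁)`, that is `n = ⌊t / Δt⌋`, the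
interpolant is affine in `t`. -/
def interp (dx dt : ℝ) (u : ℕ → ℤ → ℝ) (x t : ℝ) : ℝ :=
  let n : ℕ := ⌊t / dt⌋₊
  spaceInterp dx (u n) x
    + (t - n * dt) * ((spaceInterp dx (u (n + 1)) x - spaceInterp dx (u n) x) / dt)

/-! ### Solutions of the KdV equation -/

/-- `U` (written `U x t`) solves `U_t + U U_x + U_xxx = 0` on `ℝ × [0, T]` with initial data
`u₀`, the equation being an identity in `L²(ℝ)`: `U` is continuous, is bounded in `H³(ℝ)`, is
Lipschitz continuous in time with values in `L²(ℝ)`, and for almost every time `t` its time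
derivative, a limit of difference quotients in `L²(ℝ)`, is `-(U U_x + U_xxx)`. -/
structure IsSolution (T : ℝ) (u₀ : ℝ → ℝ) (U : ℝ → ℝ → ℝ) : Prop where
  continuousOn : ContinuousOn (Function.uncurry U) (univ ×ˢ Icc 0 T)
  initial : ∀ x, U x 0 = u₀ x
  bounded : ∃ M : ℝ, ∀ t ∈ Icc 0 T, H3Bound M fun x => U x t
  lipschitz : ∃ M : ℝ, ∀ s ∈ Icc 0 T, ∀ t ∈ Icc 0 T,
    eLpNorm (fun x => U x s - U x t) 2 volume ≤ ENNReal.ofReal (M * |s - t|)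
  equation : ∀ᵐ t ∂(volume.restrict (Ioo 0 T)), ∃ p r : ℝ → ℝ,
    MemLp p 2 volume ∧ HasWeakDeriv 1 (fun x => U x t) p ∧
    MemLp r 2 volume ∧ HasWeakDeriv 3 (fun x => U x t) r ∧
    Tendsto (fun s => eLpNorm
      (fun x => (U x s - U x t) / (s - t) - (-(U x t * p x + r x))) 2 volume) (𝓝[≠] t) (𝓝 0)

end KdV

end

/-! The proof is an energy method in a discrete H³ norm, followed by a comparison of the scheme with
the equation in L².

Two algebraic facts make the scheme stable. The operator D₋DD₊ is skew (`Grid.inner_d3_self`), so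
dispersion contributes nothing to energy identities taken at the midpoint u^{n+1/2}. The three point
average makes the cubic form ⟨ũDu, u⟩ a telescoping sum, hence zero (`Grid.inner_Bl_self`), so the
discrete L² norm is conserved exactly. For the energy `Grid.N`, built from v, D₊D₋v and D₋DD₊v, the
Leibniz rule leaves a single term of top order, of the transport form ⟨a Dp, p⟩. Summation by parts
bounds it by the sup norm of D₊a, without negative powers of the mesh width, and the discrete
Sobolev inequality handles the rest (`Grid.energy_Bl_le`). So N² grows at a rate of at most 42 N³ at
the midpoint, a Riccati inequality, and stays bounded on a time interval that depends only on R.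
Each implicit step is solved by Lax-Milgram for a frozen coefficient and a contraction
(`Grid.exists_step`). It has no other square summable solution, because the polarized cubic identity
controls the difference of two solutions by a bound on one of them (`Grid.step_unique`).

To pass to the limit, grid functions become functions on the line by averaging step functions three
times (`smooth`). Each average turns a difference into a derivative, so the discrete energy bounds
the H³ norm, and averaging commutes with differentiation. The result solves KdV up to an error O(Δx
+ Δt) measured in the dual of H³ (`approxSol_smooth_path`). That weak measure suffices for stability
in L²: the difference of two approximate solutions is bounded in H³, hence is itself an admissible
test function, and Gronwall's inequality applies (`ApproxSol.stability`). Stability yields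
uniqueness, the Cauchy property of the approximations, and a rate of convergence. The limit is
bounded in H³ by weak compactness; its right-hand side is weakly continuous in time, hence
measurable, and the equation follows from its integrated form by Lebesgue differentiation
(`exists_sol_of_approxSol`). Interpolation with the H³ bound upgrades L² convergence to uniform
convergence.

The bound by ‖u₀‖ in L² holds without an error term and needs a finer comparison. The cubic
interpolation is smaller in L² than the grid function by (Δx²/2)‖D₊v‖² up to O(Δx³)
(`integral_spaceInterp_sq_le`), while the grid norm of the samples of u₀ exceeds ‖u₀‖ in square by
O(Δx³) only (`norm_sample_sq_le`). For u₀ ≠ 0 the norm of D₊v is bounded below for small Δx,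
uniformly in time, because ‖u_x‖ is (`Sol.exists_lower_bound`). So the second order gain wins. -/

noncomputable section

namespace KdV

open scoped InnerProductSpace

/-! ### The Hilbert space of square summable grid functions -/

/-- The Hilbert space of square summable grid functions. -/
abbrev Grid : Type := lp (fun _ : ℤ => ℝ) 2

lemma memL2_iff_memℓp {v : ℤ → ℝ} : MemL2 v ↔ Memℓp v 2 := by
  rw [memℓp_gen_iff (by norm_num)]
  simp [MemL2]

lemma Grid.memL2 (v : Grid) : MemL2 v := memL2_iff_memℓp.2 v.2

/-- A square summable grid function as an element of the Hilbert space. -/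
def Grid.mk (v : ℤ → ℝ) (h : MemL2 v) : Grid := ⟨v, memL2_iff_memℓp.1 h⟩

@[simp] lemma Grid.mk_apply (v : ℤ → ℝ) (h : MemL2 v) (j : ℤ) : Grid.mk v h j = v j := rfl

lemma Grid.inner_eq (u v : Grid) : ⟪u, v⟫_ℝ = ∑' j, u j * v j := by
  rw [lp.inner_eq_tsum]; simp [mul_comm]

lemma Grid.hasSum_inner (u v : Grid) : HasSum (fun j => u j * v j) ⟪u, v⟫_ℝ := by
  have := lp.hasSum_inner (𝕜 := ℝ) u v
  simpa [mul_comm] using this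

lemma Grid.norm_sq_eq (v : Grid) : ‖v‖ ^ 2 = ∑' j, v j ^ 2 := by
  rw [← real_inner_self_eq_norm_sq, Grid.inner_eq]; simp [sq]

lemma Grid.hasSum_norm_sq (v : Grid) : HasSum (fun j => v j ^ 2) (‖v‖ ^ 2) := by
  have := Grid.hasSum_inner v v
  rw [real_inner_self_eq_norm_sq] at this
  simpa [sq] using this

lemma Grid.abs_apply_le (v : Grid) (j : ℤ) : |v j| ≤ ‖v‖ := by
  simpa using lp.norm_apply_le_norm (by norm_num : (2 : ENNReal) ≠ 0) v j

lemma gridNorm_coe {dx : ℝ} (v : Grid) : gridNorm dx v = √dx * ‖v‖ := by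
  rw [gridNorm, ← Grid.norm_sq_eq, Real.sqrt_mul' _ (sq_nonneg _), Real.sqrt_sq (norm_nonneg _)]

lemma Grid.norm_le_of_sq_le (v : Grid) {c : ℝ} (hc : 0 ≤ c) {f : ℤ → ℝ} {s : ℝ}
    (hf : HasSum f s) (h : ∀ j, v j ^ 2 ≤ f j) (hs : s ≤ c ^ 2) : ‖v‖ ≤ c := by
  have := hasSum_le h v.hasSum_norm_sq hf
  exact abs_le_of_sq_le_sq' (this.trans hs) hc |>.2

lemma MemL2.shift {v : ℤ → ℝ} (hv : MemL2 v) (k : ℤ) : MemL2 fun j => v (j + k) := by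
  have : Summable ((fun j => v j ^ 2) ∘ Equiv.addRight k) :=
    (Equiv.addRight k).summable_iff.2 hv
  exact this

/-- Shift of a grid function, `(shift k v) j = v (j + k)`. -/
def Grid.shift (k : ℤ) : Grid →ₗᵢ[ℝ] Grid where
  toFun v := Grid.mk (fun j => v (j + k)) (v.memL2.shift k)
  map_add' u v := by ext j; simp
  map_smul' c v := by ext j; simp
  norm_map' v := by
    have h2 : HasSum ((fun j => v j ^ 2) ∘ Equiv.addRight k) (‖v‖ ^ 2) :=
      (Equiv.addRight k).hasSum_iff.2 v.hasSum_norm_sq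
    have h3 := Grid.hasSum_norm_sq (Grid.mk (fun j => v (j + k)) (v.memL2.shift k))
    exact (sq_eq_sq₀ (norm_nonneg _) (norm_nonneg _)).1 (h3.unique h2)

@[simp] lemma Grid.shift_apply (k : ℤ) (v : Grid) (j : ℤ) : Grid.shift k v j = v (j + k) := rfl

@[simp] lemma Grid.norm_shift (k : ℤ) (v : Grid) : ‖Grid.shift k v‖ = ‖v‖ :=
  (Grid.shift k).norm_map v

lemma Grid.memL2_mul (a w : Grid) : MemL2 fun j => a j * w j := by
  refine Summable.of_nonneg_of_le (fun j => sq_nonneg _) (fun j => ?_)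
    (w.memL2.mul_left (‖a‖ ^ 2))
  rw [mul_pow]
  exact mul_le_mul_of_nonneg_right
    (sq_le_sq.2 (by simpa using a.abs_apply_le j)) (sq_nonneg _)

/-- Pointwise product. -/
def Grid.mul (a w : Grid) : Grid := Grid.mk (fun j => a j * w j) (Grid.memL2_mul a w)

@[simp] lemma Grid.mul_apply (a w : Grid) (j : ℤ) : Grid.mul a w j = a j * w j := rfl

lemma Grid.norm_mul_le {a : Grid} {c : ℝ} (hc : 0 ≤ c) (ha : ∀ j, |a j| ≤ c) (w : Grid) :
    ‖Grid.mul a w‖ ≤ c * ‖w‖ := by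
  refine Grid.norm_le_of_sq_le _ (by positivity) (w.hasSum_norm_sq.mul_left (c ^ 2))
    (fun j => ?_) (by rw [mul_pow])
  rw [Grid.mul_apply, mul_pow]
  exact mul_le_mul_of_nonneg_right
    (sq_le_sq.2 ((ha j).trans (le_abs_self c))) (sq_nonneg _)

lemma Grid.mul_comm (a w : Grid) : Grid.mul a w = Grid.mul w a := by
  ext j; simp [_root_.mul_comm]

/-- Multiplication as a bounded operator. -/
def Grid.mulL (a : Grid) : Grid →L[ℝ] Grid :=
  LinearMap.mkContinuous
    { toFun := Grid.mul a
      map_add' := fun u v => by ext j; simp [mul_add]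
      map_smul' := fun c v => by ext j; simp [mul_left_comm] } ‖a‖
    (fun w => Grid.norm_mul_le (norm_nonneg _) (fun j => a.abs_apply_le j) w)

lemma Grid.abs_inner_mul_le {a : Grid} {c : ℝ} (hc : 0 ≤ c) (ha : ∀ j, |a j| ≤ c) (u w : Grid) :
    |⟪Grid.mul a u, w⟫_ℝ| ≤ c * ‖u‖ * ‖w‖ :=
  (abs_real_inner_le_norm _ _).trans
    (mul_le_mul_of_nonneg_right (Grid.norm_mul_le hc ha u) (norm_nonneg _))

variable (h : ℝ)

/-- Forward difference as a bounded operator. -/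
def Grid.dP : Grid →L[ℝ] Grid :=
  h⁻¹ • ((Grid.shift 1).toContinuousLinearMap - ContinuousLinearMap.id ℝ Grid)

/-- Backward difference as a bounded operator. -/
def Grid.dM : Grid →L[ℝ] Grid :=
  h⁻¹ • (ContinuousLinearMap.id ℝ Grid - (Grid.shift (-1)).toContinuousLinearMap)

/-- Central difference as a bounded operator. -/
def Grid.dC : Grid →L[ℝ] Grid :=
  (2⁻¹ : ℝ) • (Grid.dP h + Grid.dM h)

/-- Three point average as a bounded operator. -/
def Grid.av : Grid →L[ℝ] Grid :=
  (3⁻¹ : ℝ) • ((Grid.shift 1).toContinuousLinearMap + ContinuousLinearMap.id ℝ Grid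
    + (Grid.shift (-1)).toContinuousLinearMap)

@[simp] lemma Grid.dP_apply (v : Grid) (j : ℤ) : Grid.dP h v j = (v (j + 1) - v j) / h := by
  change h⁻¹ * (v (j + 1) - v j) = _
  ring

@[simp] lemma Grid.dM_apply (v : Grid) (j : ℤ) : Grid.dM h v j = (v j - v (j - 1)) / h := by
  change h⁻¹ * (v j - v (j + -1)) = _
  rw [← sub_eq_add_neg]; ring

@[simp] lemma Grid.dC_apply (v : Grid) (j : ℤ) :
    Grid.dC h v j = (v (j + 1) - v (j - 1)) / (2 * h) := by
  change 2⁻¹ * (Grid.dP h v j + Grid.dM h v j) = _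
  rw [Grid.dP_apply, Grid.dM_apply]; ring

@[simp] lemma Grid.av_apply (v : Grid) (j : ℤ) :
    Grid.av v j = (v (j + 1) + v j + v (j - 1)) / 3 := by
  change 3⁻¹ * (v (j + 1) + v j + v (j + -1)) = _
  rw [← sub_eq_add_neg]; ring

lemma Grid.coe_dP (v : Grid) : (Grid.dP h v : ℤ → ℝ) = Dp h v := by
  ext j; simp [Dp]

lemma Grid.coe_dM (v : Grid) : (Grid.dM h v : ℤ → ℝ) = Dm h v := by
  ext j; simp [Dm]

lemma Grid.coe_dC (v : Grid) : (Grid.dC h v : ℤ → ℝ) = Dc h v := by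
  ext j; simp [Dc, Dp, Dm]; ring

lemma Grid.coe_av (v : Grid) : (Grid.av v : ℤ → ℝ) = avg v := by
  ext j; simp [avg]

/-- Second difference `D₊D₋`. -/
def Grid.d2 : Grid →L[ℝ] Grid := (Grid.dP h).comp (Grid.dM h)

/-- Third difference `D₋DD₊`. -/
def Grid.d3 : Grid →L[ℝ] Grid := (Grid.dC h).comp (Grid.d2 h)

lemma Grid.d2_apply (v : Grid) (j : ℤ) :
    Grid.d2 h v j = (v (j + 1) - 2 * v j + v (j - 1)) / h ^ 2 := by
  change Grid.dP h (Grid.dM h v) j = _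
  simp; ring

lemma Grid.d3_apply (v : Grid) (j : ℤ) : Grid.d3 h v j
    = (v (j + 2) - 2 * v (j + 1) + 2 * v (j - 1) - v (j - 2)) / (2 * h ^ 3) := by
  change Grid.dC h (Grid.d2 h v) j = _
  rw [Grid.dC_apply, Grid.d2_apply, Grid.d2_apply]
  have e1 : j + 1 + 1 = j + 2 := by ring
  have e2 : j - 1 - 1 = j - 2 := by ring
  simp only [e1, e2, add_sub_cancel_right, sub_add_cancel]
  ring

lemma Grid.coe_d2 (v : Grid) : (Grid.d2 h v : ℤ → ℝ) = Dp h (Dm h v) := by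
  rw [← Grid.coe_dM, ← Grid.coe_dP]; rfl

lemma Grid.coe_d3 (v : Grid) : (Grid.d3 h v : ℤ → ℝ) = Dm h (Dc h (Dp h v)) := by
  rw [← Grid.coe_dP, ← Grid.coe_dC, ← Grid.coe_dM]
  ext j
  rw [Grid.d3_apply]
  simp only [Grid.dM_apply, Grid.dC_apply, Grid.dP_apply]
  have e1 : j + 1 + 1 = j + 2 := by ring
  have e2 : j - 1 - 1 = j - 2 := by ring
  simp only [e1, e2, sub_add_cancel]
  ring_nf

lemma Grid.coe_d3' (v : Grid) : (Grid.d3 h v : ℤ → ℝ) = Dp h (Dc h (Dm h v)) := by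
  rw [← Grid.coe_dM, ← Grid.coe_dC, ← Grid.coe_dP]
  ext j
  rw [Grid.d3_apply]
  simp only [Grid.dM_apply, Grid.dC_apply, Grid.dP_apply]
  have e1 : j + 1 + 1 = j + 2 := by ring
  have e2 : j - 1 - 1 = j - 2 := by ring
  simp only [e1, e2, add_sub_cancel_right]
  ring_nf

/-! ### Summation by parts -/

lemma Grid.inner_shift (k : ℤ) (u v : Grid) :
    ⟪Grid.shift k u, v⟫_ℝ = ⟪u, Grid.shift (-k) v⟫_ℝ := by
  have : v = Grid.shift k (Grid.shift (-k) v) := by ext j; simp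
  conv_lhs => rw [this]
  exact (Grid.shift k).inner_map_map _ _

lemma Grid.inner_dP (u v : Grid) : ⟪Grid.dP h u, v⟫_ℝ = -⟪u, Grid.dM h v⟫_ℝ := by
  simp only [Grid.dP, Grid.dM, _root_.smul_apply, _root_.sub_apply,
    ContinuousLinearMap.id_apply, LinearIsometry.coe_toContinuousLinearMap,
    real_inner_smul_left, real_inner_smul_right, inner_sub_left, inner_sub_right,
    Grid.inner_shift]
  ring

lemma Grid.inner_dM (u v : Grid) : ⟪Grid.dM h u, v⟫_ℝ = -⟪u, Grid.dP h v⟫_ℝ := by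
  rw [real_inner_comm, real_inner_comm (Grid.dP h v), Grid.inner_dP, neg_neg]

lemma Grid.inner_dC (u v : Grid) : ⟪Grid.dC h u, v⟫_ℝ = -⟪u, Grid.dC h v⟫_ℝ := by
  simp only [Grid.dC, _root_.smul_apply, _root_.add_apply,
    real_inner_smul_left, real_inner_smul_right, inner_add_left, inner_add_right,
    Grid.inner_dP, Grid.inner_dM]
  ring

lemma Grid.inner_d2 (u v : Grid) : ⟪Grid.d2 h u, v⟫_ℝ = ⟪u, Grid.d2 h v⟫_ℝ := by
  simp [Grid.d2, Grid.inner_dP, Grid.inner_dM]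

/-- The operator is the product of the skew `dC` and the symmetric `d2`, which commute, so it is
skew. The dispersive term therefore drops out of every energy identity. -/
lemma Grid.inner_d3_self (u : Grid) : ⟪Grid.d3 h u, u⟫_ℝ = 0 := by
  have h2 : Grid.d2 h (Grid.dC h u) = Grid.d3 h u := by
    ext j
    rw [Grid.d3_apply, Grid.d2_apply]
    simp only [Grid.dC_apply]
    have e1 : j + 1 + 1 = j + 2 := by ring
    have e2 : j - 1 - 1 = j - 2 := by ring
    simp only [e1, e2, add_sub_cancel_right, sub_add_cancel]
    ring
  have h1 : ⟪Grid.d3 h u, u⟫_ℝ = -⟪u, Grid.d3 h u⟫_ℝ := by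
    conv_lhs => rw [Grid.d3, ContinuousLinearMap.comp_apply, Grid.inner_dC, Grid.inner_d2, h2]
  rw [real_inner_comm] at h1
  rw [real_inner_comm]
  linarith

variable {h}

lemma Grid.norm_dP_sq (u : Grid) : ‖Grid.dP h u‖ ^ 2 = -⟪u, Grid.d2 h u⟫_ℝ := by
  rw [← real_inner_self_eq_norm_sq, Grid.inner_dP]
  congr 2; ext j; simp [Grid.d2]

lemma Grid.dM_eq (u : Grid) : Grid.dM h u = Grid.shift (-1) (Grid.dP h u) := by
  ext j; simp [← sub_eq_add_neg]

lemma Grid.norm_dM (u : Grid) : ‖Grid.dM h u‖ = ‖Grid.dP h u‖ := by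
  rw [Grid.dM_eq, Grid.norm_shift]

lemma Grid.norm_dC_le (u : Grid) : ‖Grid.dC h u‖ ≤ ‖Grid.dP h u‖ := by
  have : Grid.dC h u = (2⁻¹ : ℝ) • (Grid.dP h u + Grid.dM h u) := rfl
  rw [this, norm_smul]
  have := norm_add_le (Grid.dP h u) (Grid.dM h u)
  rw [Grid.norm_dM] at this
  norm_num; linarith

lemma Grid.norm_av_le (u : Grid) : ‖Grid.av u‖ ≤ ‖u‖ := by
  have : Grid.av u = (3⁻¹ : ℝ) • (Grid.shift 1 u + u + Grid.shift (-1) u) := rfl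
  rw [this, norm_smul]
  have := norm_add₃_le (a := Grid.shift 1 u) (b := u) (c := Grid.shift (-1) u)
  simp only [Grid.norm_shift] at this
  norm_num; linarith

/-- Discrete Sobolev inequality. -/
lemma Grid.sq_apply_le (hh : 0 < h) (a : Grid) (j : ℤ) :
    a j ^ 2 ≤ h * (‖a‖ ^ 2 + ‖Grid.dP h a‖ ^ 2) := by
  set B := h * (‖a‖ ^ 2 + ‖Grid.dP h a‖ ^ 2)
  have hinj : Function.Injective fun n : ℕ => j + (n : ℤ) := fun a b hab => by simpa using hab
  have key : ∀ n : ℕ, a j ^ 2 - a (j + n) ^ 2 ≤ B := by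
    intro n
    have e : a j ^ 2 - a (j + n) ^ 2
        = ∑ i ∈ Finset.range n, (a (j + i) ^ 2 - a (j + (i + 1 : ℕ)) ^ 2) := by
      rw [Finset.sum_range_sub' (fun i : ℕ => a (j + i) ^ 2)]; simp
    rw [e]
    -- Young's inequality for a_k² - a_{k+1}² = -h D₊a_k (a_k + a_{k+1}). The telescoping sum is
    -- then at most the full sum of `F`, and a_{j+n} tends to zero.
    set F : ℤ → ℝ := fun k => h * (Grid.dP h a k ^ 2 + (a k ^ 2 + a (k + 1) ^ 2) / 2) with hF
    have hFs : HasSum F B := by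
      have h1 := (Grid.dP h a).hasSum_norm_sq
      have h2 := a.hasSum_norm_sq
      have h3 := (Grid.shift 1 a).hasSum_norm_sq
      rw [Grid.norm_shift] at h3
      have := (h1.add ((h2.add h3).div_const 2)).mul_left h
      convert! this using 1
      simp only [B]; ring
    have hle : ∀ k : ℤ, a k ^ 2 - a (k + 1) ^ 2 ≤ F k := by
      intro k
      have e1 : a k - a (k + 1) = - (h * Grid.dP h a k) := by
        rw [Grid.dP_apply]; field_simp; ring
      have e2 : a k ^ 2 - a (k + 1) ^ 2 = - h * (Grid.dP h a k * (a k + a (k + 1))) := by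
        rw [show a k ^ 2 - a (k + 1) ^ 2 = (a k - a (k + 1)) * (a k + a (k + 1)) by ring, e1]; ring
      rw [e2, hF]
      simp only
      nlinarith [sq_nonneg (2 * Grid.dP h a k + (a k + a (k + 1))), sq_nonneg (a k - a (k + 1)),
        mul_nonneg hh.le (sq_nonneg (2 * Grid.dP h a k + (a k + a (k + 1)))),
        mul_nonneg hh.le (sq_nonneg (a k - a (k + 1)))]
    have hFn : ∀ k, 0 ≤ F k := fun k => by positivity
    calc _ ≤ ∑ i ∈ Finset.range n, F (j + i) := by
            refine Finset.sum_le_sum fun i _ => ?_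
            have := hle (j + i)
            push_cast at this ⊢
            rwa [add_assoc] at this
      _ = ∑ k ∈ (Finset.range n).map ⟨_, hinj⟩, F k := by rw [Finset.sum_map]; rfl
      _ ≤ B := sum_le_hasSum _ (fun k _ => hFn k) hFs
  have hlim : Tendsto (fun n : ℕ => a j ^ 2 - a (j + n) ^ 2) atTop (𝓝 (a j ^ 2 - 0)) := by
    have := (a.memL2.comp_injective hinj).tendsto_atTop_zero
    exact tendsto_const_nhds.sub this
  rw [sub_zero] at hlim
  exact le_of_tendsto' hlim key

end KdV
end

noncomputable section

namespace KdV

open scoped InnerProductSpace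

/-! ### The bilinear form of the scheme -/

/-- The frozen nonlinearity `ã D w`. -/
def Grid.Bl (h : ℝ) (a w : Grid) : Grid := Grid.mul (Grid.av a) (Grid.dC h w)

variable {h : ℝ}

lemma Grid.Bl_apply (a w : Grid) (j : ℤ) :
    Grid.Bl h a w j = (a (j + 1) + a j + a (j - 1)) / 3 * ((w (j + 1) - w (j - 1)) / (2 * h)) := by
  simp [Grid.Bl]

lemma Grid.Bl_add_left (a b w : Grid) : Grid.Bl h (a + b) w = Grid.Bl h a w + Grid.Bl h b w := by
  ext j; simp [Grid.Bl, add_mul]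

lemma Grid.Bl_add_right (a w z : Grid) : Grid.Bl h a (w + z) = Grid.Bl h a w + Grid.Bl h a z := by
  ext j; simp only [Grid.Bl, map_add, Grid.mul_apply, lp.coeFn_add, Pi.add_apply, mul_add]

lemma Grid.Bl_sub_left (a b w : Grid) : Grid.Bl h (a - b) w = Grid.Bl h a w - Grid.Bl h b w := by
  ext j; simp [Grid.Bl, sub_mul]

lemma Grid.Bl_sub_right (a w z : Grid) : Grid.Bl h a (w - z) = Grid.Bl h a w - Grid.Bl h a z := by
  ext j; simp only [Grid.Bl, map_sub, Grid.mul_apply, lp.coeFn_sub, Pi.sub_apply, mul_sub]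

lemma Grid.inner_mul_comm (a u w : Grid) : ⟪Grid.mul a u, w⟫_ℝ = ⟪Grid.mul a w, u⟫_ℝ := by
  simp only [Grid.inner_eq, Grid.mul_apply]
  congr 1; ext j; ring

/-- The transport form is bounded by the difference quotient of the coefficient. -/
lemma Grid.abs_inner_mul_dC_le (hh : 0 < h) {a : Grid} {c : ℝ} (hc : 0 ≤ c)
    (ha : ∀ j, |Grid.dP h a j| ≤ c) (p : Grid) :
    |⟪Grid.mul a (Grid.dC h p), p⟫_ℝ| ≤ c / 2 * ‖p‖ ^ 2 := by
  -- Shifting the index turns the sum of a_j p_{j-1} p_j into that of a_{j+1} p_j p_{j+1}. The two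
  -- halves of the central difference then combine into a difference of a, and no difference of p
  -- survives.
  have key : ⟪Grid.mul a (Grid.dC h p), p⟫_ℝ
      = -(1 / 2) * ⟪Grid.mul (Grid.dP h a) (Grid.shift 1 p), p⟫_ℝ := by
    have h1 := (Grid.hasSum_inner (Grid.mul a (Grid.shift 1 p)) p)
    have h2 := (Grid.hasSum_inner (Grid.mul a (Grid.shift (-1) p)) p)
    have h3 := Grid.hasSum_inner (Grid.mul (Grid.shift 1 a) p) (Grid.shift 1 p)
    have e1 : ⟪Grid.mul (Grid.shift 1 a) p, Grid.shift 1 p⟫_ℝ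
        = ⟪Grid.mul a (Grid.shift (-1) p), p⟫_ℝ := by
      rw [← (Grid.shift 1).inner_map_map (Grid.mul a (Grid.shift (-1) p)) p]
      congr 1; ext j; simp
    rw [← e1] at h2
    have h4 := ((h1.sub h3).mul_left (1 / (2 * h)))
    have h5 := ((h1.sub h2).mul_left (1 / (2 * h)))
    have h6 := Grid.hasSum_inner (Grid.mul a (Grid.dC h p)) p
    have h7 := (Grid.hasSum_inner (Grid.mul (Grid.dP h a) (Grid.shift 1 p)) p).mul_left (-(1 / 2))
    have h8 := h6.unique (by
      convert! h5 using 1; ext j; simp [← sub_eq_add_neg]; field_simp)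
    have h9 := h7.unique (by
      convert! h4 using 1; ext j; simp; field_simp; ring)
    exact h9.symm
  rw [key, abs_mul]
  have := Grid.abs_inner_mul_le hc ha (Grid.shift 1 p) p
  rw [Grid.norm_shift] at this
  norm_num
  nlinarith

lemma hasSum_shift_sub {g : ℤ → ℝ} (hg : Summable g) :
    HasSum (fun j => g (j + 1) - g j) 0 := by
  have h1 : HasSum (g ∘ Equiv.addRight (1 : ℤ)) (∑' j, g j) :=
    (Equiv.addRight (1 : ℤ)).hasSum_iff.2 hg.hasSum
  simpa using h1.sub hg.hasSum

lemma Grid.summable_mul₃ (a b c : Grid) : Summable fun j => a j * b j * c j :=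
  (Grid.hasSum_inner (Grid.mul a b) c).summable

/-- The cubic form `⟨ũ D u, u⟩` vanishes identically; this is its polarization. -/
lemma Grid.inner_Bl_polar (hh : 0 < h) (v e : Grid) :
    ⟪Grid.Bl h v e + Grid.Bl h e v, e⟫_ℝ = -⟪Grid.Bl h e e, v⟫_ℝ := by
  -- The product u_j (u_{j+1} + u_j + u_{j-1})(u_{j+1} - u_{j-1}) equals G_{j+1} - G_j with G_j =
  -- u_j u_{j-1}(u_j + u_{j-1}). For u = v + e, the part of G / (6h) that is linear in v and
  -- quadratic in e is `g`.
  set g : ℤ → ℝ := fun j => (e (j - 1) ^ 2 * v j + 2 * v (j - 1) * e (j - 1) * e j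
    + v (j - 1) * e j ^ 2 + 2 * e (j - 1) * v j * e j) / (6 * h) with hg
  have hs : Summable g := by
    have s1 := Grid.summable_mul₃ (Grid.shift (-1) e) (Grid.shift (-1) e) v
    have s2 := Grid.summable_mul₃ (Grid.shift (-1) v) (Grid.shift (-1) e) e
    have s3 := Grid.summable_mul₃ (Grid.shift (-1) v) e e
    have s4 := Grid.summable_mul₃ (Grid.shift (-1) e) v e
    have := (((s1.add (s2.mul_left 2)).add s3).add (s4.mul_left 2)).div_const (6 * h)
    refine this.congr fun j => ?_
    simp only [hg, Grid.shift_apply, ← sub_eq_add_neg]; ring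
  have h1 := Grid.hasSum_inner (Grid.Bl h v e + Grid.Bl h e v) e
  have h2 := Grid.hasSum_inner (Grid.Bl h e e) v
  have h3 := h1.add h2
  have h4 := hasSum_shift_sub hs
  have := h3.unique (by
    convert! h4 using 1; ext j
    simp only [lp.coeFn_add, Pi.add_apply, Grid.Bl_apply, hg, add_sub_cancel_right]
    field_simp; ring)
  linarith

/-- With v = e the polarized identity reads 2x = -x. This is the purpose of the three point average:
it makes the scheme conserve the ℓ² norm. -/
lemma Grid.inner_Bl_self (hh : 0 < h) (u : Grid) : ⟪Grid.Bl h u u, u⟫_ℝ = 0 := by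
  have := Grid.inner_Bl_polar hh u u
  rw [inner_add_left] at this
  linarith

/-- The product ẽ De is in conservation form, a forward difference of (e_j² + e_j e_{j-1} +
e_{j-1}²)/6 divided by h, so summation by parts moves the difference onto `v`. Nothing beyond ℓ² is
asked of `e`. -/
lemma Grid.abs_inner_Bl_le (hh : 0 < h) {v : Grid} {c : ℝ} (hc : 0 ≤ c)
    (hv : ∀ j, |Grid.dP h v j| ≤ c) (e : Grid) :
    |⟪Grid.Bl h e e, v⟫_ℝ| ≤ c / 2 * ‖e‖ ^ 2 := by
  have hdm : ∀ j, |Grid.dM h v j| ≤ c := fun j => by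
    rw [Grid.dM_eq]; exact hv _
  have key : ⟪Grid.Bl h e e, v⟫_ℝ = -(1 / 6) * (⟪Grid.mul (Grid.dP h v) e, e⟫_ℝ
      + ⟪Grid.mul (Grid.dM h v) e, e⟫_ℝ + ⟪Grid.mul (Grid.dP h v) e, Grid.shift 1 e⟫_ℝ) := by
    set g : ℤ → ℝ := fun j =>
      (v (j - 1) * e j ^ 2 + v j * e (j - 1) ^ 2 + v j * e j * e (j - 1)) / (6 * h) with hg
    have hs : Summable g := by
      have s1 := Grid.summable_mul₃ (Grid.shift (-1) v) e e
      have s2 := Grid.summable_mul₃ v (Grid.shift (-1) e) (Grid.shift (-1) e)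
      have s3 := Grid.summable_mul₃ v e (Grid.shift (-1) e)
      have := (((s1.add s2).add s3)).div_const (6 * h)
      refine this.congr fun j => ?_
      simp only [hg, Grid.shift_apply, ← sub_eq_add_neg]; ring
    have h1 := Grid.hasSum_inner (Grid.Bl h e e) v
    have h2 := (((Grid.hasSum_inner (Grid.mul (Grid.dP h v) e) e).add
      (Grid.hasSum_inner (Grid.mul (Grid.dM h v) e) e)).add
      (Grid.hasSum_inner (Grid.mul (Grid.dP h v) e) (Grid.shift 1 e))).mul_left (1 / 6)
    have h4 := hasSum_shift_sub hs
    have := (h1.add h2).unique (by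
      convert! h4 using 1; ext j
      simp only [Grid.Bl_apply, Grid.mul_apply, Grid.dP_apply, Grid.dM_apply, Grid.shift_apply, hg,
        add_sub_cancel_right]
      field_simp; ring)
    linarith
  have i1 := abs_le.1 (Grid.abs_inner_mul_le hc hv e e)
  have i2 := abs_le.1 (Grid.abs_inner_mul_le hc hdm e e)
  have i3 := Grid.abs_inner_mul_le hc hv e (Grid.shift 1 e)
  rw [Grid.norm_shift] at i3
  have i3 := abs_le.1 i3
  rw [key, abs_le]
  constructor <;> nlinarith

/-! ### The discrete energy -/

/-- The discrete `H³` energy norm. -/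
def Grid.N (h : ℝ) (v : Grid) : ℝ :=
  √(h * (‖v‖ ^ 2 + ‖Grid.d2 h v‖ ^ 2 + ‖Grid.d3 h v‖ ^ 2))

lemma Grid.N_nonneg (v : Grid) : 0 ≤ Grid.N h v := Real.sqrt_nonneg _

lemma Grid.N_sq (hh : 0 < h) (v : Grid) :
    Grid.N h v ^ 2 = h * (‖v‖ ^ 2 + ‖Grid.d2 h v‖ ^ 2 + ‖Grid.d3 h v‖ ^ 2) :=
  Real.sq_sqrt (by positivity)

/-- For fixed h the differences are bounded operators. Hence energy balls are closed in ℓ², which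
the fixed point argument needs. -/
lemma Grid.continuous_N : Continuous (Grid.N h) := by
  unfold Grid.N; fun_prop

lemma sqrt_mul_le_of_sq_le {c x s : ℝ} (hc : 0 ≤ c) (hs : 0 ≤ s) (h : c * x ^ 2 ≤ s ^ 2) :
    √c * x ≤ s := by
  refine (abs_le_of_sq_le_sq' ?_ hs).2
  rwa [mul_pow, Real.sq_sqrt hc]

lemma Grid.norm_le_N (hh : 0 < h) (v : Grid) : √h * ‖v‖ ≤ Grid.N h v := by
  refine sqrt_mul_le_of_sq_le hh.le (Grid.N_nonneg v) ?_
  rw [Grid.N_sq hh]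
  have := sq_nonneg ‖Grid.d2 h v‖; have := sq_nonneg ‖Grid.d3 h v‖
  gcongr; linarith

lemma Grid.norm_d2_le_N (hh : 0 < h) (v : Grid) : √h * ‖Grid.d2 h v‖ ≤ Grid.N h v := by
  refine sqrt_mul_le_of_sq_le hh.le (Grid.N_nonneg v) ?_
  rw [Grid.N_sq hh]
  have := sq_nonneg ‖v‖; have := sq_nonneg ‖Grid.d3 h v‖
  gcongr; linarith

lemma Grid.norm_d3_le_N (hh : 0 < h) (v : Grid) : √h * ‖Grid.d3 h v‖ ≤ Grid.N h v := by
  refine sqrt_mul_le_of_sq_le hh.le (Grid.N_nonneg v) ?_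
  rw [Grid.N_sq hh]
  have := sq_nonneg ‖Grid.d2 h v‖; have := sq_nonneg ‖v‖
  gcongr; linarith

/-- The first difference is absent from the energy and is recovered by interpolation: ‖D₊v‖² = -⟨v,
D₊D₋v⟩ ≤ ‖v‖ ‖D₊D₋v‖. -/
lemma Grid.norm_dP_le_N (hh : 0 < h) (v : Grid) : √h * ‖Grid.dP h v‖ ≤ Grid.N h v := by
  refine sqrt_mul_le_of_sq_le hh.le (Grid.N_nonneg v) ?_
  rw [Grid.N_sq hh, Grid.norm_dP_sq]
  have h1 := (neg_le_abs _).trans (abs_real_inner_le_norm v (Grid.d2 h v))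
  have := sq_nonneg (‖v‖ - ‖Grid.d2 h v‖)
  have := sq_nonneg ‖Grid.d3 h v‖
  gcongr
  nlinarith [sq_nonneg ‖v‖, sq_nonneg ‖Grid.d2 h v‖]

/-- Sup bound from two `ℓ²` bounds. -/
lemma Grid.abs_le_of_norms (hh : 0 < h) {a : Grid} {c : ℝ} (hc : 0 ≤ c) (h1 : √h * ‖a‖ ≤ c)
    (h2 : √h * ‖Grid.dP h a‖ ≤ c) (j : ℤ) : |a j| ≤ 2 * c := by
  have e1 := pow_le_pow_left₀ (by positivity) h1 2
  have e2 := pow_le_pow_left₀ (by positivity) h2 2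
  rw [mul_pow, Real.sq_sqrt hh.le] at e1 e2
  have := Grid.sq_apply_le hh a j
  refine abs_le_of_sq_le_sq ?_ (by positivity)
  nlinarith

lemma Grid.dP_dP (v : Grid) : Grid.dP h (Grid.dP h v) = Grid.shift 1 (Grid.d2 h v) := by
  ext j; simp [Grid.d2]

lemma Grid.dP_dC (v : Grid) :
    Grid.dP h (Grid.dC h v) = (2⁻¹ : ℝ) • (Grid.shift 1 (Grid.d2 h v) + Grid.d2 h v) := by
  ext j
  simp only [Grid.dP_apply, Grid.dC_apply, Grid.d2_apply, lp.coeFn_smul, lp.coeFn_add,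
    Pi.smul_apply, Pi.add_apply, Grid.shift_apply, smul_eq_mul]
  ring_nf

lemma Grid.norm_half_shift_le (k : ℤ) (u : Grid) : ‖(2⁻¹ : ℝ) • (Grid.shift k u + u)‖ ≤ ‖u‖ := by
  rw [norm_smul]
  have := norm_add_le (Grid.shift k u) u
  rw [Grid.norm_shift] at this
  norm_num; linarith

lemma Grid.norm_dP_dC_le (v : Grid) : ‖Grid.dP h (Grid.dC h v)‖ ≤ ‖Grid.d2 h v‖ := by
  rw [Grid.dP_dC]; exact Grid.norm_half_shift_le _ _

lemma Grid.dC_dC_eq (v : Grid) : Grid.dP h (Grid.dC h (Grid.dC h v))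
    = (2⁻¹ : ℝ) • (Grid.shift 1 (Grid.d3 h v) + Grid.d3 h v) := by
  have : Grid.dP h (Grid.dC h (Grid.dC h v)) = Grid.dC h (Grid.dP h (Grid.dC h v)) := by
    ext j; simp; ring_nf
  rw [this, Grid.dP_dC, map_smul, map_add]
  congr 2
  ext j; simp [Grid.d3]

lemma Grid.norm_dP_dP_dC (v : Grid) :
    ‖Grid.dP h (Grid.dP h (Grid.dC h v))‖ = ‖Grid.d3 h v‖ := by
  have : Grid.dP h (Grid.dP h (Grid.dC h v)) = Grid.shift 1 (Grid.d3 h v) := by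
    ext j; simp [Grid.d3, Grid.d2]; ring_nf
  rw [this, Grid.norm_shift]

/-! ### Sup norm bounds by the energy, for differences of order at most two -/

section bounds
variable (hh : 0 < h) (v : Grid)
include hh

lemma Grid.abs_apply_le_N (j : ℤ) : |v j| ≤ 2 * Grid.N h v :=
  Grid.abs_le_of_norms hh (Grid.N_nonneg v) (Grid.norm_le_N hh v) (Grid.norm_dP_le_N hh v) j

lemma Grid.abs_dP_le_N (j : ℤ) : |Grid.dP h v j| ≤ 2 * Grid.N h v :=
  Grid.abs_le_of_norms hh (Grid.N_nonneg v) (Grid.norm_dP_le_N hh v)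
    (by rw [Grid.dP_dP, Grid.norm_shift]; exact Grid.norm_d2_le_N hh v) j

lemma Grid.abs_dC_le_N (j : ℤ) : |Grid.dC h v j| ≤ 2 * Grid.N h v := by
  have h1 := abs_le.1 (Grid.abs_dP_le_N hh v j)
  have h2 := abs_le.1 (Grid.abs_dP_le_N hh v (j - 1))
  have : Grid.dC h v j = (Grid.dP h v j + Grid.dP h v (j - 1)) / 2 := by simp; ring
  rw [this, abs_le]; constructor <;> linarith

lemma Grid.abs_dC_dC_le_N (j : ℤ) : |Grid.dC h (Grid.dC h v) j| ≤ 2 * Grid.N h v := by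
  refine Grid.abs_le_of_norms hh (Grid.N_nonneg v) ?_ ?_ j
  · refine le_trans ?_ (Grid.norm_d2_le_N hh v)
    gcongr; exact (Grid.norm_dC_le _).trans (Grid.norm_dP_dC_le v)
  · refine le_trans ?_ (Grid.norm_d3_le_N hh v)
    gcongr; rw [Grid.dC_dC_eq]; exact Grid.norm_half_shift_le _ _

lemma Grid.abs_dP_dC_le_N (j : ℤ) : |Grid.dP h (Grid.dC h v) j| ≤ 2 * Grid.N h v := by
  refine Grid.abs_le_of_norms hh (Grid.N_nonneg v) ?_ ?_ j
  · refine le_trans ?_ (Grid.norm_d2_le_N hh v)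
    gcongr; exact Grid.norm_dP_dC_le v
  · rw [Grid.norm_dP_dP_dC]; exact Grid.norm_d3_le_N hh v

end bounds

/-! ### Averages and product rules -/

lemma Grid.abs_av_le {v : Grid} {c : ℝ} (hv : ∀ j, |v j| ≤ c) (j : ℤ) : |Grid.av v j| ≤ c := by
  have h1 := abs_le.1 (hv (j + 1)); have h2 := abs_le.1 (hv j); have h3 := abs_le.1 (hv (j - 1))
  rw [Grid.av_apply, abs_le]; constructor <;> linarith

lemma Grid.dP_av (v : Grid) : Grid.dP h (Grid.av v) = Grid.av (Grid.dP h v) := by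
  ext j; simp; ring_nf

lemma Grid.d2_av (v : Grid) : Grid.d2 h (Grid.av v) = Grid.av (Grid.d2 h v) := by
  ext j; simp [Grid.d2]; ring_nf

lemma Grid.dC_av (v : Grid) : Grid.dC h (Grid.av v) = Grid.av (Grid.dC h v) := by
  ext j; simp; ring_nf

lemma Grid.N_av_le (hh : 0 < h) (v : Grid) : Grid.N h (Grid.av v) ≤ Grid.N h v := by
  unfold Grid.N
  have : Grid.d3 h (Grid.av v) = Grid.av (Grid.d3 h v) := by
    simp only [Grid.d3, ContinuousLinearMap.comp_apply, Grid.d2_av, Grid.dC_av]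
  rw [this, Grid.d2_av]
  gcongr <;> exact Grid.norm_av_le _

/-- Leibniz bound for the central difference of a product. -/
lemma Grid.norm_dC_mul_le {f g : Grid} {c d : ℝ} (hc : 0 ≤ c) (hd : 0 ≤ d)
    (hf : ∀ j, |f j| ≤ c) (hg : ∀ j, |g j| ≤ d) :
    ‖Grid.dC h (Grid.mul f g)‖ ≤ c * ‖Grid.dC h g‖ + d * ‖Grid.dC h f‖ := by
  set μf : Grid := (2⁻¹ : ℝ) • (Grid.shift 1 f + Grid.shift (-1) f)
  set μg : Grid := (2⁻¹ : ℝ) • (Grid.shift 1 g + Grid.shift (-1) g)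
  have e : Grid.dC h (Grid.mul f g)
      = Grid.mul μf (Grid.dC h g) + Grid.mul μg (Grid.dC h f) := by
    ext j
    simp only [μf, μg, Grid.mul_apply, Grid.dC_apply, lp.coeFn_smul, lp.coeFn_add,
      Pi.smul_apply, Pi.add_apply, Grid.shift_apply, smul_eq_mul, ← sub_eq_add_neg]
    ring
  have b1 : ∀ j, |μf j| ≤ c := fun j => by
    have h1 := abs_le.1 (hf (j + 1)); have h2 := abs_le.1 (hf (j - 1))
    simp only [μf, lp.coeFn_smul, lp.coeFn_add, Pi.smul_apply, Pi.add_apply, Grid.shift_apply,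
      smul_eq_mul, ← sub_eq_add_neg]
    rw [abs_le]; constructor <;> linarith
  have b2 : ∀ j, |μg j| ≤ d := fun j => by
    have h1 := abs_le.1 (hg (j + 1)); have h2 := abs_le.1 (hg (j - 1))
    simp only [μg, lp.coeFn_smul, lp.coeFn_add, Pi.smul_apply, Pi.add_apply, Grid.shift_apply,
      smul_eq_mul, ← sub_eq_add_neg]
    rw [abs_le]; constructor <;> linarith
  rw [e]
  exact (norm_add_le _ _).trans
    (add_le_add (Grid.norm_mul_le hc b1 _) (Grid.norm_mul_le hd b2 _))

/-- Leibniz bound with both derivatives of one factor in the sup norm. -/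
lemma Grid.norm_dC_mul_le' {f g : Grid} {c d : ℝ} (hc : 0 ≤ c) (hd : 0 ≤ d)
    (hg' : ∀ j, |Grid.dC h g j| ≤ c) (hg : ∀ j, |g j| ≤ d) :
    ‖Grid.dC h (Grid.mul f g)‖ ≤ c * ‖f‖ + d * ‖Grid.dC h f‖ := by
  set μf : Grid := (2⁻¹ : ℝ) • (Grid.shift 1 f + Grid.shift (-1) f)
  set μg : Grid := (2⁻¹ : ℝ) • (Grid.shift 1 g + Grid.shift (-1) g)
  have e : Grid.dC h (Grid.mul f g)
      = Grid.mul (Grid.dC h g) μf + Grid.mul μg (Grid.dC h f) := by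
    ext j
    simp only [μf, μg, Grid.mul_apply, Grid.dC_apply, lp.coeFn_smul, lp.coeFn_add,
      Pi.smul_apply, Pi.add_apply, Grid.shift_apply, smul_eq_mul, ← sub_eq_add_neg]
    ring
  have b1 : ‖μf‖ ≤ ‖f‖ := by
    simp only [μf]
    rw [norm_smul]
    have := norm_add_le (Grid.shift 1 f) (Grid.shift (-1) f)
    simp only [Grid.norm_shift] at this
    norm_num; linarith
  have b2 : ∀ j, |μg j| ≤ d := fun j => by
    have h1 := abs_le.1 (hg (j + 1)); have h2 := abs_le.1 (hg (j - 1))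
    simp only [μg, lp.coeFn_smul, lp.coeFn_add, Pi.smul_apply, Pi.add_apply, Grid.shift_apply,
      smul_eq_mul, ← sub_eq_add_neg]
    rw [abs_le]; constructor <;> linarith
  rw [e]
  refine (norm_add_le _ _).trans (add_le_add ?_ (Grid.norm_mul_le hd b2 _))
  exact (Grid.norm_mul_le hc hg' _).trans (by gcongr)

/-- An exact Leibniz rule. When g is a first difference of w, only the first summand carries a third
difference of w. -/
lemma Grid.d2_mul (f g : Grid) : Grid.d2 h (Grid.mul f g)
    = Grid.mul f (Grid.d2 h g) + (Grid.mul (Grid.d2 h f) g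
      + Grid.mul (Grid.dP h f) (Grid.dP h g)
      + Grid.shift (-1) (Grid.mul (Grid.dP h f) (Grid.dP h g))) := by
  ext j; simp [Grid.d2, ← sub_eq_add_neg]; ring

lemma Grid.d2_dC (w : Grid) : Grid.d2 h (Grid.dC h w) = Grid.dC h (Grid.d2 h w) := by
  ext j; simp [Grid.d2]; ring_nf

/-- The energy estimate for the frozen nonlinearity. -/
lemma Grid.energy_Bl_le (hh : 0 < h) (v w : Grid) :
    h * (|⟪Grid.Bl h v w, w⟫_ℝ| + |⟪Grid.d2 h (Grid.Bl h v w), Grid.d2 h w⟫_ℝ|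
      + |⟪Grid.d3 h (Grid.Bl h v w), Grid.d3 h w⟫_ℝ|) ≤ 21 * (Grid.N h v * Grid.N h w ^ 2) := by
  set a := Grid.av v
  set V := Grid.N h v
  set W := Grid.N h w
  have hV : 0 ≤ V := Grid.N_nonneg v
  have hW : 0 ≤ W := Grid.N_nonneg w
  set s := √h
  have hs : 0 ≤ s := Real.sqrt_nonneg _
  have hss : s * s = h := Real.mul_self_sqrt hh.le
  have haV : Grid.N h a ≤ V := Grid.N_av_le hh v
  have da : ∀ j, |Grid.dP h a j| ≤ 2 * V := fun j =>
    (Grid.abs_dP_le_N hh a j).trans (by linarith)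
  -- The transport form costs only the sup norm of D₊ã. It is used for p = w, D₊D₋w and D₋DD₊w.
  have T : ∀ p : Grid, |⟪Grid.mul a (Grid.dC h p), p⟫_ℝ| ≤ V * ‖p‖ ^ 2 := fun p => by
    have := Grid.abs_inner_mul_dC_le hh (by positivity) da p
    linarith
  set R := Grid.mul (Grid.d2 h a) (Grid.dC h w) + Grid.mul (Grid.dP h a) (Grid.dP h (Grid.dC h w))
    + Grid.shift (-1) (Grid.mul (Grid.dP h a) (Grid.dP h (Grid.dC h w))) with hR
  -- The commutator terms in `R` have at most two differences on either factor, so that one further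
  -- difference is still under control.
  have hd2 : Grid.d2 h (Grid.Bl h v w) = Grid.mul a (Grid.d3 h w) + R := by
    rw [Grid.Bl, Grid.d2_mul, Grid.d2_dC]; rfl
  have n0 := Grid.norm_le_N hh w
  have n2 := Grid.norm_d2_le_N hh w
  have n3 := Grid.norm_d3_le_N hh w
  have a1 := (Grid.norm_dP_le_N hh a).trans haV
  have a2 := (Grid.norm_d2_le_N hh a).trans haV
  have a3 := (Grid.norm_d3_le_N hh a).trans haV
  have c1 := Grid.abs_dC_le_N hh w
  have c2 := Grid.abs_dC_dC_le_N hh w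
  have c3 := Grid.abs_dP_dC_le_N hh w
  have hRn : s * ‖R‖ ≤ 6 * (V * W) := by
    have r1 : ‖Grid.mul (Grid.d2 h a) (Grid.dC h w)‖ ≤ 2 * W * ‖Grid.d2 h a‖ := by
      rw [Grid.mul_comm]; exact Grid.norm_mul_le (by positivity) c1 _
    have r2 : ‖Grid.mul (Grid.dP h a) (Grid.dP h (Grid.dC h w))‖ ≤ 2 * W * ‖Grid.dP h a‖ := by
      rw [Grid.mul_comm]; exact Grid.norm_mul_le (by positivity) c3 _
    have r3 : ‖R‖ ≤ 2 * W * ‖Grid.d2 h a‖ + 2 * W * ‖Grid.dP h a‖ + 2 * W * ‖Grid.dP h a‖ := by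
      refine (norm_add₃_le).trans ?_
      rw [Grid.norm_shift]; gcongr
    calc s * ‖R‖ ≤ 2 * W * (s * ‖Grid.d2 h a‖) + 2 * W * (s * ‖Grid.dP h a‖)
          + 2 * W * (s * ‖Grid.dP h a‖) := by nlinarith
      _ ≤ 2 * W * V + 2 * W * V + 2 * W * V := by gcongr
      _ = _ := by ring
  -- Every summand has at most three differences on one factor, which is taken in ℓ², and at most
  -- two on the other, which is bounded in the sup norm.
  have hdR : s * ‖Grid.dC h R‖ ≤ 12 * (V * W) := by
    have r1 : ‖Grid.dC h (Grid.mul (Grid.d2 h a) (Grid.dC h w))‖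
        ≤ 2 * W * ‖Grid.d2 h a‖ + 2 * W * ‖Grid.d3 h a‖ :=
      Grid.norm_dC_mul_le' (by positivity) (by positivity) c2 c1
    have r2 : ‖Grid.dC h (Grid.mul (Grid.dP h a) (Grid.dP h (Grid.dC h w)))‖
        ≤ 2 * V * ‖Grid.d3 h w‖ + 2 * W * ‖Grid.d2 h a‖ := by
      refine (Grid.norm_dC_mul_le (c := 2 * V) (d := 2 * W) (by positivity) (by positivity)
        da c3).trans ?_
      gcongr
      · refine (Grid.norm_dC_le _).trans ?_; rw [Grid.norm_dP_dP_dC]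
      · refine (Grid.norm_dC_le _).trans ?_; rw [Grid.dP_dP, Grid.norm_shift]
    have r3 : ‖Grid.dC h R‖ ≤ (2 * W * ‖Grid.d2 h a‖ + 2 * W * ‖Grid.d3 h a‖)
        + (2 * V * ‖Grid.d3 h w‖ + 2 * W * ‖Grid.d2 h a‖)
        + (2 * V * ‖Grid.d3 h w‖ + 2 * W * ‖Grid.d2 h a‖) := by
      have e : ∀ f : Grid, Grid.dC h (Grid.shift (-1) f) = Grid.shift (-1) (Grid.dC h f) := by
        intro f; ext j; simp; ring_nf
      rw [hR, map_add, map_add, e]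
      refine (norm_add₃_le).trans ?_
      rw [Grid.norm_shift]; gcongr
    calc s * ‖Grid.dC h R‖ ≤ (2 * W * (s * ‖Grid.d2 h a‖) + 2 * W * (s * ‖Grid.d3 h a‖))
        + (2 * V * (s * ‖Grid.d3 h w‖) + 2 * W * (s * ‖Grid.d2 h a‖))
        + (2 * V * (s * ‖Grid.d3 h w‖) + 2 * W * (s * ‖Grid.d2 h a‖)) := by nlinarith
      _ ≤ (2 * W * V + 2 * W * V) + (2 * V * W + 2 * W * V) + (2 * V * W + 2 * W * V) := by
        gcongr
      _ = _ := by ring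
  have E0 : |⟪Grid.Bl h v w, w⟫_ℝ| ≤ V * ‖w‖ ^ 2 := T w
  have E2 : |⟪Grid.d2 h (Grid.Bl h v w), Grid.d2 h w⟫_ℝ|
      ≤ V * ‖Grid.d2 h w‖ ^ 2 + ‖R‖ * ‖Grid.d2 h w‖ := by
    rw [hd2, inner_add_left]
    refine (abs_add_le _ _).trans (add_le_add ?_ (abs_real_inner_le_norm _ _))
    exact T (Grid.d2 h w)
  have E3 : |⟪Grid.d3 h (Grid.Bl h v w), Grid.d3 h w⟫_ℝ|
      ≤ V * ‖Grid.d3 h w‖ ^ 2 + ‖Grid.dC h R‖ * ‖Grid.d3 h w‖ := by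
    have : Grid.d3 h (Grid.Bl h v w)
        = Grid.dC h (Grid.mul a (Grid.d3 h w)) + Grid.dC h R := by
      rw [← map_add, ← hd2]; rfl
    rw [this, inner_add_left]
    refine (abs_add_le _ _).trans (add_le_add ?_ (abs_real_inner_le_norm _ _))
    -- ⟨D(ap), p⟩ = -⟨a Dp, p⟩ is the transport form again, with p the third difference of w.
    rw [Grid.inner_dC, abs_neg, Grid.inner_mul_comm]
    exact T _
  have q0 : h * ‖w‖ ^ 2 ≤ W ^ 2 := by
    rw [show h * ‖w‖ ^ 2 = (s * ‖w‖) ^ 2 by rw [mul_pow, Real.sq_sqrt hh.le]]; gcongr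
  have q2 : h * ‖Grid.d2 h w‖ ^ 2 ≤ W ^ 2 := by
    rw [show h * ‖Grid.d2 h w‖ ^ 2 = (s * ‖Grid.d2 h w‖) ^ 2 by rw [mul_pow, Real.sq_sqrt hh.le]]; gcongr
  have q3 : h * ‖Grid.d3 h w‖ ^ 2 ≤ W ^ 2 := by
    rw [show h * ‖Grid.d3 h w‖ ^ 2 = (s * ‖Grid.d3 h w‖) ^ 2 by rw [mul_pow, Real.sq_sqrt hh.le]]; gcongr
  calc _ ≤ h * (V * ‖w‖ ^ 2 + (V * ‖Grid.d2 h w‖ ^ 2 + ‖R‖ * ‖Grid.d2 h w‖)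
        + (V * ‖Grid.d3 h w‖ ^ 2 + ‖Grid.dC h R‖ * ‖Grid.d3 h w‖)) := by gcongr
    _ = V * (h * ‖w‖ ^ 2) + V * (h * ‖Grid.d2 h w‖ ^ 2) + V * (h * ‖Grid.d3 h w‖ ^ 2)
        + (s * ‖R‖) * (s * ‖Grid.d2 h w‖) + (s * ‖Grid.dC h R‖) * (s * ‖Grid.d3 h w‖) := by
        linear_combination (-(‖R‖ * ‖Grid.d2 h w‖) - ‖Grid.dC h R‖ * ‖Grid.d3 h w‖) * hss
    -- 21 = 3 + 6 + 12: three transport terms and the two commutator terms.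
    _ ≤ V * W ^ 2 + V * W ^ 2 + V * W ^ 2 + (6 * (V * W)) * W + (12 * (V * W)) * W := by
        gcongr
    _ = _ := by ring

end KdV
end

noncomputable section

namespace KdV

open scoped InnerProductSpace

variable {h : ℝ}

/-! ### One step of the scheme -/

lemma Grid.abs_inner_Bl_frozen_le (hh : 0 < h) (v w : Grid) :
    |⟪Grid.Bl h v w, w⟫_ℝ| ≤ Grid.N h v * ‖w‖ ^ 2 := by
  have := Grid.abs_inner_mul_dC_le hh (c := 2 * Grid.N h v)
    (mul_nonneg zero_le_two (Grid.N_nonneg v))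
    (fun j => (Grid.abs_dP_le_N hh (Grid.av v) j).trans
      (mul_le_mul_of_nonneg_left (Grid.N_av_le hh v) zero_le_two)) w
  rw [Grid.Bl]; linarith

/-- The linear operator `2 + Δt (ṽ D + D₋DD₊)`. -/
def Grid.stepOp (h dt : ℝ) (v : Grid) : Grid →L[ℝ] Grid :=
  (2 : ℝ) • ContinuousLinearMap.id ℝ Grid
    + dt • ((Grid.mulL (Grid.av v)).comp (Grid.dC h) + Grid.d3 h)

lemma Grid.stepOp_apply (dt : ℝ) (v w : Grid) :
    Grid.stepOp h dt v w = (2 : ℝ) • w + dt • (Grid.Bl h v w + Grid.d3 h w) := rfl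

/-- Lax-Milgram: pairing with w removes the dispersive term, and the transport form is at most
N(v)‖w‖², so the form is coercive with constant 2 - Δt N(v) ≥ 1. -/
lemma Grid.exists_stepOp_eq (hh : 0 < h) {dt : ℝ} (hdt : 0 < dt) {v : Grid}
    (hv : dt * Grid.N h v ≤ 1) (u : Grid) : ∃ w, Grid.stepOp h dt v w = u := by
  let B : Grid →L[ℝ] Grid →L[ℝ] ℝ := (innerSL ℝ).comp (Grid.stepOp h dt v)
  have hB : ∀ x y, B x y = ⟪Grid.stepOp h dt v x, y⟫_ℝ := fun x y => rfl
  have hc : IsCoercive B := by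
    refine ⟨1, one_pos, fun w => ?_⟩
    rw [hB, Grid.stepOp_apply, inner_add_left, real_inner_smul_left, real_inner_smul_left,
      inner_add_left, Grid.inner_d3_self, real_inner_self_eq_norm_sq, add_zero]
    have h1 := (abs_le.1 (Grid.abs_inner_Bl_frozen_le hh v w)).1
    have h2 : dt * (-(Grid.N h v * ‖w‖ ^ 2)) ≤ dt * ⟪Grid.Bl h v w, w⟫_ℝ := by gcongr
    have h3 : dt * Grid.N h v * ‖w‖ ^ 2 ≤ 1 * ‖w‖ ^ 2 := by gcongr
    nlinarith
  refine ⟨hc.continuousLinearEquivOfBilin.symm u, ?_⟩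
  refine ext_inner_right ℝ fun y => ?_
  rw [← hB, ← hc.continuousLinearEquivOfBilin_apply]
  simp

lemma Grid.d3_d2 (w : Grid) : Grid.d2 h (Grid.d3 h w) = Grid.d3 h (Grid.d2 h w) := by
  simp [Grid.d3, Grid.d2_dC]

lemma two_inner_sub_ge (a b : Grid) : ‖a‖ ^ 2 - ‖b‖ ^ 2 ≤ 2 * ⟪a - b, a⟫_ℝ := by
  rw [inner_sub_left, real_inner_self_eq_norm_sq]
  have := real_inner_le_norm b a
  nlinarith [sq_nonneg (‖a‖ - ‖b‖)]

/-- Apply 1, D₊D₋ and D₋DD₊ to the equation and pair with the same operator applied to w. All three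
commute with the dispersive term, which therefore vanishes, and `energy_Bl_le` bounds the nonlinear
terms. -/
lemma Grid.N_sq_le_of_stepOp (hh : 0 < h) {dt : ℝ} (hdt : 0 < dt) {u v w : Grid}
    (hw : Grid.stepOp h dt v w = (2 : ℝ) • u) :
    Grid.N h w ^ 2 ≤ Grid.N h u ^ 2 + 21 * (dt * Grid.N h v * Grid.N h w ^ 2) := by
  have key : ∀ X : Grid →L[ℝ] Grid, (X (Grid.d3 h w) = Grid.d3 h (X w)) →
      ‖X w‖ ^ 2 - ‖X u‖ ^ 2 ≤ dt * |⟪X (Grid.Bl h v w), X w⟫_ℝ| := by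
    intro X hX
    have h1 := congrArg X hw
    rw [Grid.stepOp_apply, map_add, map_smul, map_smul, map_smul, map_add, hX] at h1
    have h2 : (2 : ℝ) • (X w - X u) = - (dt • (X (Grid.Bl h v w) + Grid.d3 h (X w))) := by
      rw [smul_sub, ← h1]; abel
    have h3 := congrArg (fun z => ⟪z, X w⟫_ℝ) h2
    simp only [real_inner_smul_left, inner_neg_left, inner_add_left, Grid.inner_d3_self,
      add_zero] at h3
    have h4 := two_inner_sub_ge (X w) (X u)
    have h5 : -(dt * ⟪X (Grid.Bl h v w), X w⟫_ℝ) ≤ dt * |⟪X (Grid.Bl h v w), X w⟫_ℝ| := by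
      rw [← mul_neg]; exact mul_le_mul_of_nonneg_left (neg_le_abs _) hdt.le
    linarith
  have k0 := key (ContinuousLinearMap.id ℝ Grid) rfl
  have k2 := key (Grid.d2 h) (Grid.d3_d2 w)
  have k3 := key (Grid.d3 h) rfl
  have e := mul_le_mul_of_nonneg_left (Grid.energy_Bl_le hh v w) hdt.le
  simp only [ContinuousLinearMap.id_apply] at k0
  have := mul_le_mul_of_nonneg_left (add_le_add (add_le_add k0 k2) k3) hh.le
  rw [Grid.N_sq hh w, Grid.N_sq hh u] at *
  nlinarith

/-- One step of the scheme from `u` to `u'`. -/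
def Grid.Step (h dt : ℝ) (u u' : Grid) : Prop :=
  u' = u - dt • (Grid.Bl h ((2⁻¹ : ℝ) • (u + u')) ((2⁻¹ : ℝ) • (u + u'))
    + Grid.d3 h ((2⁻¹ : ℝ) • (u + u')))

/-- The unknown is changed to the midpoint w, for which the step reads 2w + Δt (w̃ Dw + D₋DD₊w) =
2u. This separates the coefficient from the unknown. -/
lemma Grid.step_iff {dt : ℝ} {u u' : Grid} :
    Grid.Step h dt u u' ↔
      Grid.stepOp h dt ((2⁻¹ : ℝ) • (u + u')) ((2⁻¹ : ℝ) • (u + u')) = (2 : ℝ) • u := by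
  set w := (2⁻¹ : ℝ) • (u + u') with hw
  have h2 : (2 : ℝ) • w = u + u' := by rw [hw, smul_smul]; norm_num
  rw [Grid.stepOp_apply, h2, two_smul]
  unfold Grid.Step
  rw [← hw]
  constructor
  · intro e
    rw [← sub_eq_zero] at e ⊢
    rw [← e]; abel
  · intro e
    have := congrArg (fun z => z - u - dt • (Grid.Bl h w w + Grid.d3 h w)) e
    simp only [add_sub_cancel_right] at this
    rw [← sub_eq_zero] at this ⊢
    rw [← this]; abel

/-- Picard iteration on the frozen coefficient. The energy estimate keeps the ball of radius 2N(u)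
invariant, while the map contracts in the weaker ℓ² norm, in which that ball is complete. -/
lemma Grid.exists_step (hh : 0 < h) {dt : ℝ} (hdt : 0 < dt) {u : Grid}
    (hu : 84 * (dt * Grid.N h u) ≤ 1) :
    ∃ u', Grid.Step h dt u u' ∧ Grid.N h ((2⁻¹ : ℝ) • (u + u')) ≤ 2 * Grid.N h u := by
  set ν := Grid.N h u with hν
  have hν0 : 0 ≤ ν := Grid.N_nonneg u
  let K : Set Grid := {v | Grid.N h v ≤ 2 * ν}
  have hK : IsClosed K := isClosed_le Grid.continuous_N continuous_const
  have hex : ∀ v : K, ∃ w : K, Grid.stepOp h dt v w = (2 : ℝ) • u := by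
    rintro ⟨v, hv⟩
    have hv' : dt * Grid.N h v ≤ dt * (2 * ν) := mul_le_mul_of_nonneg_left hv hdt.le
    obtain ⟨w, hw⟩ := Grid.exists_stepOp_eq hh hdt (v := v) (by nlinarith) ((2 : ℝ) • u)
    refine ⟨⟨w, ?_⟩, hw⟩
    have h1 := Grid.N_sq_le_of_stepOp hh hdt hw
    have h2 : dt * Grid.N h v * Grid.N h w ^ 2 ≤ dt * (2 * ν) * Grid.N h w ^ 2 := by gcongr
    have h3 : (84 * (dt * ν)) * Grid.N h w ^ 2 ≤ 1 * Grid.N h w ^ 2 := by gcongr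
    -- Since 42 Δt ν ≤ 1/2, the estimate reads N(w)² ≤ ν² + N(w)²/2, that is N(w)² ≤ 2ν².
    refine (abs_le_of_sq_le_sq' (?_ : Grid.N h w ^ 2 ≤ (2 * ν) ^ 2) (by positivity)).2
    nlinarith
  choose Φ hΦ using hex
  have : CompleteSpace K := hK.completeSpace_coe
  have : Nonempty K := ⟨⟨u, by change Grid.N h u ≤ 2 * ν; linarith⟩⟩
  have hcontr : ContractingWith (1 / 2) Φ := by
    refine ⟨by norm_num, LipschitzWith.of_dist_le_mul fun v₁ v₂ => ?_⟩
    set w₁ : Grid := (Φ v₁ : Grid) with hw₁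
    set w₂ : Grid := (Φ v₂ : Grid) with hw₂
    set e := w₁ - w₂ with he
    have h1 := hΦ v₁
    have h2 := hΦ v₂
    rw [← hw₁, Grid.stepOp_apply] at h1
    rw [← hw₂, Grid.stepOp_apply] at h2
    have heq : (2 : ℝ) • e + dt • (Grid.Bl h v₁ e + Grid.Bl h (v₁ - v₂) w₂ + Grid.d3 h e) = 0 := by
      have := sub_eq_zero.2 (h1.trans h2.symm)
      rw [← this, he, Grid.Bl_sub_right, Grid.Bl_sub_left, map_sub]
      module
    have h3 := congrArg (fun z => ⟪z, e⟫_ℝ) heq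
    simp only [real_inner_smul_left, inner_add_left, Grid.inner_d3_self, add_zero,
      inner_zero_left, real_inner_self_eq_norm_sq] at h3
    have b1 := abs_le.1 (Grid.abs_inner_Bl_frozen_le hh (v₁ : Grid) e)
    have hNw : Grid.N h w₂ ≤ 2 * ν := (Φ v₂).2
    have hNv : Grid.N h v₁ ≤ 2 * ν := v₁.2
    -- The difference of the coefficients is needed in ℓ² only, because D of the known solution w₂
    -- is bounded in the sup norm by its energy.
    have b2 : |⟪Grid.Bl h ((v₁ : Grid) - v₂) w₂, e⟫_ℝ| ≤ 4 * ν * ‖(v₁ : Grid) - v₂‖ * ‖e‖ := by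
      rw [Grid.Bl, Grid.mul_comm]
      refine (Grid.abs_inner_mul_le (c := 4 * ν) (by positivity)
        (fun j => (Grid.abs_dC_le_N hh w₂ j).trans (by linarith)) _ _).trans ?_
      gcongr; exact Grid.norm_av_le _
    have b2 := abs_le.1 b2
    set D := ‖(v₁ : Grid) - v₂‖
    have m1 : dt * ⟪Grid.Bl h v₁ e, e⟫_ℝ ≥ -(dt * (2 * ν) * ‖e‖ ^ 2) := by
      have : Grid.N h v₁ * ‖e‖ ^ 2 ≤ 2 * ν * ‖e‖ ^ 2 := by gcongr
      nlinarith
    have m2 : dt * ⟪Grid.Bl h ((v₁ : Grid) - v₂) w₂, e⟫_ℝ ≥ -(dt * ν * (4 * D * ‖e‖)) := by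
      nlinarith
    have m3 : dt * ν * ‖e‖ ^ 2 ≤ 1 / 84 * ‖e‖ ^ 2 := by gcongr; linarith
    have m4 : dt * ν * (4 * D * ‖e‖) ≤ 1 / 84 * (4 * D * ‖e‖) := by gcongr; linarith
    have hfin : ‖e‖ * ‖e‖ ≤ (1 / 2 * D) * ‖e‖ := by
      have : 0 ≤ D * ‖e‖ := by positivity
      nlinarith
    have : ‖e‖ ≤ 1 / 2 * D := by
      rcases (norm_nonneg e).eq_or_lt with h0 | h0
      · rw [← h0]; positivity
      · exact le_of_mul_le_mul_right hfin h0
    rw [Subtype.dist_eq, Subtype.dist_eq, dist_eq_norm, dist_eq_norm]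
    simpa using this
  set w := hcontr.fixedPoint with hw
  have hfix : Φ w = w := hcontr.fixedPoint_isFixedPt
  have hs := hΦ w
  rw [hfix] at hs
  have e1 : (2⁻¹ : ℝ) • (u + ((2 : ℝ) • (w : Grid) - u)) = w := by
    rw [add_sub_cancel, smul_smul]; norm_num
  refine ⟨(2 : ℝ) • (w : Grid) - u, ?_, ?_⟩
  · rw [Grid.step_iff, e1]; exact hs
  · rw [e1]; exact w.2

/-- The competitor `z` carries no energy bound. The terms linear in the difference e polarize to -⟨ẽ
De, a⟩, which costs N(a)‖e‖², and the quadratic term vanishes against e; so 2‖e‖² ≤ Δt N(a)‖e‖². -/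
lemma Grid.step_unique (hh : 0 < h) {dt : ℝ} (hdt : 0 < dt) {u v z : Grid}
    (hv : Grid.Step h dt u v) (hz : Grid.Step h dt u z)
    (hN : dt * Grid.N h ((2⁻¹ : ℝ) • (u + v)) ≤ 1) : z = v := by
  rw [Grid.step_iff, Grid.stepOp_apply] at hv hz
  set a := (2⁻¹ : ℝ) • (u + v) with ha
  set b := (2⁻¹ : ℝ) • (u + z) with hb
  set e := b - a with he
  have hbe : b = a + e := by rw [he]; abel
  have heq : (2 : ℝ) • e + dt • ((Grid.Bl h a e + Grid.Bl h e a) + Grid.Bl h e e + Grid.d3 h e)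
      = 0 := by
    have := sub_eq_zero.2 (hz.trans hv.symm)
    rw [← this, hbe, Grid.Bl_add_right, Grid.Bl_add_left, Grid.Bl_add_left, map_add]
    module
  have h3 := congrArg (fun z => ⟪z, e⟫_ℝ) heq
  simp only [inner_zero_left] at h3
  rw [inner_add_left, real_inner_smul_left, real_inner_smul_left, inner_add_left, inner_add_left,
    Grid.inner_d3_self, Grid.inner_Bl_self hh, Grid.inner_Bl_polar hh,
    real_inner_self_eq_norm_sq] at h3
  have b := abs_le.1 (Grid.abs_inner_Bl_le hh (c := 2 * Grid.N h a)
    (mul_nonneg zero_le_two (Grid.N_nonneg _)) (Grid.abs_dP_le_N hh a) e)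
  have m : dt * Grid.N h a * ‖e‖ ^ 2 ≤ 1 * ‖e‖ ^ 2 := by gcongr
  have m2 : dt * ⟪Grid.Bl h e e, a⟫_ℝ ≤ dt * (2 * Grid.N h a / 2 * ‖e‖ ^ 2) := by
    gcongr; exact b.2
  have : ‖e‖ ^ 2 = 0 := le_antisymm (by nlinarith) (sq_nonneg _)
  have he0 : e = 0 := by simpa using this
  rw [he0, add_zero, hb, ha] at hbe
  have := smul_right_injective Grid (by norm_num : (2⁻¹ : ℝ) ≠ 0) hbe
  exact add_left_cancel this

/-- The midpoint rule makes the energy identity exact: ‖Xu'‖² - ‖Xu‖² is the pairing of Xu' - Xu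
with Xu' + Xu, and the latter is twice X at the midpoint. -/
lemma Grid.step_diff {dt : ℝ} {u u' : Grid} (hs : Grid.Step h dt u u') (X : Grid →L[ℝ] Grid)
    (hX : ∀ w, X (Grid.d3 h w) = Grid.d3 h (X w)) :
    ‖X u'‖ ^ 2 - ‖X u‖ ^ 2 = -(2 * dt * ⟪X (Grid.Bl h ((2⁻¹ : ℝ) • (u + u'))
      ((2⁻¹ : ℝ) • (u + u'))), X ((2⁻¹ : ℝ) • (u + u'))⟫_ℝ) := by
  set w := (2⁻¹ : ℝ) • (u + u') with hw
  have h2 : u + u' = (2 : ℝ) • w := by rw [hw, smul_smul]; norm_num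
  have h1 : ‖X u'‖ ^ 2 - ‖X u‖ ^ 2 = ⟪X u' - X u, X u + X u'⟫_ℝ := by
    simp only [inner_sub_left, inner_add_right, real_inner_self_eq_norm_sq]
    rw [real_inner_comm (X u)]; ring
  have h3 : u' - u = -(dt • (Grid.Bl h w w + Grid.d3 h w)) := by
    have : u' = u - dt • (Grid.Bl h w w + Grid.d3 h w) := hs
    nth_rw 1 [this]; abel
  rw [h1, ← map_add, h2, ← map_sub, h3]
  simp only [map_neg, map_smul, map_add, hX, inner_neg_left, real_inner_smul_left,
    real_inner_smul_right, inner_add_left, Grid.inner_d3_self]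
  ring

lemma Grid.norm_step (hh : 0 < h) {dt : ℝ} {u u' : Grid} (hs : Grid.Step h dt u u') :
    ‖u'‖ = ‖u‖ := by
  have := Grid.step_diff hs (ContinuousLinearMap.id ℝ Grid) (fun _ => rfl)
  simp only [ContinuousLinearMap.id_apply, Grid.inner_Bl_self hh, mul_zero, neg_zero] at this
  exact (sq_eq_sq₀ (norm_nonneg _) (norm_nonneg _)).1 (by linarith)

lemma Grid.N_step_le (hh : 0 < h) {dt : ℝ} (hdt : 0 < dt) {u u' : Grid}
    (hs : Grid.Step h dt u u') :
    Grid.N h u' ^ 2 ≤ Grid.N h u ^ 2 + 42 * (dt * Grid.N h ((2⁻¹ : ℝ) • (u + u')) ^ 3) := by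
  have k0 := Grid.step_diff hs (ContinuousLinearMap.id ℝ Grid) (fun _ => rfl)
  have k2 := Grid.step_diff hs (Grid.d2 h) Grid.d3_d2
  have k3 := Grid.step_diff hs (Grid.d3 h) (fun _ => rfl)
  set w := (2⁻¹ : ℝ) • (u + u') with hw
  simp only [ContinuousLinearMap.id_apply] at k0
  have e := mul_le_mul_of_nonneg_left (Grid.energy_Bl_le hh w w) (by positivity : 0 ≤ 2 * dt)
  have n0 := neg_le_abs ⟪Grid.Bl h w w, w⟫_ℝ
  have n2 := neg_le_abs ⟪Grid.d2 h (Grid.Bl h w w), Grid.d2 h w⟫_ℝ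
  have n3 := neg_le_abs ⟪Grid.d3 h (Grid.Bl h w w), Grid.d3 h w⟫_ℝ
  have hp : 0 ≤ h * (2 * dt) := by positivity
  have m := mul_le_mul_of_nonneg_left (add_le_add (add_le_add n0 n2) n3) hp
  rw [Grid.N_sq hh u', Grid.N_sq hh u]
  have : ‖u'‖ ^ 2 + ‖Grid.d2 h u'‖ ^ 2 + ‖Grid.d3 h u'‖ ^ 2
      = ‖u‖ ^ 2 + ‖Grid.d2 h u‖ ^ 2 + ‖Grid.d3 h u‖ ^ 2
        + 2 * dt * (-⟪Grid.Bl h w w, w⟫_ℝ + -⟪Grid.d2 h (Grid.Bl h w w), Grid.d2 h w⟫_ℝ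
          + -⟪Grid.d3 h (Grid.Bl h w w), Grid.d3 h w⟫_ℝ) := by linarith
  rw [this]
  nlinarith

/-! ### The scheme on a time interval -/

/-- The length of the time interval on which the energy at most quadruples. -/
def lifespan (ρ : ℝ) : ℝ := 1 / (2688 * ρ)

/-- A sequence of steps, carried out as long as `n Δt ≤ T`. -/
def Grid.Steps (h dt T : ℝ) (u : ℕ → Grid) : Prop :=
  ∀ n : ℕ, n * dt ≤ T → Grid.Step h dt (u n) (u (n + 1))

/-- By uniqueness the given step is the one constructed in `exists_step`, so it inherits the bound
on the midpoint. The growth constant is 2688 = 42 · 4³. -/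
lemma Grid.step_bounds (hh : 0 < h) {dt : ℝ} (hdt : 0 < dt) {ρ : ℝ} (hρ : 0 < ρ)
    (hdt' : dt * (168 * ρ) ≤ 1) {u u' : Grid} (hu : Grid.N h u ≤ 2 * ρ)
    (hs : Grid.Step h dt u u') :
    Grid.N h ((2⁻¹ : ℝ) • (u + u')) ≤ 4 * ρ ∧
      Grid.N h u' ^ 2 ≤ Grid.N h u ^ 2 + 2688 * (dt * ρ ^ 3) ∧
      ∀ z, Grid.Step h dt u z → z = u' := by
  have h1 : dt * Grid.N h u ≤ dt * (2 * ρ) := by gcongr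
  obtain ⟨v, hv, hvN⟩ := Grid.exists_step hh hdt (u := u) (by nlinarith)
  have hu' : ∀ z, Grid.Step h dt u z → z = v := fun z hz =>
    Grid.step_unique hh hdt hv hz (by nlinarith)
  rw [hu' u' hs]
  have hw : Grid.N h ((2⁻¹ : ℝ) • (u + v)) ≤ 4 * ρ := by linarith
  refine ⟨hw, ?_, hu'⟩
  have h2 := Grid.N_step_le hh hdt hv
  have h3 : Grid.N h ((2⁻¹ : ℝ) • (u + v)) ^ 3 ≤ (4 * ρ) ^ 3 :=
    pow_le_pow_left₀ (Grid.N_nonneg _) hw 3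
  have h4 := mul_le_mul_of_nonneg_left h3 hdt.le
  nlinarith

/-- A discrete Riccati argument: while N stays below 2ρ, its square grows at most linearly, N² ≤ ρ²
+ 2688 t ρ³. The last step may end as late as Δt after the life span; even for t ≤ 2 `lifespan ρ`
the bound is 3ρ² ≤ (2ρ)². -/
lemma Grid.steps_bounds_sq (hh : 0 < h) {dt : ℝ} (hdt : 0 < dt) {ρ : ℝ} (hρ : 0 < ρ)
    (hdt' : dt ≤ lifespan ρ) {u : ℕ → Grid} (h0 : Grid.N h (u 0) ≤ ρ) (n : ℕ)
    (hn : n * dt ≤ lifespan ρ + dt)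
    (hs : ∀ m < n, Grid.Step h dt (u m) (u (m + 1))) : Grid.N h (u n) ≤ 2 * ρ := by
  have hL : lifespan ρ * (2688 * ρ) = 1 := by unfold lifespan; field_simp
  have hd2 : dt * (2688 * ρ) ≤ 1 := by rw [← hL]; gcongr
  have hd3 : dt * (168 * ρ) ≤ 1 := by nlinarith [mul_pos hdt hρ]
  have growth : ∀ m ≤ n, Grid.N h (u m) ^ 2 ≤ ρ ^ 2 + 2688 * (m * dt * ρ ^ 3) ∧
      Grid.N h (u m) ≤ 2 * ρ := by
    intro m
    induction m with
    | zero =>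
      intro _
      refine ⟨?_, by linarith⟩
      have := pow_le_pow_left₀ (Grid.N_nonneg (u 0)) h0 2
      simpa using this
    | succ m ih =>
      intro hm
      obtain ⟨i1, i2⟩ := ih (by omega)
      obtain ⟨_, b2, _⟩ := Grid.step_bounds hh hdt hρ hd3 i2 (hs m (by omega))
      have e1 : Grid.N h (u (m + 1)) ^ 2 ≤ ρ ^ 2 + 2688 * ((m + 1 : ℕ) * dt * ρ ^ 3) := by
        push_cast; nlinarith
      refine ⟨e1, (abs_le_of_sq_le_sq' (e1.trans ?_) (by positivity)).2⟩
      have hmn : ((m + 1 : ℕ) : ℝ) * dt ≤ 2 * lifespan ρ := by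
        have : ((m + 1 : ℕ) : ℝ) * dt ≤ n * dt := by gcongr
        linarith
      have := mul_le_mul_of_nonneg_right hmn (by positivity : 0 ≤ 2688 * ρ ^ 3)
      have e2 : 2 * lifespan ρ * (2688 * ρ ^ 3) = 2 * ρ ^ 2 := by
        linear_combination 2 * ρ ^ 2 * hL
      nlinarith [sq_nonneg ρ]
  exact (growth n le_rfl).2

/-- Data of the scheme on `[0, T]` with uniform energy bounds. -/
lemma Grid.steps_bounds (hh : 0 < h) {dt : ℝ} (hdt : 0 < dt) {ρ : ℝ} (hρ : 0 < ρ)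
    (hdt' : dt ≤ lifespan ρ) {u : ℕ → Grid} (h0 : Grid.N h (u 0) ≤ ρ)
    (hs : Grid.Steps h dt (lifespan ρ) u) (n : ℕ) (hn : n * dt ≤ lifespan ρ) :
    Grid.N h (u n) ≤ 2 * ρ ∧ Grid.N h (u (n + 1)) ≤ 2 * ρ ∧
      Grid.N h ((2⁻¹ : ℝ) • (u n + u (n + 1))) ≤ 4 * ρ ∧ ‖u n‖ = ‖u 0‖ ∧ ‖u (n + 1)‖ = ‖u 0‖ := by
  have hL : lifespan ρ * (2688 * ρ) = 1 := by unfold lifespan; field_simp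
  have hd2 : dt * (2688 * ρ) ≤ 1 := by rw [← hL]; gcongr
  have hd3 : dt * (168 * ρ) ≤ 1 := by nlinarith [mul_pos hdt hρ]
  have hst : ∀ m ≤ n, Grid.Step h dt (u m) (u (m + 1)) := fun m hm => by
    refine hs m (le_trans ?_ hn); gcongr
  have b1 : Grid.N h (u n) ≤ 2 * ρ := Grid.steps_bounds_sq hh hdt hρ hdt' h0 n
    (by linarith) (fun m hm => hst m hm.le)
  have b2 : Grid.N h (u (n + 1)) ≤ 2 * ρ := Grid.steps_bounds_sq hh hdt hρ hdt' h0 (n + 1)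
    (by push_cast; linarith) (fun m hm => hst m (by omega))
  have hnorm : ∀ m ≤ n + 1, ‖u m‖ = ‖u 0‖ := by
    intro m
    induction m with
    | zero => simp
    | succ m ih => intro hm; rw [Grid.norm_step hh (hst m (by omega)), ih (by omega)]
  exact ⟨b1, b2, (Grid.step_bounds hh hdt hρ hd3 b1 (hst n le_rfl)).1, hnorm n (by omega),
    hnorm _ le_rfl⟩

lemma Grid.exists_steps (hh : 0 < h) {dt : ℝ} (hdt : 0 < dt) {ρ : ℝ} (hρ : 0 < ρ)
    (hdt' : dt ≤ lifespan ρ) (u₀ : Grid) (h0 : Grid.N h u₀ ≤ ρ) :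
    ∃ u : ℕ → Grid, u 0 = u₀ ∧ Grid.Steps h dt (lifespan ρ) u := by
  have hL : lifespan ρ * (2688 * ρ) = 1 := by unfold lifespan; field_simp
  have hd2 : dt * (2688 * ρ) ≤ 1 := by rw [← hL]; gcongr
  classical
  -- The value `v` for a state without successor is a dummy. The energy bounds show that it is not
  -- used up to the life span.
  let f : Grid → Grid := fun v => if hv : ∃ v', Grid.Step h dt v v' then hv.choose else v
  let u : ℕ → Grid := fun n => f^[n] u₀
  have hu : ∀ n, u (n + 1) = f (u n) := fun n => Function.iterate_succ_apply' f n u₀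
  have key : ∀ n : ℕ, n * dt ≤ lifespan ρ → ∀ m ≤ n, Grid.Step h dt (u m) (u (m + 1)) := by
    intro n
    induction n using Nat.strong_induction_on with
    | _ n ih =>
      intro hn m hm
      have hlt : ∀ k < m, Grid.Step h dt (u k) (u (k + 1)) := fun k hk =>
        ih k (by omega) (le_trans (by gcongr; omega) hn) k le_rfl
      have hmn : (m : ℝ) * dt ≤ lifespan ρ := le_trans (by gcongr) hn
      have b := Grid.steps_bounds_sq (u := u) hh hdt hρ hdt' h0 m (by linarith) hlt
      have hb : dt * Grid.N h (u m) ≤ dt * (2 * ρ) := by gcongr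
      obtain ⟨v, hv, _⟩ := Grid.exists_step hh hdt (u := u m) (by nlinarith [mul_pos hdt hρ])
      have hex : ∃ v', Grid.Step h dt (u m) v' := ⟨v, hv⟩
      rw [hu m]
      simp only [f]
      rw [dif_pos hex]
      exact hex.choose_spec
  exact ⟨u, rfl, fun n hn => key n hn n le_rfl⟩

lemma Grid.steps_unique (hh : 0 < h) {dt : ℝ} (hdt : 0 < dt) {ρ : ℝ} (hρ : 0 < ρ)
    (hdt' : dt ≤ lifespan ρ) {u v : ℕ → Grid} (h0 : Grid.N h (u 0) ≤ ρ) (huv : u 0 = v 0)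
    (hs : Grid.Steps h dt (lifespan ρ) u) (ht : Grid.Steps h dt (lifespan ρ) v) (n : ℕ)
    (hn : n * dt ≤ lifespan ρ) : u n = v n ∧ u (n + 1) = v (n + 1) := by
  have hL : lifespan ρ * (2688 * ρ) = 1 := by unfold lifespan; field_simp
  have hd2 : dt * (2688 * ρ) ≤ 1 := by rw [← hL]; gcongr
  have hd3 : dt * (168 * ρ) ≤ 1 := by nlinarith [mul_pos hdt hρ]
  have step : ∀ m : ℕ, m * dt ≤ lifespan ρ → u m = v m → u (m + 1) = v (m + 1) := by
    intro m hm e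
    have b := (Grid.steps_bounds hh hdt hρ hdt' h0 hs m hm).1
    have := (Grid.step_bounds hh hdt hρ hd3 b (hs m hm)).2.2 (v (m + 1)) (e ▸ ht m hm)
    exact this.symm
  have key : ∀ m ≤ n, u m = v m := by
    intro m
    induction m with
    | zero => intro _; exact huv
    | succ m ih =>
      intro hm
      refine step m (le_trans ?_ hn) (ih (by omega))
      gcongr; omega
  exact ⟨key n le_rfl, step n hn (key n le_rfl)⟩

end KdV
end

noncomputable section

namespace KdV

open scoped InnerProductSpace

/-! ### Square integrable functions as elements of a Hilbert space -/

/-- The Hilbert space `L²(ℝ)`. -/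
abbrev H : Type := Lp ℝ 2 (volume : Measure ℝ)

/-- The class of `f` in `L²(ℝ)`, zero if `f` is not square integrable. -/
def L2 (f : ℝ → ℝ) : H := by
  classical exact if hf : MemLp f 2 volume then hf.toLp f else 0

lemma L2_of {f : ℝ → ℝ} (hf : MemLp f 2 volume) : L2 f = hf.toLp f := dif_pos hf

lemma coeFn_L2 {f : ℝ → ℝ} (hf : MemLp f 2 volume) : L2 f =ᵐ[volume] f := by
  rw [L2_of hf]; exact hf.coeFn_toLp

lemma L2_congr {f g : ℝ → ℝ} (h : f =ᵐ[volume] g) : L2 f = L2 g := by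
  by_cases hf : MemLp f 2 volume
  · have hg := hf.ae_eq h
    rw [L2_of hf, L2_of hg]; exact MemLp.toLp_congr _ _ h
  · have hg : ¬MemLp g 2 volume := fun hg => hf (hg.ae_eq h.symm)
    rw [L2, L2, dif_neg hf, dif_neg hg]

lemma L2_coe (f : H) : L2 f = f := by
  rw [L2_of (Lp.memLp f)]; exact Lp.toLp_coeFn f _

lemma L2_inj {f g : ℝ → ℝ} (hf : MemLp f 2 volume) (hg : MemLp g 2 volume) (h : L2 f = L2 g) :
    f =ᵐ[volume] g :=
  (coeFn_L2 hf).symm.trans ((by rw [h] : (L2 f : ℝ → ℝ) =ᵐ[volume] L2 g).trans (coeFn_L2 hg))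

lemma L2_add {f g : ℝ → ℝ} (hf : MemLp f 2 volume) (hg : MemLp g 2 volume) :
    L2 (fun x => f x + g x) = L2 f + L2 g := by
  rw [L2_of hf, L2_of hg, ← MemLp.toLp_add, ← L2_of (hf.add hg)]; rfl

lemma L2_sub {f g : ℝ → ℝ} (hf : MemLp f 2 volume) (hg : MemLp g 2 volume) :
    L2 (fun x => f x - g x) = L2 f - L2 g := by
  rw [L2_of hf, L2_of hg, ← MemLp.toLp_sub, ← L2_of (hf.sub hg)]; rfl

lemma L2_const_mul {f : ℝ → ℝ} (hf : MemLp f 2 volume) (c : ℝ) :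
    L2 (fun x => c * f x) = c • L2 f := by
  rw [L2_of hf, L2_of (hf.const_mul c)]; rfl

lemma norm_L2 {f : ℝ → ℝ} (hf : MemLp f 2 volume) :
    ‖L2 f‖ = (eLpNorm f 2 volume).toReal := by
  rw [L2_of hf, Lp.norm_toLp]

lemma eLpNorm_eq_norm_L2 {f : ℝ → ℝ} (hf : MemLp f 2 volume) :
    eLpNorm f 2 volume = ENNReal.ofReal ‖L2 f‖ := by
  rw [norm_L2 hf, ENNReal.ofReal_toReal hf.2.ne]

lemma norm_L2_le {f : ℝ → ℝ} {M : ℝ} (hM : 0 ≤ M)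
    (h : eLpNorm f 2 volume ≤ ENNReal.ofReal M) : ‖L2 f‖ ≤ M := by
  by_cases hf : MemLp f 2 volume
  · rw [norm_L2 hf]
    exact ENNReal.toReal_le_of_le_ofReal hM h
  · rw [L2, dif_neg hf]; simpa using hM

lemma inner_L2 {f g : ℝ → ℝ} (hf : MemLp f 2 volume) (hg : MemLp g 2 volume) :
    ⟪L2 f, L2 g⟫_ℝ = ∫ x, f x * g x := by
  rw [L2.inner_def]
  refine integral_congr_ae ?_
  filter_upwards [coeFn_L2 hf, coeFn_L2 hg] with x h1 h2
  rw [h1, h2]; simp [mul_comm]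

lemma norm_L2_sq {f : ℝ → ℝ} (hf : MemLp f 2 volume) : ‖L2 f‖ ^ 2 = ∫ x, f x ^ 2 := by
  rw [← real_inner_self_eq_norm_sq, inner_L2 hf hf]; simp [sq]

lemma integrable_mul_of_memLp {f g : ℝ → ℝ} (hf : MemLp f 2 volume) (hg : MemLp g 2 volume) :
    Integrable (fun x => f x * g x) volume :=
  hf.integrable_mul hg

lemma abs_integral_mul_le {f g : ℝ → ℝ} (hf : MemLp f 2 volume) (hg : MemLp g 2 volume) :
    |∫ x, f x * g x| ≤ ‖L2 f‖ * ‖L2 g‖ := by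
  rw [← inner_L2 hf hg]; exact abs_real_inner_le_norm _ _

lemma memLp_abs {f : ℝ → ℝ} (hf : MemLp f 2 volume) : MemLp (fun x => |f x|) 2 volume := hf.norm

lemma norm_L2_mono {f g : ℝ → ℝ} (hf : MemLp f 2 volume) (hg : MemLp g 2 volume)
    (h : ∀ x, |f x| ≤ |g x|) : ‖L2 f‖ ≤ ‖L2 g‖ := by
  rw [norm_L2 hf, norm_L2 hg]
  exact ENNReal.toReal_mono hg.2.ne (eLpNorm_mono (by simpa using h))

lemma norm_L2_abs {f : ℝ → ℝ} (hf : MemLp f 2 volume) : ‖L2 fun x => |f x|‖ = ‖L2 f‖ :=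
  le_antisymm (norm_L2_mono (memLp_abs hf) hf (by simp)) (norm_L2_mono hf (memLp_abs hf) (by simp))

lemma memLp_bdd_mul {f g : ℝ → ℝ} {c : ℝ} (hf : AEStronglyMeasurable f volume)
    (hg : MemLp g 2 volume) (hc : ∀ x, |f x| ≤ c) : MemLp (fun x => f x * g x) 2 volume := by
  refine (hg.const_mul c).mono (hf.mul hg.1) (Eventually.of_forall fun x => ?_)
  rw [norm_mul, norm_mul]
  exact mul_le_mul_of_nonneg_right ((hc x).trans (le_abs_self c)) (norm_nonneg _)

lemma norm_L2_bdd_mul_le {f g : ℝ → ℝ} {c : ℝ} (hf : AEStronglyMeasurable f volume)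
    (hg : MemLp g 2 volume) (hc : ∀ x, |f x| ≤ c) : ‖L2 fun x => f x * g x‖ ≤ c * ‖L2 g‖ := by
  have hc0 : 0 ≤ c := (abs_nonneg _).trans (hc 0)
  have h1 := norm_L2_mono (memLp_bdd_mul hf hg hc) (hg.const_mul c) (fun x => by
    rw [abs_mul, abs_mul]
    exact mul_le_mul_of_nonneg_right ((hc x).trans (le_abs_self c)) (abs_nonneg _))
  rwa [L2_const_mul hg, norm_smul, Real.norm_of_nonneg hc0] at h1

lemma memLp_intervalIntegrable {f : ℝ → ℝ} (hf : MemLp f 2 volume) (a b : ℝ) :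
    IntervalIntegrable f volume a b :=
  intervalIntegrable_iff.2 (((hf.locallyIntegrable (by norm_num)).integrableOn_isCompact
    isCompact_uIcc).mono_set uIoc_subset_uIcc)

/-! ### Absolutely continuous functions with square integrable derivative -/

/-- `f` and `g` are square integrable and `f` is the integral of `g`. -/
structure W (f g : ℝ → ℝ) : Prop where
  left : MemLp f 2 volume
  right : MemLp g 2 volume
  ftc : ∀ a b, f b - f a = ∫ x in a..b, g x

lemma W.add {f g p q : ℝ → ℝ} (h : W f g) (h' : W p q) :
    W (fun x => f x + p x) (fun x => g x + q x) where
  left := h.left.add h'.left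
  right := h.right.add h'.right
  ftc a b := by
    rw [intervalIntegral.integral_add (memLp_intervalIntegrable h.right a b)
      (memLp_intervalIntegrable h'.right a b), ← h.ftc, ← h'.ftc]; ring

lemma W.sub {f g p q : ℝ → ℝ} (h : W f g) (h' : W p q) :
    W (fun x => f x - p x) (fun x => g x - q x) where
  left := h.left.sub h'.left
  right := h.right.sub h'.right
  ftc a b := by
    rw [intervalIntegral.integral_sub (memLp_intervalIntegrable h.right a b)
      (memLp_intervalIntegrable h'.right a b), ← h.ftc, ← h'.ftc]; ring

lemma W.eq_add_integral {f g : ℝ → ℝ} (h : W f g) (c : ℝ) :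
    f = fun x => f c + ∫ y in c..x, g y := by
  ext x; rw [← h.ftc]; ring

lemma W.congr_right {f g g' : ℝ → ℝ} (h : W f g) (hg : g =ᵐ[volume] g') : W f g' where
  left := h.left
  right := h.right.ae_eq hg
  ftc a b := by
    rw [h.ftc]
    exact intervalIntegral.integral_congr_ae (hg.mono fun x hx _ => hx)

lemma W.ac {f g : ℝ → ℝ} (h : W f g) (a b : ℝ) : AbsolutelyContinuousOnInterval f a b := by
  have h1 := (memLp_intervalIntegrable h.right a b).absolutelyContinuousOnInterval_intervalIntegral
    (c := a) left_mem_uIcc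
  have h2 : AbsolutelyContinuousOnInterval (fun _ : ℝ => f a) a b :=
    ((LipschitzWith.const (f a)).lipschitzOnWith (s := uIcc a b)).absolutelyContinuousOnInterval
  rw [h.eq_add_integral a]
  exact h2.add h1

lemma W.continuous {f g : ℝ → ℝ} (h : W f g) : Continuous f := by
  rw [h.eq_add_integral 0]
  exact continuous_const.add
    (intervalIntegral.continuous_primitive (fun a b => memLp_intervalIntegrable h.right a b) 0)

lemma W.ae_deriv {f g : ℝ → ℝ} (h : W f g) : ∀ᵐ x, deriv f x = g x := by
  filter_upwards [LocallyIntegrable.ae_hasDerivAt_integral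
    (h.right.locallyIntegrable (by norm_num))] with x hx
  have := (hx 0).const_add (f 0)
  rw [← h.eq_add_integral 0] at this
  exact this.deriv

/-- Leibniz rule in integrated form. -/
lemma W.mul_ftc {f g p q : ℝ → ℝ} (h : W f g) (h' : W p q) (a b : ℝ) :
    f b * p b - f a * p a = ∫ x in a..b, (g x * p x + f x * q x) := by
  rw [← AbsolutelyContinuousOnInterval.integral_deriv_mul_eq_sub (h.ac a b) (h'.ac a b)]
  refine intervalIntegral.integral_congr_ae ?_
  filter_upwards [h.ae_deriv, h'.ae_deriv] with x h1 h2 _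
  rw [h1, h2]

/-- An integrable function with integrable derivative vanishes at infinity. -/
lemma tendsto_zero_of_ftc {F G : ℝ → ℝ} (hF : Integrable F volume) (hG : Integrable G volume)
    (h : ∀ a b, F b - F a = ∫ x in a..b, G x) :
    Tendsto F atTop (𝓝 0) ∧ Tendsto F atBot (𝓝 0) := by
  have e1 : F = fun x => F 0 + ∫ y in (0 : ℝ)..x, G y := by ext x; rw [← h]; ring
  have e2 : F = fun x => F 0 - ∫ y in x..(0 : ℝ), G y := by ext x; rw [← h]; ring
  have t1 : Tendsto F atTop (𝓝 (F 0 + ∫ y in Ioi 0, G y)) := by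
    nth_rw 1 [e1]
    exact tendsto_const_nhds.add
      (intervalIntegral_tendsto_integral_Ioi 0 hG.integrableOn tendsto_id)
  have t2 : Tendsto F atBot (𝓝 (F 0 - ∫ y in Iic 0, G y)) := by
    nth_rw 1 [e2]
    exact tendsto_const_nhds.sub
      (intervalIntegral_tendsto_integral_Iic 0 hG.integrableOn tendsto_id)
  constructor
  -- The limit exists because G is integrable, and it is zero because F is integrable and half lines
  -- have infinite measure.
  · have : F 0 + ∫ y in Ioi 0, G y = 0 := by
      refine IntegrableAtFilter.eq_zero_of_tendsto (μ := volume) ⟨univ, univ_mem, ?_⟩ ?_ t1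
      · simpa using hF
      · intro s hs
        obtain ⟨b, hb⟩ := mem_atTop_sets.1 hs
        exact measure_mono_top (s₁ := Ici b) (fun x hx => hb x hx) Real.volume_Ici
    rwa [this] at t1
  · have : F 0 - ∫ y in Iic 0, G y = 0 := by
      refine IntegrableAtFilter.eq_zero_of_tendsto (μ := volume) ⟨univ, univ_mem, ?_⟩ ?_ t2
      · simpa using hF
      · intro s hs
        obtain ⟨b, hb⟩ := mem_atBot_sets.1 hs
        exact measure_mono_top (s₁ := Iic b) (fun x hx => hb x hx) Real.volume_Iic
    rwa [this] at t2

lemma integral_eq_zero_of_ftc {F G : ℝ → ℝ} (hF : Integrable F volume) (hG : Integrable G volume)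
    (h : ∀ a b, F b - F a = ∫ x in a..b, G x) : ∫ x, G x = 0 := by
  obtain ⟨h1, h2⟩ := tendsto_zero_of_ftc hF hG h
  have t := intervalIntegral_tendsto_integral hG tendsto_neg_atTop_atBot tendsto_id
  have t' : Tendsto (fun x : ℝ => ∫ y in -x..id x, G y) atTop (𝓝 (0 - 0)) := by
    simp_rw [← h]
    exact h1.sub (h2.comp tendsto_neg_atTop_atBot)
  rw [sub_zero] at t'
  exact tendsto_nhds_unique t t'

lemma abs_le_of_ftc {F G : ℝ → ℝ} (hF : Integrable F volume) (hG : Integrable G volume)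
    (h : ∀ a b, F b - F a = ∫ x in a..b, G x) (x : ℝ) : |F x| ≤ ∫ y, |G y| := by
  obtain ⟨-, h2⟩ := tendsto_zero_of_ftc hF hG h
  have t : Tendsto (fun a => F x - F a) atBot (𝓝 (F x - 0)) := tendsto_const_nhds.sub h2
  rw [sub_zero] at t
  refine le_of_tendsto t.abs ?_
  filter_upwards [eventually_le_atBot x] with a ha
  rw [h, intervalIntegral.integral_of_le ha]
  refine (abs_integral_le_integral_abs).trans ?_
  exact setIntegral_le_integral hG.abs (Eventually.of_forall fun _ => abs_nonneg _)

lemma W.integrable_leibniz {f g p q : ℝ → ℝ} (h : W f g) (h' : W p q) :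
    Integrable (fun x => g x * p x + f x * q x) volume :=
  (integrable_mul_of_memLp h.right h'.left).add (integrable_mul_of_memLp h.left h'.right)

/-- Integration by parts on the line. -/
lemma W.integral_mul {f g p q : ℝ → ℝ} (h : W f g) (h' : W p q) :
    ∫ x, g x * p x = -∫ x, f x * q x := by
  have := integral_eq_zero_of_ftc (integrable_mul_of_memLp h.left h'.left)
    (h.integrable_leibniz h') (h.mul_ftc h')
  rw [integral_add (integrable_mul_of_memLp h.right h'.left)
    (integrable_mul_of_memLp h.left h'.right)] at this
  linarith

/-- The Sobolev inequality. -/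
lemma W.sq_le {f g : ℝ → ℝ} (h : W f g) (x : ℝ) : f x ^ 2 ≤ 2 * ‖L2 f‖ * ‖L2 g‖ := by
  have h1 := abs_le_of_ftc (integrable_mul_of_memLp h.left h.left)
    (h.integrable_leibniz h) (h.mul_ftc h) x
  have h2 : ∫ y, |g y * f y + f y * g y| = 2 * ∫ y, |f y| * |g y| := by
    rw [← integral_const_mul]
    congr 1; ext y
    rw [show g y * f y + f y * g y = 2 * (f y * g y) by ring, abs_mul, abs_mul]; norm_num
  have h3 := abs_integral_mul_le (memLp_abs h.left) (memLp_abs h.right)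
  rw [norm_L2_abs h.left, norm_L2_abs h.right] at h3
  have h4 := (le_abs_self _).trans h3
  have h5 := (le_abs_self _).trans h1
  rw [h2] at h5
  nlinarith

lemma W.abs_le {f g : ℝ → ℝ} (h : W f g) {M : ℝ} (hf : ‖L2 f‖ ≤ M) (hg : ‖L2 g‖ ≤ M) (x : ℝ) :
    |f x| ≤ 2 * M := by
  have hM : 0 ≤ M := (norm_nonneg _).trans hf
  refine abs_le_of_sq_le_sq ?_ (by positivity)
  refine (h.sq_le x).trans ?_
  have : 2 * ‖L2 f‖ * ‖L2 g‖ ≤ 2 * M * M := by gcongr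
  nlinarith

/-- Interpolation: the first derivative is controlled by the function and its second derivative. -/
lemma W.norm_sq_le {f g k : ℝ → ℝ} (h : W f g) (h' : W g k) :
    ‖L2 g‖ ^ 2 ≤ ‖L2 f‖ * ‖L2 k‖ := by
  rw [← real_inner_self_eq_norm_sq, inner_L2 h.right h.right, h.integral_mul h']
  exact (neg_le_abs _).trans (abs_integral_mul_le h.left h'.right)

/-- The integral of `e² v` is reduced to that of `e e' v`. -/
lemma W.integral_mul_mul {e e' v v' : ℝ → ℝ} (h : W e e') (hv : W v v') :
    ∫ x, e x * e' x * v x = -(1 / 2) * ∫ x, e x ^ 2 * v' x := by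
  have hev : W (fun x => e x * v x) (fun x => e' x * v x + e x * v' x) := by
    have b1 := fun x => h.abs_le (M := max ‖L2 e‖ ‖L2 e'‖) (le_max_left _ _) (le_max_right _ _) x
    have b2 := fun x => hv.abs_le (M := max ‖L2 v‖ ‖L2 v'‖) (le_max_left _ _) (le_max_right _ _) x
    refine ⟨memLp_bdd_mul h.continuous.aestronglyMeasurable hv.left b1, ?_, h.mul_ftc hv⟩
    refine MemLp.add ?_ (memLp_bdd_mul h.continuous.aestronglyMeasurable hv.right b1)
    simpa only [mul_comm] using memLp_bdd_mul hv.continuous.aestronglyMeasurable h.right b2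
  have h1 := h.integral_mul hev
  have i1 : Integrable (fun x => e x * e' x * v x) volume :=
    (integrable_mul_of_memLp h.right hev.left).congr (Eventually.of_forall fun x => by
      simp only; ring)
  have i3 := integrable_mul_of_memLp h.left hev.right
  have i2 : Integrable (fun x => e x ^ 2 * v' x) volume :=
    (i3.sub i1).congr (Eventually.of_forall fun x => by
      simp only [Pi.sub_apply]; ring)
  have e1 : ∫ x, e' x * (e x * v x) = ∫ x, e x * e' x * v x := by congr 1; ext x; ring
  have e2 : ∫ x, e x * (e' x * v x + e x * v' x)
      = (∫ x, e x * e' x * v x) + ∫ x, e x ^ 2 * v' x := by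
    rw [← integral_add i1 i2]; congr 1; ext x; ring
  rw [e1, e2] at h1
  linarith

end KdV
end

noncomputable section

namespace KdV

open scoped InnerProductSpace

/-! ### Test functions and weak derivatives -/

lemma memLp_test {φ : ℝ → ℝ} (h1 : ContDiff ℝ (⊤ : ℕ∞) φ) (h2 : HasCompactSupport φ) :
    MemLp φ 2 volume :=
  h1.continuous.memLp_of_hasCompactSupport h2

lemma contDiff_deriv {φ : ℝ → ℝ} (h1 : ContDiff ℝ (⊤ : ℕ∞) φ) :
    ContDiff ℝ (⊤ : ℕ∞) (deriv φ) :=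
  (contDiff_infty_iff_deriv.1 h1).2

lemma W_test {φ : ℝ → ℝ} (h1 : ContDiff ℝ (⊤ : ℕ∞) φ) (h2 : HasCompactSupport φ) :
    W φ (deriv φ) where
  left := memLp_test h1 h2
  right := memLp_test (contDiff_deriv h1) h2.deriv
  ftc a b := by
    rw [intervalIntegral.integral_deriv_eq_sub (fun x _ => h1.differentiable (by simp) x)
      ((contDiff_deriv h1).continuous.intervalIntegrable a b)]

lemma HasWeakDeriv.zero (f : ℝ → ℝ) : HasWeakDeriv 0 f f := by
  intro φ _ _; simp

lemma HasWeakDeriv.succ {k : ℕ} {f g g' : ℝ → ℝ} (h : HasWeakDeriv k f g) (hg : W g g') :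
    HasWeakDeriv (k + 1) f g' := by
  intro φ h1 h2
  rw [iteratedDeriv_succ', h _ (contDiff_deriv h1) h2.deriv, pow_succ]
  have := hg.integral_mul (W_test h1 h2)
  rw [this]; ring

lemma HasWeakDeriv.sub_one {k : ℕ} {f g g' : ℝ → ℝ} (h : HasWeakDeriv k f g)
    (h' : HasWeakDeriv (k + 1) f g') : HasWeakDeriv 1 g g' := by
  intro φ h1 h2
  have e := h' φ h1 h2
  rw [iteratedDeriv_succ', h _ (contDiff_deriv h1) h2.deriv, pow_succ] at e
  rw [iteratedDeriv_one, pow_one]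
  rcases neg_one_pow_eq_or ℝ k with hk | hk <;> rw [hk] at e <;> linarith

lemma HasWeakDeriv.ae_eq {k : ℕ} {f g g' : ℝ → ℝ} (h : HasWeakDeriv k f g)
    (h' : HasWeakDeriv k f g') (hg : MemLp g 2 volume) (hg' : MemLp g' 2 volume) :
    g =ᵐ[volume] g' := by
  refine ae_eq_of_integral_contDiff_smul_eq (hg.locallyIntegrable (by norm_num))
    (hg'.locallyIntegrable (by norm_num)) fun φ h1 h2 => ?_
  have e := (h φ h1 h2).symm.trans (h' φ h1 h2)
  have := mul_left_cancel₀ (pow_ne_zero k (by norm_num : (-1 : ℝ) ≠ 0)) e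
  simpa [mul_comm] using this

/-- A smooth compactly supported function of integral zero has a compactly supported primitive. -/
lemma exists_test_primitive {η : ℝ → ℝ} (h1 : ContDiff ℝ (⊤ : ℕ∞) η) (h2 : HasCompactSupport η)
    (h0 : ∫ x, η x = 0) :
    ∃ φ : ℝ → ℝ, ContDiff ℝ (⊤ : ℕ∞) φ ∧ HasCompactSupport φ ∧ deriv φ = η := by
  obtain ⟨R, hR⟩ := h2.isCompact.isBounded.subset_closedBall 0
  have hout : ∀ x, R < |x| → η x = 0 := fun x hx => by
    by_contra hne
    have := hR (subset_tsupport η (Function.mem_support.2 hne))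
    rw [Metric.mem_closedBall, dist_zero_right, Real.norm_eq_abs] at this
    linarith
  have hint : ∀ a b, IntervalIntegrable η volume a b := fun a b =>
    h1.continuous.intervalIntegrable a b
  set φ : ℝ → ℝ := fun x => ∫ y in (-(|R| + 1))..x, η y with hφ
  have hder : ∀ x, HasDerivAt φ (η x) x := fun x =>
    intervalIntegral.integral_hasDerivAt_right (hint _ _)
      (h1.continuous.stronglyMeasurableAtFilter _ _) h1.continuous.continuousAt
  have hd : deriv φ = η := funext fun x => (hder x).deriv
  refine ⟨φ, ?_, ?_, hd⟩
  · exact contDiff_infty_iff_deriv.2 ⟨fun x => (hder x).differentiableAt, hd ▸ h1⟩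
  · refine HasCompactSupport.intro (isCompact_Icc (a := -(|R| + 1)) (b := |R| + 1)) fun x hx => ?_
    have hRR := le_abs_self R
    rw [mem_Icc, not_and_or, not_le, not_le] at hx
    rcases hx with hx | hx
    · simp only [hφ]
      rw [intervalIntegral.integral_symm, neg_eq_zero]
      rw [intervalIntegral.integral_of_le hx.le]
      refine setIntegral_eq_zero_of_forall_eq_zero fun y hy => hout y ?_
      have : y ≤ -(|R| + 1) := hy.2
      rw [abs_of_nonpos (by linarith [abs_nonneg R])]; linarith
    · simp only [hφ]
      have hs : Function.support η ⊆ Ioc (-(|R| + 1)) x := by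
        intro y hy
        have : ¬ R < |y| := fun hlt => hy (hout y hlt)
        rw [not_lt, abs_le] at this
        exact ⟨by linarith, by linarith⟩
      rw [intervalIntegral.integral_eq_integral_of_support_subset hs, h0]

/-- A square integrable function with square integrable weak derivative is almost everywhere the
integral of this derivative. -/
lemma HasWeakDeriv.exists_W {f g : ℝ → ℝ} (h : HasWeakDeriv 1 f g) (hf : MemLp f 2 volume)
    (hg : MemLp g 2 volume) : ∃ F, f =ᵐ[volume] F ∧ W F g := by
  have hgi := fun a b => memLp_intervalIntegrable hg a b
  set G : ℝ → ℝ := fun x => ∫ y in (0 : ℝ)..x, g y with hG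
  have hGc : Continuous G := intervalIntegral.continuous_primitive hgi 0
  have hGac : ∀ a b, AbsolutelyContinuousOnInterval G a b := fun a b => by
    have h1 := (hgi a b).absolutelyContinuousOnInterval_intervalIntegral (c := a) left_mem_uIcc
    have h2 : AbsolutelyContinuousOnInterval (fun _ : ℝ => ∫ y in (0 : ℝ)..a, g y) a b :=
      ((LipschitzWith.const _).lipschitzOnWith (s := uIcc a b)).absolutelyContinuousOnInterval
    have : G = fun x => (∫ y in (0 : ℝ)..a, g y) + ∫ y in a..x, g y := by
      ext x; rw [intervalIntegral.integral_add_adjacent_intervals (hgi _ _) (hgi _ _)]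
    rw [this]
    exact h2.add h1
  have hGd : ∀ᵐ x, deriv G x = g x := by
    filter_upwards [LocallyIntegrable.ae_hasDerivAt_integral
      (hg.locallyIntegrable (by norm_num))] with x hx
    exact (hx 0).deriv
  have hfl := hf.locallyIntegrable (μ := volume) (by norm_num : (1 : ENNReal) ≤ 2)
  have hGl : LocallyIntegrable G volume := hGc.locallyIntegrable
  have hint : ∀ {u φ : ℝ → ℝ}, LocallyIntegrable u volume → Continuous φ → HasCompactSupport φ →
      Integrable (fun x => u x * φ x) volume := fun hu hφ hφ' => by
    simpa [mul_comm] using hu.integrable_smul_left_of_hasCompactSupport hφ hφ'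
  -- the primitive has the same weak derivative
  have hGw : ∀ φ : ℝ → ℝ, ContDiff ℝ (⊤ : ℕ∞) φ → HasCompactSupport φ →
      ∫ x, G x * deriv φ x = -∫ x, g x * φ x := by
    intro φ h1 h2
    have hφ := W_test h1 h2
    have i1 : Integrable (fun x => g x * φ x) volume := integrable_mul_of_memLp hg hφ.left
    have i2 : Integrable (fun x => G x * deriv φ x) volume :=
      hint hGl (contDiff_deriv h1).continuous h2.deriv
    have hF : Integrable (fun x => G x * φ x) volume := hint hGl h1.continuous h2
    have := integral_eq_zero_of_ftc hF (i1.add i2) (fun a b => by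
      rw [← AbsolutelyContinuousOnInterval.integral_deriv_mul_eq_sub (hGac a b) (hφ.ac a b)]
      refine intervalIntegral.integral_congr_ae ?_
      filter_upwards [hGd] with x hx _
      rw [hx]; rfl)
    simp only [Pi.add_apply] at this
    rw [integral_add i1 i2] at this
    linarith
  -- The lemma of du Bois-Reymond: D has weak derivative zero. A test function minus its integral
  -- times the normalized bump ψ has a compactly supported primitive, so D integrates to zero
  -- against it, and D is constant.
  set D : ℝ → ℝ := fun x => f x - G x with hD
  have hDl : LocallyIntegrable D volume := hfl.sub hGl
  have hDz : ∀ φ : ℝ → ℝ, ContDiff ℝ (⊤ : ℕ∞) φ → HasCompactSupport φ →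
      ∫ x, D x * deriv φ x = 0 := by
    intro φ h1 h2
    have e1 := h φ h1 h2
    have e2 := hGw φ h1 h2
    rw [iteratedDeriv_one, pow_one] at e1
    have c := (contDiff_deriv h1).continuous
    have : ∫ x, D x * deriv φ x = (∫ x, f x * deriv φ x) - ∫ x, G x * deriv φ x := by
      rw [← integral_sub (hint hfl c h2.deriv) (hint hGl c h2.deriv)]
      congr 1; ext x; simp only [hD]; ring
    rw [this, e1, e2]; ring
  let B : ContDiffBump (0 : ℝ) := ⟨1, 2, by norm_num, by norm_num⟩
  set ψ : ℝ → ℝ := B.normed volume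
  have ψ1 : ContDiff ℝ (⊤ : ℕ∞) ψ := B.contDiff_normed
  have ψ2 : HasCompactSupport ψ := B.hasCompactSupport_normed
  have ψ3 : ∫ x, ψ x = 1 := B.integral_normed
  set c := ∫ x, D x * ψ x with hc
  have hconst : D =ᵐ[volume] fun _ => c := by
    refine ae_eq_of_integral_contDiff_smul_eq hDl continuous_const.locallyIntegrable
      fun η h1 h2 => ?_
    set κ := ∫ x, η x with hκ
    have hηi := h1.continuous.integrable_of_hasCompactSupport h2 (μ := volume)
    have hψi := ψ1.continuous.integrable_of_hasCompactSupport ψ2 (μ := volume)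
    obtain ⟨φ, φ1, φ2, φ3⟩ := exists_test_primitive (η := fun x => η x - κ * ψ x)
      (h1.sub (contDiff_const.mul ψ1)) (h2.sub (ψ2.mul_left (f := fun _ => κ))) (by
        rw [integral_sub hηi (hψi.const_mul κ), integral_const_mul, ψ3]; simp [hκ])
    have e := hDz φ φ1 φ2
    rw [φ3] at e
    have : ∫ x, D x * (η x - κ * ψ x) = (∫ x, D x * η x) - κ * c := by
      rw [hc, ← integral_const_mul,
        ← integral_sub (hint hDl h1.continuous h2) ((hint hDl ψ1.continuous ψ2).const_mul κ)]
      congr 1; ext x; ring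
    rw [this] at e
    simp only [smul_eq_mul]
    rw [integral_mul_const, ← hκ, ← sub_eq_zero.1 e]
    congr 1; ext x; ring
  refine ⟨fun x => c + G x, ?_, ?_⟩
  · filter_upwards [hconst] with x hx
    simp only [hD] at hx; linarith
  · have hae : f =ᵐ[volume] fun x => c + G x := by
      filter_upwards [hconst] with x hx
      simp only [hD] at hx; linarith
    refine ⟨hf.ae_eq hae, hg, fun a b => ?_⟩
    rw [← intervalIntegral.integral_interval_sub_left (hgi 0 b) (hgi 0 a)]
    simp only [hG]; ring

/-- Functions with three square integrable derivatives, with all norms at most `M`. -/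
structure Pack (M : ℝ) (f f₁ f₂ f₃ : ℝ → ℝ) : Prop where
  w₁ : W f f₁
  w₂ : W f₁ f₂
  w₃ : W f₂ f₃
  n₀ : ‖L2 f‖ ≤ M
  n₁ : ‖L2 f₁‖ ≤ M
  n₂ : ‖L2 f₂‖ ≤ M
  n₃ : ‖L2 f₃‖ ≤ M

lemma Pack.nonneg {M : ℝ} {f f₁ f₂ f₃ : ℝ → ℝ} (h : Pack M f f₁ f₂ f₃) : 0 ≤ M :=
  (norm_nonneg _).trans h.n₀

lemma Pack.mono {M M' : ℝ} {f f₁ f₂ f₃ : ℝ → ℝ} (h : Pack M f f₁ f₂ f₃) (hM : M ≤ M') :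
    Pack M' f f₁ f₂ f₃ :=
  ⟨h.w₁, h.w₂, h.w₃, h.n₀.trans hM, h.n₁.trans hM, h.n₂.trans hM, h.n₃.trans hM⟩

lemma Pack.sub {M M' : ℝ} {f f₁ f₂ f₃ g g₁ g₂ g₃ : ℝ → ℝ} (h : Pack M f f₁ f₂ f₃)
    (h' : Pack M' g g₁ g₂ g₃) : Pack (M + M') (fun x => f x - g x) (fun x => f₁ x - g₁ x)
      (fun x => f₂ x - g₂ x) (fun x => f₃ x - g₃ x) where
  w₁ := h.w₁.sub h'.w₁
  w₂ := h.w₂.sub h'.w₂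
  w₃ := h.w₃.sub h'.w₃
  n₀ := by rw [L2_sub h.w₁.left h'.w₁.left]; exact (norm_sub_le _ _).trans (add_le_add h.n₀ h'.n₀)
  n₁ := by rw [L2_sub h.w₂.left h'.w₂.left]; exact (norm_sub_le _ _).trans (add_le_add h.n₁ h'.n₁)
  n₂ := by rw [L2_sub h.w₃.left h'.w₃.left]; exact (norm_sub_le _ _).trans (add_le_add h.n₂ h'.n₂)
  n₃ := by
    rw [L2_sub h.w₃.right h'.w₃.right]; exact (norm_sub_le _ _).trans (add_le_add h.n₃ h'.n₃)

lemma Pack.hasWeakDeriv {M : ℝ} {f f₁ f₂ f₃ : ℝ → ℝ} (h : Pack M f f₁ f₂ f₃) :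
    HasWeakDeriv 1 f f₁ ∧ HasWeakDeriv 2 f f₂ ∧ HasWeakDeriv 3 f f₃ := by
  have h1 := (HasWeakDeriv.zero f).succ h.w₁
  have h2 := h1.succ h.w₂
  exact ⟨h1, h2, h2.succ h.w₃⟩

lemma Pack.h3Bound {M : ℝ} {f f₁ f₂ f₃ : ℝ → ℝ} (h : Pack M f f₁ f₂ f₃) : H3Bound M f := by
  obtain ⟨h1, h2, h3⟩ := h.hasWeakDeriv
  have e : ∀ {g : ℝ → ℝ}, MemLp g 2 volume → ‖L2 g‖ ≤ M →
      eLpNorm g 2 volume ≤ ENNReal.ofReal M := fun hg hM => by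
    rw [eLpNorm_eq_norm_L2 hg]; exact ENNReal.ofReal_le_ofReal hM
  refine ⟨h.w₁.left, fun k hk => ?_⟩
  interval_cases k
  · exact ⟨f, h.w₁.left, HasWeakDeriv.zero f, e h.w₁.left h.n₀⟩
  · exact ⟨f₁, h.w₂.left, h1, e h.w₂.left h.n₁⟩
  · exact ⟨f₂, h.w₃.left, h2, e h.w₃.left h.n₂⟩
  · exact ⟨f₃, h.w₃.right, h3, e h.w₃.right h.n₃⟩

/-- Each weak derivative has the next one as its own weak derivative, so all but the highest have
absolutely continuous representatives. That of `f` is `f` itself, by continuity. -/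
lemma H3Bound.exists_pack {M : ℝ} (hM : 0 ≤ M) {f : ℝ → ℝ} (hf : Continuous f)
    (h : H3Bound M f) : ∃ f₁ f₂ f₃, Pack M f f₁ f₂ f₃ := by
  obtain ⟨g0, m0, d0, n0⟩ := h.2 0 (by norm_num)
  obtain ⟨g1, m1, d1, n1⟩ := h.2 1 (by norm_num)
  obtain ⟨g2, m2, d2, n2⟩ := h.2 2 (by norm_num)
  obtain ⟨g3, m3, d3, n3⟩ := h.2 3 (by norm_num)
  obtain ⟨F0, e0, W0⟩ := d1.exists_W h.1 m1
  obtain ⟨F1, e1, W1⟩ := (d1.sub_one d2).exists_W m1 m2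
  obtain ⟨F2, e2, W2⟩ := (d2.sub_one d3).exists_W m2 m3
  have hF0 : f = F0 := (hf.ae_eq_iff_eq volume W0.continuous).1 e0
  subst hF0
  have hz : g0 =ᵐ[volume] f := d0.ae_eq (HasWeakDeriv.zero f) m0 h.1
  refine ⟨F1, F2, g3, W0.congr_right e1, W1.congr_right e2, W2, ?_, ?_, ?_, ?_⟩
  · rw [← L2_congr hz]; exact norm_L2_le hM n0
  · rw [← L2_congr e1]; exact norm_L2_le hM n1
  · rw [← L2_congr e2]; exact norm_L2_le hM n2
  · exact norm_L2_le hM n3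

lemma MemH3.exists_pack {f : ℝ → ℝ} (hf : Continuous f) (h : MemH3 f) :
    ∃ M f₁ f₂ f₃, Pack M f f₁ f₂ f₃ := by
  obtain ⟨M, hM⟩ := h
  have h' : H3Bound (max M 0) f := ⟨hM.1, fun k hk => by
    obtain ⟨g, a, b, c⟩ := hM.2 k hk
    exact ⟨g, a, b, c.trans (ENNReal.ofReal_le_ofReal (le_max_left _ _))⟩⟩
  exact ⟨max M 0, h'.exists_pack (le_max_right _ _) hf⟩

/-! ### Density of test functions -/

lemma eq_zero_of_inner_test {u : H} (hu : ∀ φ : ℝ → ℝ, ContDiff ℝ (⊤ : ℕ∞) φ →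
    HasCompactSupport φ → ⟪u, L2 φ⟫_ℝ = 0) : u = 0 := by
  have hm := Lp.memLp u
  have : (u : ℝ → ℝ) =ᵐ[volume] 0 := by
    refine ae_eq_zero_of_integral_contDiff_smul_eq_zero (hm.locallyIntegrable (by norm_num))
      fun φ h1 h2 => ?_
    have := hu φ h1 h2
    rw [← L2_coe u, inner_L2 hm (memLp_test h1 h2)] at this
    rw [← this]; congr 1; ext x; simp [mul_comm]
  exact (Lp.eq_zero_iff_ae_eq_zero).2 this

/-- Bounded families that converge weakly against test functions converge weakly. -/
lemma tendsto_inner_of_test {ι : Type*} {l : Filter ι} {F : ι → H} {u : H} {M : ℝ}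
    (hF : ∀ᶠ i in l, ‖F i‖ ≤ M)
    (h : ∀ φ : ℝ → ℝ, ContDiff ℝ (⊤ : ℕ∞) φ → HasCompactSupport φ →
      Tendsto (fun i => ⟪F i, L2 φ⟫_ℝ) l (𝓝 ⟪u, L2 φ⟫_ℝ)) (p : H) :
    Tendsto (fun i => ⟪F i, p⟫_ℝ) l (𝓝 ⟪u, p⟫_ℝ) := by
  set S : Set H := {q | ∃ φ : ℝ → ℝ, ContDiff ℝ (⊤ : ℕ∞) φ ∧ HasCompactSupport φ ∧ q = L2 φ}
  set K := Submodule.span ℝ S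
  -- An element orthogonal to all test functions vanishes.
  have hK : Dense (K : Set H) := by
    rw [← Submodule.dense_iff_topologicalClosure_eq_top.symm,
      Submodule.topologicalClosure_eq_top_iff, Submodule.eq_bot_iff]
    intro q hq
    refine eq_zero_of_inner_test fun φ h1 h2 => ?_
    rw [real_inner_comm]
    exact (Submodule.mem_orthogonal K q).1 hq _ (Submodule.subset_span ⟨φ, h1, h2, rfl⟩)
  have hspan : ∀ q ∈ K, Tendsto (fun i => ⟪F i, q⟫_ℝ) l (𝓝 ⟪u, q⟫_ℝ) := by
    intro q hq
    induction hq using Submodule.span_induction with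
    | mem q hq => obtain ⟨φ, h1, h2, rfl⟩ := hq; exact h φ h1 h2
    | zero => simpa using tendsto_const_nhds
    | add a b _ _ ha hb => simpa only [inner_add_right] using ha.add hb
    | smul c a _ ha => simpa only [real_inner_smul_right] using ha.const_mul c
  rw [Metric.tendsto_nhds]
  intro ε hε
  set L := |M| + ‖u‖ + 1 with hL
  have hLpos : 0 < L := by positivity
  obtain ⟨q, hq, hpq⟩ := Metric.dense_iff.1 hK p (ε / (2 * L)) (by positivity)
  rw [Metric.mem_ball, dist_eq_norm] at hq
  have hq' : ‖p - q‖ < ε / (2 * L) := by rwa [norm_sub_rev]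
  filter_upwards [hF, Metric.tendsto_nhds.1 (hspan q hpq) (ε / 2) (by positivity)] with i h1 h2
  rw [Real.dist_eq] at h2 ⊢
  have e : ⟪F i, p⟫_ℝ - ⟪u, p⟫_ℝ = ⟪F i - u, p - q⟫_ℝ + (⟪F i, q⟫_ℝ - ⟪u, q⟫_ℝ) := by
    simp only [inner_sub_left, inner_sub_right]; ring
  have h3 : |⟪F i - u, p - q⟫_ℝ| ≤ ε / 2 := by
    refine (abs_real_inner_le_norm _ _).trans ?_
    have : ‖F i - u‖ ≤ L := by
      refine (norm_sub_le _ _).trans ?_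
      linarith [le_abs_self M]
    calc ‖F i - u‖ * ‖p - q‖ ≤ L * (ε / (2 * L)) := by gcongr
      _ = ε / 2 := by field_simp
  rw [e]
  refine (abs_add_le _ _).trans_lt ?_
  linarith

end KdV
end

noncomputable section

namespace KdV

open scoped InnerProductSpace

/-! ### Averaging operators -/

/-- The average of `f` over `[x + a, x + b]`. -/
def A (a b : ℝ) (f : ℝ → ℝ) (x : ℝ) : ℝ := (b - a)⁻¹ * ∫ y in (x + a)..(x + b), f y

lemma A_congr {a b : ℝ} {f g : ℝ → ℝ} (h : f =ᵐ[volume] g) : A a b f = A a b g := by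
  ext x
  unfold A
  rw [intervalIntegral.integral_congr_ae (h.mono fun y hy _ => hy)]

lemma memLp_shift {f : ℝ → ℝ} (hf : MemLp f 2 volume) (c : ℝ) :
    MemLp (fun x => f (x + c)) 2 volume :=
  hf.comp_measurePreserving (measurePreserving_add_right volume c)

lemma A_ftc {f : ℝ → ℝ} (hf : MemLp f 2 volume) (a b x y : ℝ) :
    A a b f y - A a b f x = ∫ z in x..y, (b - a)⁻¹ * (f (z + b) - f (z + a)) := by
  have hi := fun c d => memLp_intervalIntegrable hf c d
  have e1 : ∫ z in x..y, f (z + b) = ∫ z in (x + b)..(y + b), f z :=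
    intervalIntegral.integral_comp_add_right (f := f) b
  have e2 : ∫ z in x..y, f (z + a) = ∫ z in (x + a)..(y + a), f z :=
    intervalIntegral.integral_comp_add_right (f := f) a
  rw [intervalIntegral.integral_const_mul, intervalIntegral.integral_sub
    (memLp_intervalIntegrable (memLp_shift hf b) _ _)
    (memLp_intervalIntegrable (memLp_shift hf a) _ _), e1, e2]
  unfold A
  have h1 := intervalIntegral.integral_add_adjacent_intervals (hi (x + a) (y + a)) (hi (y + a) (y + b))
  have h2 := intervalIntegral.integral_add_adjacent_intervals (hi (x + a) (x + b)) (hi (x + b) (y + b))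
  rw [← mul_sub]
  congr 1
  linarith

lemma continuous_A {f : ℝ → ℝ} (hf : MemLp f 2 volume) (a b : ℝ) : Continuous (A a b f) := by
  have hi := fun c d => memLp_intervalIntegrable hf c d
  have : A a b f = fun x => (b - a)⁻¹ *
      ((∫ y in (0 : ℝ)..(x + b), f y) - ∫ y in (0 : ℝ)..(x + a), f y) := by
    ext x
    rw [intervalIntegral.integral_interval_sub_left (hi _ _) (hi _ _)]; rfl
  rw [this]
  have hc := intervalIntegral.continuous_primitive hi 0
  exact continuous_const.mul ((hc.comp (continuous_id.add continuous_const)).sub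
    (hc.comp (continuous_id.add continuous_const)))

lemma lintegral_enorm_sq_eq {f : ℝ → ℝ} {μ : Measure ℝ} :
    eLpNorm f 2 μ ^ 2 = ∫⁻ x, ‖f x‖ₑ ^ 2 ∂μ := by
  have := eLpNorm_nnreal_pow_eq_lintegral (f := f) (μ := μ) (p := 2) (by norm_num)
  simpa using this

/-- The Cauchy-Schwarz inequality on the window, stated with extended nonnegative integrals so that
Tonelli's theorem applies directly. -/
lemma enorm_A_sq_le {f : ℝ → ℝ} (hf : StronglyMeasurable f) {a b : ℝ} (hab : a < b) (x : ℝ) :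
    ‖A a b f x‖ₑ ^ 2
      ≤ (ENNReal.ofReal (b - a))⁻¹ * ∫⁻ s in Ioc a b, ‖f (x + s)‖ₑ ^ 2 := by
  set κ := ENNReal.ofReal (b - a) with hκ
  have hκ0 : κ ≠ 0 := by simpa [hκ] using hab
  have hκt : κ ≠ ⊤ := ENNReal.ofReal_ne_top
  set F : ℝ → ℝ := fun s => f (x + s)
  have hF : StronglyMeasurable F := hf.comp_measurable (measurable_const_add x)
  have h1 : ∫ y in (x + a)..(x + b), f y = ∫ s in a..b, F s := by
    rw [intervalIntegral.integral_comp_add_left (f := f) x]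
  have h2 : ‖∫ s in a..b, F s‖ₑ ≤ eLpNorm F 1 (volume.restrict (Ioc a b)) := by
    rw [intervalIntegral.integral_of_le hab.le, eLpNorm_one_eq_lintegral_enorm]
    exact enorm_integral_le_lintegral_enorm _
  have h3 := eLpNorm_le_eLpNorm_mul_rpow_measure_univ (p := 1) (q := 2)
    (μ := volume.restrict (Ioc a b)) (by norm_num) hF.aestronglyMeasurable
  have h4 : eLpNorm F 1 (volume.restrict (Ioc a b)) ^ 2
      ≤ (∫⁻ s in Ioc a b, ‖F s‖ₑ ^ 2) * κ := by
    refine (pow_le_pow_left' h3 2).trans ?_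
    rw [mul_pow, lintegral_enorm_sq_eq, Measure.restrict_apply_univ, Real.volume_Ioc, ← hκ,
      ← ENNReal.rpow_natCast, ← ENNReal.rpow_mul]
    norm_num
  have h5 : ‖(b - a)⁻¹‖ₑ = κ⁻¹ := by
    rw [Real.enorm_of_nonneg (inv_nonneg.2 (sub_pos.2 hab).le),
      ENNReal.ofReal_inv_of_pos (sub_pos.2 hab)]
  unfold A
  rw [enorm_mul, mul_pow, h1, h5]
  calc κ⁻¹ ^ 2 * ‖∫ s in a..b, F s‖ₑ ^ 2
      ≤ κ⁻¹ ^ 2 * ((∫⁻ s in Ioc a b, ‖F s‖ₑ ^ 2) * κ) := by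
        gcongr; exact (pow_le_pow_left' h2 2).trans h4
    _ = κ⁻¹ * (κ⁻¹ * κ) * ∫⁻ s in Ioc a b, ‖F s‖ₑ ^ 2 := by ring
    _ = _ := by rw [ENNReal.inv_mul_cancel hκ0 hκt, mul_one]

/-- Exchange the two integrals and use translation invariance for each shift: averaging is a
contraction of L². -/
lemma eLpNorm_A_le {f : ℝ → ℝ} (hf : MemLp f 2 volume) {a b : ℝ} (hab : a < b) :
    eLpNorm (A a b f) 2 volume ≤ eLpNorm f 2 volume := by
  obtain ⟨g, hg, hfg⟩ := hf.1
  rw [A_congr hfg, eLpNorm_congr_ae hfg]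
  have key : eLpNorm (A a b g) 2 volume ^ 2 ≤ eLpNorm g 2 volume ^ 2 := by
    rw [lintegral_enorm_sq_eq, lintegral_enorm_sq_eq]
    calc ∫⁻ x, ‖A a b g x‖ₑ ^ 2
        ≤ ∫⁻ x, (ENNReal.ofReal (b - a))⁻¹ * ∫⁻ s in Ioc a b, ‖g (x + s)‖ₑ ^ 2 :=
          lintegral_mono fun x => enorm_A_sq_le hg hab x
      _ = (ENNReal.ofReal (b - a))⁻¹ * ∫⁻ x, ∫⁻ s in Ioc a b, ‖g (x + s)‖ₑ ^ 2 := by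
          rw [lintegral_const_mul' _ _ (by simpa using hab)]
      _ = (ENNReal.ofReal (b - a))⁻¹ * ∫⁻ s in Ioc a b, ∫⁻ x, ‖g (x + s)‖ₑ ^ 2 := by
          rw [lintegral_lintegral_swap]
          have : Measurable (Function.uncurry fun x s : ℝ => ‖g (x + s)‖ₑ ^ 2) :=
            ((hg.measurable.comp (measurable_fst.add measurable_snd)).enorm).pow_const 2
          exact this.aemeasurable
      _ = (ENNReal.ofReal (b - a))⁻¹ * ∫⁻ _ in Ioc a b, ∫⁻ x, ‖g x‖ₑ ^ 2 := by
          congr 2; ext s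
          exact lintegral_add_right_eq_self (fun x => ‖g x‖ₑ ^ 2) s
      _ = _ := by
          rw [lintegral_const, Measure.restrict_apply_univ, Real.volume_Ioc, mul_comm, mul_assoc,
            ENNReal.mul_inv_cancel (by simpa using hab) ENNReal.ofReal_ne_top, mul_one]
  exact (ENNReal.pow_le_pow_left_iff (by norm_num)).1 key

lemma memLp_A {f : ℝ → ℝ} (hf : MemLp f 2 volume) {a b : ℝ} (hab : a < b) :
    MemLp (A a b f) 2 volume :=
  ⟨(continuous_A hf a b).aestronglyMeasurable, (eLpNorm_A_le hf hab).trans_lt hf.2⟩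

lemma norm_A_le {f : ℝ → ℝ} (hf : MemLp f 2 volume) {a b : ℝ} (hab : a < b) :
    ‖L2 (A a b f)‖ ≤ ‖L2 f‖ := by
  rw [norm_L2 (memLp_A hf hab), norm_L2 hf]
  exact ENNReal.toReal_mono hf.2.ne (eLpNorm_A_le hf hab)

/-- The derivative of a moving average is the difference quotient of its endpoint values. This is
how grid differences become derivatives, with only square integrability of `f` assumed. -/
lemma W_A {f : ℝ → ℝ} (hf : MemLp f 2 volume) {a b : ℝ} (hab : a < b) :
    W (A a b f) fun x => (b - a)⁻¹ * (f (x + b) - f (x + a)) where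
  left := memLp_A hf hab
  right := ((memLp_shift hf b).sub (memLp_shift hf a)).const_mul _
  ftc := fun x y => A_ftc hf a b x y

lemma W.A {f g : ℝ → ℝ} (h : W f g) {a b : ℝ} (hab : a < b) : W (A a b f) (A a b g) := by
  have := W_A h.left hab
  simp only [h.ftc] at this
  exact this

lemma A_add {f g : ℝ → ℝ} (hf : MemLp f 2 volume) (hg : MemLp g 2 volume) (a b : ℝ) :
    A a b (fun x => f x + g x) = fun x => A a b f x + A a b g x := by
  ext x
  simp only [KdV.A]
  rw [intervalIntegral.integral_add (memLp_intervalIntegrable hf _ _)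
    (memLp_intervalIntegrable hg _ _), mul_add]

lemma A_const_mul (f : ℝ → ℝ) (a b c : ℝ) :
    A a b (fun x => c * f x) = fun x => c * A a b f x := by
  ext x
  simp only [KdV.A]
  rw [intervalIntegral.integral_const_mul]; ring

lemma abs_A_le {f : ℝ → ℝ} {c : ℝ} {a b : ℝ} (hab : a < b) (h : ∀ x, |f x| ≤ c) (x : ℝ) :
    |A a b f x| ≤ c := by
  unfold A
  have h1 := intervalIntegral.norm_integral_le_of_norm_le_const (a := x + a) (b := x + b) (f := f)
    (C := c) (fun y _ => h y)
  rw [Real.norm_eq_abs, add_sub_add_left_eq_sub, abs_of_pos (sub_pos.2 hab)] at h1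
  rw [abs_mul, abs_of_pos (inv_pos.2 (sub_pos.2 hab)), inv_mul_le_iff₀ (sub_pos.2 hab)]
  linarith

/-- An average differs from the value by at most the deviation on the interval. -/
lemma abs_A_sub_le {f : ℝ → ℝ} {a b : ℝ} (hab : a < b) {x c δ : ℝ}
    (hf : IntervalIntegrable f volume (x + a) (x + b))
    (h : ∀ y ∈ Icc (x + a) (x + b), |f y - c| ≤ δ) : |A a b f x - c| ≤ δ := by
  have e : A a b f x - c = (b - a)⁻¹ * ∫ y in (x + a)..(x + b), (f y - c) := by
    rw [intervalIntegral.integral_sub hf intervalIntegrable_const, intervalIntegral.integral_const,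
      smul_eq_mul, add_sub_add_left_eq_sub, mul_sub, ← mul_assoc,
      inv_mul_cancel₀ (sub_pos.2 hab).ne', one_mul]; rfl
  have h1 := intervalIntegral.norm_integral_le_of_norm_le_const (a := x + a) (b := x + b)
    (f := fun y => f y - c) (C := δ) (fun y hy => h y (by
      rw [uIoc_of_le (by linarith)] at hy; exact ⟨hy.1.le, hy.2⟩))
  rw [Real.norm_eq_abs, add_sub_add_left_eq_sub, abs_of_pos (sub_pos.2 hab)] at h1
  rw [e, abs_mul, abs_of_pos (inv_pos.2 (sub_pos.2 hab)), inv_mul_le_iff₀ (sub_pos.2 hab)]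
  linarith

/-- The deviation on a window is controlled by an average of |g| and not by its supremum. Since
averages contract L², such pointwise bounds give L² bounds of order c. -/
lemma W.abs_sub_le {f g : ℝ → ℝ} (h : W f g) {x y c : ℝ} (hy : y ∈ Icc (x - c) (x + c)) :
    |f y - f x| ≤ 2 * c * KdV.A (-c) c (fun z => |g z|) x := by
  have hc : 0 ≤ c := by linarith [hy.1, hy.2]
  rcases hc.eq_or_lt with rfl | hc'
  · have : y = x := by simpa using hy
    simp [this]
  have e : 2 * c * KdV.A (-c) c (fun z => |g z|) x = ∫ z in (x - c)..(x + c), |g z| := by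
    unfold KdV.A
    rw [show c - -c = 2 * c by ring, ← sub_eq_add_neg, ← mul_assoc,
      mul_inv_cancel₀ (by positivity), one_mul]
  rw [e, h.ftc]
  have hi := memLp_intervalIntegrable (memLp_abs h.right) (x - c) (x + c)
  rw [intervalIntegral.integral_of_le (show x - c ≤ x + c by linarith)]
  refine (intervalIntegral.norm_integral_le_integral_norm_uIoc (f := g) (μ := volume)).trans ?_
  refine setIntegral_mono_set ?_ (Eventually.of_forall fun _ => abs_nonneg _) ?_
  · rwa [intervalIntegrable_iff_integrableOn_Ioc_of_le (by linarith)] at hi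
  · refine LE.le.eventuallyLE (fun z hz => ?_)
    rcases le_total x y with hxy | hxy
    · rw [uIoc_of_le hxy] at hz
      exact ⟨by linarith [hz.1], by linarith [hz.2, hy.2]⟩
    · rw [uIoc_of_ge hxy] at hz
      exact ⟨by linarith [hz.1, hy.1], by linarith [hz.2]⟩

lemma W.abs_A_sub_le {f g : ℝ → ℝ} (h : W f g) {a b c : ℝ} (hab : a < b) (ha : -c ≤ a)
    (hb : b ≤ c) (x : ℝ) :
    |KdV.A a b f x - f x| ≤ 2 * c * KdV.A (-c) c (fun z => |g z|) x :=
  KdV.abs_A_sub_le hab (memLp_intervalIntegrable h.left _ _) fun y hy =>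
    h.abs_sub_le ⟨by linarith [hy.1], by linarith [hy.2]⟩

lemma norm_L2_le_of_abs_le_A {f g : ℝ → ℝ} (hf : MemLp f 2 volume) (hg : MemLp g 2 volume)
    {c : ℝ} (hc : 0 < c) (h : ∀ x, |f x| ≤ 2 * c * A (-c) c (fun z => |g z|) x) :
    ‖L2 f‖ ≤ 2 * c * ‖L2 g‖ := by
  have hcc : -c < c := by linarith
  have hm := (memLp_A (memLp_abs hg) hcc)
  have h1 := norm_L2_mono hf (hm.const_mul (2 * c)) (fun x => (h x).trans (le_abs_self _))
  rw [L2_const_mul hm, norm_smul, Real.norm_of_nonneg (by positivity)] at h1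
  have h2 := norm_A_le (memLp_abs hg) hcc
  rw [norm_L2_abs hg] at h2
  exact h1.trans (by gcongr)

lemma W.norm_A_sub_le {f g : ℝ → ℝ} (h : W f g) {a b c : ℝ} (hab : a < b) (ha : -c ≤ a)
    (hb : b ≤ c) : ‖L2 (KdV.A a b f) - L2 f‖ ≤ 2 * c * ‖L2 g‖ := by
  have hm := memLp_A h.left hab
  rw [← L2_sub hm h.left]
  exact norm_L2_le_of_abs_le_A (hm.sub h.left) h.right (by linarith) (h.abs_A_sub_le hab ha hb)

/-! ### Step functions -/

/-- The step function with values `v j` on the cells `[xⱼ, xⱼ₊₁)`. -/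
def step (h : ℝ) (v : ℤ → ℝ) (x : ℝ) : ℝ := v ⌊x / h⌋

/-- The cell `[xⱼ, xⱼ₊₁)`. -/
def cell (h : ℝ) (j : ℤ) : Set ℝ := Ico (j * h) ((j + 1) * h)

variable {h : ℝ}

lemma mem_cell_iff (hh : 0 < h) {j : ℤ} {x : ℝ} : x ∈ cell h j ↔ ⌊x / h⌋ = j := by
  rw [Int.floor_eq_iff, le_div_iff₀ hh, div_lt_iff₀ hh]; rfl

lemma mem_cell_floor (hh : 0 < h) (x : ℝ) : x ∈ cell h ⌊x / h⌋ := (mem_cell_iff hh).2 rfl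

lemma measurableSet_cell (j : ℤ) : MeasurableSet (cell h j) := measurableSet_Ico

lemma volume_cell (j : ℤ) : volume (cell h j) = ENNReal.ofReal h := by
  rw [cell, Real.volume_Ico]; congr 1; ring

lemma pairwise_disjoint_cell (hh : 0 < h) : Pairwise (Function.onFun Disjoint (cell h)) := by
  intro i j hij
  rw [Function.onFun, Set.disjoint_left]
  intro x h1 h2
  exact hij (((mem_cell_iff hh).1 h1).symm.trans ((mem_cell_iff hh).1 h2))

lemma iUnion_cell (hh : 0 < h) : ⋃ j, cell h j = univ :=
  eq_univ_of_forall fun x => mem_iUnion.2 ⟨_, mem_cell_floor hh x⟩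

lemma lintegral_eq_tsum_cell (hh : 0 < h) (F : ℝ → ENNReal) :
    ∫⁻ x, F x = ∑' j, ∫⁻ x in cell h j, F x := by
  rw [← setLIntegral_univ, ← iUnion_cell hh,
    lintegral_iUnion (fun j => measurableSet_cell j) (pairwise_disjoint_cell hh)]

lemma measurable_step (h : ℝ) (v : ℤ → ℝ) : Measurable (step h v) :=
  (measurable_of_countable v).comp (Int.measurable_floor.comp (measurable_id.div_const h))

lemma eLpNorm_step (hh : 0 < h) (v : Grid) :
    eLpNorm (step h v) 2 volume = ENNReal.ofReal (√h * ‖v‖) := by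
  have key : eLpNorm (step h v) 2 volume ^ 2 = ENNReal.ofReal (√h * ‖v‖) ^ 2 := by
    rw [lintegral_enorm_sq_eq, lintegral_eq_tsum_cell hh, ← ENNReal.ofReal_pow (by positivity),
      mul_pow, Real.sq_sqrt hh.le]
    have e : ∀ j, ∫⁻ x in cell h j, ‖step h v x‖ₑ ^ 2 = ENNReal.ofReal (h * v j ^ 2) := by
      intro j
      have : ∀ x ∈ cell h j, ‖step h v x‖ₑ ^ 2 = ENNReal.ofReal (v j ^ 2) := by
        intro x hx
        rw [step, (mem_cell_iff hh).1 hx, ← ofReal_norm, ← ENNReal.ofReal_pow (norm_nonneg _)]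
        simp
      rw [setLIntegral_congr_fun (measurableSet_cell j) this, setLIntegral_const, volume_cell,
        ← ENNReal.ofReal_mul (sq_nonneg _), mul_comm]
    simp_rw [e]
    rw [← ENNReal.ofReal_tsum_of_nonneg (fun j => by positivity) (v.memL2.mul_left h),
      tsum_mul_left, ← Grid.norm_sq_eq]
  exact (ENNReal.pow_right_strictMono (n := 2) (by norm_num)).injective key

lemma memLp_step (hh : 0 < h) (v : Grid) : MemLp (step h v) 2 volume :=
  ⟨(measurable_step h v).aestronglyMeasurable, by rw [eLpNorm_step hh]; exact ENNReal.ofReal_lt_top⟩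

lemma norm_step (hh : 0 < h) (v : Grid) : ‖L2 (step h v)‖ = √h * ‖v‖ := by
  rw [norm_L2 (memLp_step hh v), eLpNorm_step hh, ENNReal.toReal_ofReal (by positivity)]

lemma step_add_h (hh : 0 < h) (v : ℤ → ℝ) (x : ℝ) : step h v (x + h) = v (⌊x / h⌋ + 1) := by
  rw [step, add_div, div_self hh.ne', Int.floor_add_one]

lemma step_sub_h (hh : 0 < h) (v : ℤ → ℝ) (x : ℝ) : step h v (x + -h) = v (⌊x / h⌋ - 1) := by
  rw [step, ← sub_eq_add_neg, sub_div, div_self hh.ne', Int.floor_sub_one]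

lemma W_A_step_c (hh : 0 < h) (v : Grid) :
    W (A (-h) h (step h v)) (step h (Grid.dC h v)) := by
  have := W_A (memLp_step hh v) (show -h < h by linarith)
  convert! this using 1
  ext x
  rw [step_add_h hh, step_sub_h hh, step, Grid.dC_apply]
  rw [show h - -h = 2 * h by ring]; field_simp

lemma W_A_step_m (hh : 0 < h) (v : Grid) :
    W (A (-h) 0 (step h v)) (step h (Grid.dM h v)) := by
  have := W_A (memLp_step hh v) (show -h < 0 by linarith)
  convert! this using 1
  ext x
  rw [add_zero, step_sub_h hh, step, Grid.dM_apply]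
  rw [show 0 - -h = h by ring]; unfold step; field_simp

lemma W_A_step_p (hh : 0 < h) (v : Grid) :
    W (A 0 h (step h v)) (step h (Grid.dP h v)) := by
  have := W_A (memLp_step hh v) hh
  convert! this using 1
  ext x
  rw [add_zero, step_add_h hh, step, Grid.dP_apply, sub_zero]
  unfold step; field_simp

/-- Averages of a step function over at most one cell to each side. -/
lemma abs_A_step_sub_le (hh : 0 < h) (v : Grid) {a b : ℝ} (hab : a < b) (ha : -h ≤ a)
    (hb : b ≤ h) (x : ℝ) : |A a b (step h v) x - step h v x|
      ≤ h * (|Grid.dP h v ⌊x / h⌋| + |Grid.dM h v ⌊x / h⌋|) := by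
  refine abs_A_sub_le hab (memLp_intervalIntegrable (memLp_step hh v) _ _) fun y hy => ?_
  set j := ⌊x / h⌋ with hj
  obtain ⟨h1, h2⟩ := mem_cell_floor hh x
  rw [← hj] at h1 h2
  set k := ⌊y / h⌋ with hk
  obtain ⟨k1, k2⟩ := mem_cell_floor hh y
  rw [← hk] at k1 k2
  -- Points at distance at most h lie in the same cell or in adjacent ones.
  have l1 : (j : ℝ) - 2 < k := by
    have : (j - 1) * h < (k + 1) * h := by linarith [hy.1]
    have := lt_of_mul_lt_mul_right this hh.le
    linarith
  have l2 : (k : ℝ) < j + 2 := by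
    have : k * h < (j + 2) * h := by linarith [hy.2]
    exact lt_of_mul_lt_mul_right this hh.le
  have l1' : j - 2 < k := by exact_mod_cast l1
  have l2' : k < j + 2 := by exact_mod_cast l2
  have p1 : |Grid.dP h v j| * h = |v (j + 1) - v j| := by
    rw [Grid.dP_apply, abs_div, abs_of_pos hh]; field_simp
  have p2 : |Grid.dM h v j| * h = |v j - v (j - 1)| := by
    rw [Grid.dM_apply, abs_div, abs_of_pos hh]; field_simp
  have e : step h v y - step h v x = v k - v j := rfl
  rw [e, mul_add, mul_comm h, mul_comm h, p1, p2]
  have : k = j - 1 ∨ k = j ∨ k = j + 1 := by omega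
  rcases this with r | r | r <;> rw [r]
  · rw [abs_sub_comm]; linarith [abs_nonneg (v (j + 1) - v j)]
  · rw [sub_self, abs_zero]; positivity
  · linarith [abs_nonneg (v j - v (j - 1))]

lemma norm_A_step_sub_le (hh : 0 < h) (v : Grid) {a b : ℝ} (hab : a < b) (ha : -h ≤ a)
    (hb : b ≤ h) : ‖L2 (A a b (step h v)) - L2 (step h v)‖ ≤ 2 * h * (√h * ‖Grid.dP h v‖) := by
  have hm := memLp_A (memLp_step hh v) hab
  have m1 := memLp_abs (memLp_step hh (Grid.dP h v))
  have m2 := memLp_abs (memLp_step hh (Grid.dM h v))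
  rw [← L2_sub hm (memLp_step hh v)]
  have h1 : ‖L2 fun x => A a b (step h v) x - step h v x‖
      ≤ ‖L2 fun x => h * (|step h (Grid.dP h v) x| + |step h (Grid.dM h v) x|)‖ :=
    norm_L2_mono (hm.sub (memLp_step hh v)) ((m1.add m2).const_mul h) (fun x =>
      (abs_A_step_sub_le hh v hab ha hb x).trans (le_abs_self _))
  refine h1.trans ?_
  have e : L2 (fun x => h * (|step h (Grid.dP h v) x| + |step h (Grid.dM h v) x|))
      = h • (L2 (fun x => |step h (Grid.dP h v) x|) + L2 fun x => |step h (Grid.dM h v) x|) := by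
    rw [← L2_add m1 m2]
    exact L2_const_mul (m1.add m2) h
  rw [e, norm_smul, Real.norm_of_nonneg hh.le]
  have h2 := norm_add_le (L2 (fun x => |step h (Grid.dP h v) x|))
    (L2 fun x => |step h (Grid.dM h v) x|)
  rw [norm_L2_abs (memLp_step hh _), norm_L2_abs (memLp_step hh _), norm_step hh, norm_step hh,
    Grid.norm_dM] at h2
  nlinarith

/-! ### Smooth interpolation -/

/-- Smooth interpolation of a grid function. -/
def smooth (h : ℝ) (v : ℤ → ℝ) : ℝ → ℝ := A 0 h (A (-h) 0 (A (-h) h (step h v)))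

/-- First derivative of the smooth interpolation. -/
def smooth₁ (h : ℝ) (v : Grid) : ℝ → ℝ := A 0 h (A (-h) 0 (step h (Grid.dC h v)))

/-- Second derivative of the smooth interpolation. -/
def smooth₂ (h : ℝ) (v : Grid) : ℝ → ℝ := A 0 h (step h (Grid.dM h (Grid.dC h v)))

/-- Each average in `smooth` trades one difference for one derivative. After three of them the
derivative is exactly the step function of D₋DD₊v. -/
lemma W_smooth (hh : 0 < h) (v : Grid) : W (smooth h v) (smooth₁ h v) :=
  ((W_A_step_c hh v).A (by linarith)).A hh

lemma W_smooth₁ (hh : 0 < h) (v : Grid) : W (smooth₁ h v) (smooth₂ h v) :=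
  (W_A_step_m hh _).A hh

lemma W_smooth₂ (hh : 0 < h) (v : Grid) : W (smooth₂ h v) (step h (Grid.d3 h v)) := by
  have := W_A_step_p hh (Grid.dM h (Grid.dC h v))
  have e : Grid.dP h (Grid.dM h (Grid.dC h v)) = Grid.d3 h v := Grid.d2_dC v
  rwa [e] at this

lemma norm_smooth_le (hh : 0 < h) (v : Grid) : ‖L2 (smooth h v)‖ ≤ √h * ‖v‖ := by
  have m0 := memLp_step hh v
  have m1 := memLp_A m0 (show -h < h by linarith)
  have m2 := memLp_A m1 (show -h < 0 by linarith)
  rw [← norm_step hh]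
  exact (norm_A_le m2 hh).trans ((norm_A_le m1 (by linarith)).trans (norm_A_le m0 (by linarith)))

lemma norm_smooth₁_le (hh : 0 < h) (v : Grid) : ‖L2 (smooth₁ h v)‖ ≤ √h * ‖Grid.dP h v‖ := by
  have m0 := memLp_step hh (Grid.dC h v)
  have m1 := memLp_A m0 (show -h < 0 by linarith)
  refine (norm_A_le m1 hh).trans ((norm_A_le m0 (by linarith)).trans ?_)
  rw [norm_step hh]
  gcongr; exact Grid.norm_dC_le v

/-- Averages contract L², so the discrete energy bounds all derivatives up to order three with
constant one. -/
lemma pack_smooth (hh : 0 < h) (v : Grid) :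
    Pack (Grid.N h v) (smooth h v) (smooth₁ h v) (smooth₂ h v) (step h (Grid.d3 h v)) where
  w₁ := W_smooth hh v
  w₂ := W_smooth₁ hh v
  w₃ := W_smooth₂ hh v
  n₀ := (norm_smooth_le hh v).trans (Grid.norm_le_N hh v)
  n₁ := (norm_smooth₁_le hh v).trans (Grid.norm_dP_le_N hh v)
  n₂ := by
    refine (norm_A_le (memLp_step hh _) hh).trans ?_
    rw [norm_step hh, Grid.norm_dM]
    refine le_trans ?_ (Grid.norm_d2_le_N hh v)
    gcongr; exact Grid.norm_dP_dC_le v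
  n₃ := by rw [norm_step hh]; exact Grid.norm_d3_le_N hh v

lemma smooth_add (hh : 0 < h) (u v : Grid) :
    smooth h (u + v : Grid) = fun x => smooth h u x + smooth h v x := by
  have m := fun v => memLp_step hh v
  have m1 := fun v => memLp_A (m v) (show -h < h by linarith)
  have m2 := fun v => memLp_A (m1 v) (show -h < 0 by linarith)
  have e : step h (u + v : Grid) = fun x => step h u x + step h v x := by
    ext x; simp [step]
  unfold smooth
  rw [e, A_add (m u) (m v), A_add (m1 u) (m1 v), A_add (m2 u) (m2 v)]

lemma smooth_smul (c : ℝ) (u : Grid) :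
    smooth h (c • u : Grid) = fun x => c * smooth h u x := by
  have e : step h (c • u : Grid) = fun x => c * step h u x := by
    ext x; simp [step]
  unfold smooth
  rw [e, A_const_mul, A_const_mul, A_const_mul]

lemma memLp_smooth (hh : 0 < h) (v : Grid) : MemLp (smooth h v) 2 volume := (W_smooth hh v).left

/-- The smooth interpolation as a linear map to `L²`. -/
def smoothL (h : ℝ) (hh : 0 < h) : Grid →ₗ[ℝ] H where
  toFun v := L2 (smooth h v)
  map_add' u v := by rw [smooth_add hh, L2_add (memLp_smooth hh u) (memLp_smooth hh v)]
  map_smul' c v := by rw [smooth_smul, L2_const_mul (memLp_smooth hh v)]; rfl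

/-- Each of the three averages costs 2h times the first difference. -/
lemma norm_smooth_sub_step_le (hh : 0 < h) (v : Grid) :
    ‖L2 (smooth h v) - L2 (step h v)‖ ≤ 6 * h * (√h * ‖Grid.dP h v‖) := by
  have c := W_A_step_c hh v
  have b1 := (c.A (show -h < 0 by linarith)).norm_A_sub_le hh (c := h) (by linarith) le_rfl
  have b2 := c.norm_A_sub_le (show -h < 0 by linarith) (c := h) le_rfl hh.le
  have b3 := norm_A_step_sub_le hh v (show -h < h by linarith) le_rfl le_rfl
  have n1 : ‖L2 (step h (Grid.dC h v))‖ ≤ √h * ‖Grid.dP h v‖ := by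
    rw [norm_step hh]; gcongr; exact Grid.norm_dC_le v
  have n2 := (norm_A_le c.right (show -h < 0 by linarith)).trans n1
  have e : L2 (smooth h v) - L2 (step h v) = (L2 (smooth h v) - L2 (A (-h) 0 (A (-h) h (step h v))))
      + (L2 (A (-h) 0 (A (-h) h (step h v))) - L2 (A (-h) h (step h v)))
      + (L2 (A (-h) h (step h v)) - L2 (step h v)) := by abel
  rw [e]
  refine (norm_add₃_le).trans ?_
  calc _ ≤ 2 * h * (√h * ‖Grid.dP h v‖) + 2 * h * (√h * ‖Grid.dP h v‖)
        + 2 * h * (√h * ‖Grid.dP h v‖) := by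
        gcongr
        · exact b1.trans (by gcongr)
        · exact b2.trans (by gcongr)
    _ = _ := by ring

lemma norm_smooth₁_sub_step_le (hh : 0 < h) (v : Grid) :
    ‖L2 (smooth₁ h v) - L2 (step h (Grid.dC h v))‖ ≤ 4 * h * (√h * ‖Grid.d2 h v‖) := by
  set q := Grid.dC h v
  have c := W_A_step_m hh q
  have b2 := c.norm_A_sub_le hh (c := h) (by linarith) le_rfl
  have b3 := norm_A_step_sub_le hh q (show -h < 0 by linarith) le_rfl hh.le
  rw [norm_step hh, Grid.norm_dM] at b2
  have hq : ‖Grid.dP h q‖ ≤ ‖Grid.d2 h v‖ := Grid.norm_dP_dC_le v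
  have e : L2 (smooth₁ h v) - L2 (step h q) = (L2 (smooth₁ h v) - L2 (A (-h) 0 (step h q)))
      + (L2 (A (-h) 0 (step h q)) - L2 (step h q)) := by abel
  rw [e]
  refine (norm_add_le _ _).trans ?_
  calc _ ≤ 2 * h * (√h * ‖Grid.d2 h v‖) + 2 * h * (√h * ‖Grid.d2 h v‖) := by
        gcongr
        · exact b2.trans (by gcongr)
        · exact b3.trans (by gcongr)
    _ = _ := by ring

lemma abs_smooth_sub_le (hh : 0 < h) (v : Grid) {c : ℝ} (hc : ∀ j, |Grid.dP h v j| ≤ c) (x : ℝ) :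
    |smooth h v x - step h v x| ≤ 6 * h * c := by
  have hm : ∀ j, |Grid.dM h v j| ≤ c := fun j => by rw [Grid.dM_eq]; exact hc _
  have hC : ∀ x, |step h (Grid.dC h v) x| ≤ c := fun x => by
    have h1 := abs_le.1 (hc ⌊x / h⌋)
    have h2 := abs_le.1 (hc (⌊x / h⌋ - 1))
    have : Grid.dC h v ⌊x / h⌋ = (Grid.dP h v ⌊x / h⌋ + Grid.dP h v (⌊x / h⌋ - 1)) / 2 := by
      simp; ring
    rw [step, this, abs_le]; constructor <;> linarith
  have w := W_A_step_c hh v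
  have hb : ∀ {g : ℝ → ℝ}, (∀ x, |g x| ≤ c) → A (-h) h (fun z => |g z|) x ≤ c := fun hg =>
    (le_abs_self _).trans (abs_A_le (by linarith) (fun z => by rw [abs_abs]; exact hg z) x)
  have b1 := (w.A (show -h < 0 by linarith)).abs_A_sub_le hh (c := h) (by linarith) le_rfl x
  have b2 := w.abs_A_sub_le (show -h < 0 by linarith) (c := h) le_rfl hh.le x
  have b3 := abs_A_step_sub_le hh v (show -h < h by linarith) le_rfl le_rfl x
  have c1 := hb (abs_A_le (show -h < 0 by linarith) hC)
  have c2 := hb hC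
  have c3 := hc ⌊x / h⌋
  have c4 := hm ⌊x / h⌋
  have e : smooth h v x - step h v x = (smooth h v x - A (-h) 0 (A (-h) h (step h v)) x)
      + (A (-h) 0 (A (-h) h (step h v)) x - A (-h) h (step h v) x)
      + (A (-h) h (step h v) x - step h v x) := by ring
  rw [e]
  refine (abs_add_three _ _ _).trans ?_
  have d1 := b1.trans (mul_le_mul_of_nonneg_left c1 (by positivity))
  have d2 := b2.trans (mul_le_mul_of_nonneg_left c2 (by positivity))
  have d3 := b3.trans (mul_le_mul_of_nonneg_left (add_le_add c3 c4) hh.le)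
  unfold smooth at *
  linarith

end KdV
end

noncomputable section

namespace KdV

open scoped InnerProductSpace

/-! ### Approximate solutions and their stability -/

/-- The flux of the equation, tested against a function with derivatives `p₁` and `p₃`. -/
def flux (f p₁ p₃ : ℝ → ℝ) : ℝ := 1 / 2 * (∫ x, f x ^ 2 * p₁ x) + ∫ x, f x * p₃ x

lemma Pack.abs_le {M : ℝ} {f f₁ f₂ f₃ : ℝ → ℝ} (h : Pack M f f₁ f₂ f₃) (x : ℝ) :
    |f x| ≤ 2 * M := h.w₁.abs_le h.n₀ h.n₁ x

lemma Pack.abs_le₁ {M : ℝ} {f f₁ f₂ f₃ : ℝ → ℝ} (h : Pack M f f₁ f₂ f₃) (x : ℝ) :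
    |f₁ x| ≤ 2 * M := h.w₂.abs_le h.n₁ h.n₂ x

lemma Pack.memLp_mul {M : ℝ} {f f₁ f₂ f₃ : ℝ → ℝ} (h : Pack M f f₁ f₂ f₃) :
    MemLp (fun x => f x * f₁ x) 2 volume :=
  memLp_bdd_mul h.w₁.continuous.aestronglyMeasurable h.w₁.right h.abs_le

lemma Pack.integral_third {M M' : ℝ} {f f₁ f₂ f₃ p p₁ p₂ p₃ : ℝ → ℝ} (h : Pack M f f₁ f₂ f₃)
    (hp : Pack M' p p₁ p₂ p₃) : ∫ x, f₃ x * p x = -∫ x, f x * p₃ x := by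
  rw [h.w₃.integral_mul hp.w₁, h.w₂.integral_mul hp.w₂, h.w₁.integral_mul hp.w₃, neg_neg]

/-- The weak form of the spatial operator. -/
lemma Pack.inner_eq_flux {M M' : ℝ} {f f₁ f₂ f₃ p p₁ p₂ p₃ : ℝ → ℝ} (h : Pack M f f₁ f₂ f₃)
    (hp : Pack M' p p₁ p₂ p₃) :
    ⟪L2 (fun x => f x * f₁ x + f₃ x), L2 p⟫_ℝ = -flux f p₁ p₃ := by
  rw [L2_add h.memLp_mul h.w₃.right, inner_add_left, inner_L2 h.memLp_mul hp.w₁.left,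
    inner_L2 h.w₃.right hp.w₁.left, h.integral_third hp, h.w₁.integral_mul_mul hp.w₁, flux]
  ring

lemma Pack.flux_sub {M M' M'' : ℝ} {f f₁ f₂ f₃ g g₁ g₂ g₃ p p₁ p₂ p₃ : ℝ → ℝ}
    (hf : Pack M f f₁ f₂ f₃) (hg : Pack M' g g₁ g₂ g₃) (hp : Pack M'' p p₁ p₂ p₃) :
    flux f p₁ p₃ - flux g p₁ p₃ = 1 / 2 * (∫ x, (f x - g x) * (f x + g x) * p₁ x)
      + ∫ x, (f x - g x) * p₃ x := by
  have i1 : ∀ {N : ℝ} {u u₁ u₂ u₃ : ℝ → ℝ}, Pack N u u₁ u₂ u₃ →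
      Integrable (fun x => u x ^ 2 * p₁ x) volume := fun hu =>
    (integrable_mul_of_memLp (memLp_bdd_mul hu.w₁.continuous.aestronglyMeasurable hu.w₁.left
      hu.abs_le) hp.w₁.right).congr (Eventually.of_forall fun x => by simp only; ring)
  have i2 : ∀ {N : ℝ} {u u₁ u₂ u₃ : ℝ → ℝ}, Pack N u u₁ u₂ u₃ →
      Integrable (fun x => u x * p₃ x) volume := fun hu =>
    integrable_mul_of_memLp hu.w₁.left hp.w₃.right
  have e1 : ∫ x, (f x - g x) * (f x + g x) * p₁ x
      = (∫ x, f x ^ 2 * p₁ x) - ∫ x, g x ^ 2 * p₁ x := by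
    rw [← integral_sub (i1 hf) (i1 hg)]; congr 1; ext x; ring
  have e2 : ∫ x, (f x - g x) * p₃ x = (∫ x, f x * p₃ x) - ∫ x, g x * p₃ x := by
    rw [← integral_sub (i2 hf) (i2 hg)]; congr 1; ext x; ring
  rw [e1, e2, flux, flux]; ring

/-- The flux is Lipschitz continuous in `L²`. -/
lemma Pack.abs_flux_sub_le {M M'' : ℝ} {f f₁ f₂ f₃ g g₁ g₂ g₃ p p₁ p₂ p₃ : ℝ → ℝ}
    (hf : Pack M f f₁ f₂ f₃) (hg : Pack M g g₁ g₂ g₃) (hp : Pack M'' p p₁ p₂ p₃) :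
    |flux f p₁ p₃ - flux g p₁ p₃| ≤ (2 * M + 1) * ‖L2 f - L2 g‖ * M'' := by
  have he := hf.w₁.left.sub hg.w₁.left
  have hb : ∀ x, |f x + g x| ≤ 4 * M := fun x =>
    (abs_add_le _ _).trans (by linarith [hf.abs_le x, hg.abs_le x])
  have hm : AEStronglyMeasurable (fun x => f x + g x) volume :=
    (hf.w₁.continuous.add hg.w₁.continuous).aestronglyMeasurable
  rw [hf.flux_sub hg hp, ← L2_sub hf.w₁.left hg.w₁.left]
  have a1 := abs_integral_mul_le (memLp_bdd_mul hm he hb) hp.w₁.right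
  have a2 := abs_integral_mul_le he hp.w₃.right
  have a3 := norm_L2_bdd_mul_le hm he hb
  have e1 : ∫ x, (f x - g x) * (f x + g x) * p₁ x
      = ∫ x, (f x + g x) * (f - g) x * p₁ x := by
    congr 1; ext x; simp only [Pi.sub_apply]; ring
  rw [e1]
  have hM := hf.nonneg
  set D := ‖L2 fun x => f x - g x‖
  have hD : ‖L2 (f - g)‖ = D := rfl
  rw [hD] at a2 a3
  have hD0 : 0 ≤ D := norm_nonneg _
  have a4 := a1.trans (mul_le_mul a3 hp.n₁ (norm_nonneg _) (by positivity))
  have a5 := a2.trans (mul_le_mul_of_nonneg_left hp.n₃ hD0)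
  refine (abs_add_le _ _).trans ?_
  rw [abs_mul, abs_of_pos (by norm_num : (0 : ℝ) < 1 / 2)]
  simp only [Pi.sub_apply] at a5 a4 ⊢
  linarith

/-- The flux difference tested against the difference itself. -/
lemma Pack.flux_sub_self_le {M : ℝ} {f f₁ f₂ f₃ g g₁ g₂ g₃ : ℝ → ℝ}
    (hf : Pack M f f₁ f₂ f₃) (hg : Pack M g g₁ g₂ g₃) :
    flux f (fun x => f₁ x - g₁ x) (fun x => f₃ x - g₃ x)
      - flux g (fun x => f₁ x - g₁ x) (fun x => f₃ x - g₃ x) ≤ M * ‖L2 f - L2 g‖ ^ 2 := by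
  have hp := hf.sub hg
  rw [hf.flux_sub hg hp]
  -- Three integrations by parts turn ∫ e e''' into its negative.
  have z : ∫ x, (f x - g x) * (f₃ x - g₃ x) = 0 := by
    have h1 := hp.integral_third hp
    have h2 : ∫ x, (f₃ x - g₃ x) * (f x - g x) = ∫ x, (f x - g x) * (f₃ x - g₃ x) := by
      congr 1; ext x; ring
    linarith
  have e1 : ∫ x, (f x - g x) * (f x + g x) * (f₁ x - g₁ x)
      = ∫ x, (f x - g x) * (f₁ x - g₁ x) * (f x + g x) := by congr 1; ext x; ring
  have he := hf.w₁.left.sub hg.w₁.left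
  have hb : ∀ x, |f₁ x + g₁ x| ≤ 4 * M := fun x =>
    (abs_add_le _ _).trans (by linarith [hf.abs_le₁ x, hg.abs_le₁ x])
  have hm : AEStronglyMeasurable (fun x => f₁ x + g₁ x) volume :=
    (hf.w₂.continuous.add hg.w₂.continuous).aestronglyMeasurable
  -- With e = f - g, ½∫ e e'(f + g) = -¼∫ e²(f' + g'), and |f' + g'| ≤ 4M, which gives the constant
  -- M.
  rw [z, e1, hp.w₁.integral_mul_mul (hf.w₁.add hg.w₁)]
  have a1 := abs_integral_mul_le (memLp_bdd_mul hm he hb) he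
  have a3 := norm_L2_bdd_mul_le hm he hb
  have e2 : ∫ x, (f x - g x) ^ 2 * (f₁ x + g₁ x)
      = ∫ x, (f₁ x + g₁ x) * (f - g) x * (f - g) x := by
    congr 1; ext x; simp only [Pi.sub_apply]; ring
  rw [e2, ← L2_sub hf.w₁.left hg.w₁.left]
  set D := ‖L2 fun x => f x - g x‖
  have hD : ‖L2 (f - g)‖ = D := rfl
  rw [hD] at a1 a3
  have a4 := (neg_le_abs _).trans (a1.trans (mul_le_mul_of_nonneg_right a3 (norm_nonneg _)))
  nlinarith

/-- A family of functions that solves the equation up to a weak error `ε`. -/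
structure ApproxSol (T M ε : ℝ) (w w₁ w₂ w₃ : ℝ → ℝ → ℝ) : Prop where
  pack : ∀ t ∈ Icc 0 T, Pack M (w t) (w₁ t) (w₂ t) (w₃ t)
  lip : ∀ s ∈ Icc 0 T, ∀ t ∈ Icc 0 T, ‖L2 (w s) - L2 (w t)‖ ≤ M * |s - t|
  eqn : ∀ᵐ t, t ∈ Ioo 0 T → ∃ z : H, HasDerivAt (fun s => L2 (w s)) z t ∧
    ∀ M' p p₁ p₂ p₃, Pack M' p p₁ p₂ p₃ → |⟪z, L2 p⟫_ℝ - flux (w t) p₁ p₃| ≤ ε * M'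

lemma ApproxSol.mono {T M M' ε ε' : ℝ} {w w₁ w₂ w₃ : ℝ → ℝ → ℝ}
    (h : ApproxSol T M ε w w₁ w₂ w₃) (hM : M ≤ M') (hε : ε ≤ ε') :
    ApproxSol T M' ε' w w₁ w₂ w₃ where
  pack t ht := (h.pack t ht).mono hM
  lip s hs t ht := (h.lip s hs t ht).trans (by gcongr)
  eqn := by
    filter_upwards [h.eqn] with t ht hmem
    obtain ⟨z, h1, h2⟩ := ht hmem
    refine ⟨z, h1, fun N p p₁ p₂ p₃ hp => (h2 N p p₁ p₂ p₃ hp).trans ?_⟩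
    have := hp.nonneg
    gcongr

/-- Gronwall's inequality for Lipschitz functions. -/
lemma gronwall_of_lipschitz {f : ℝ → ℝ} {T c k L : ℝ} (hc : 0 ≤ c) (hk : 0 ≤ k) (hL : 0 ≤ L)
    (hf : ∀ s ∈ Icc 0 T, ∀ t ∈ Icc 0 T, |f s - f t| ≤ L * |s - t|)
    (hd : ∀ᵐ t, t ∈ Ioo 0 T → ∃ d, HasDerivAt f d t ∧ d ≤ c * f t + k) {t : ℝ}
    (ht : t ∈ Icc 0 T) : f t ≤ (f 0 + k * t) * Real.exp (c * t) := by
  have hfl : LipschitzOnWith L.toNNReal f (uIcc 0 t) := by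
    refine LipschitzOnWith.of_dist_le_mul fun x hx y hy => ?_
    rw [uIcc_of_le ht.1] at hx hy
    rw [Real.dist_eq, Real.dist_eq, Real.coe_toNNReal _ hL]
    exact hf x ⟨hx.1, hx.2.trans ht.2⟩ y ⟨hy.1, hy.2.trans ht.2⟩
  have hE : ∀ s, HasDerivAt (fun s => Real.exp (-(c * s))) (-c * Real.exp (-(c * s))) s := fun s => by
    have := (((hasDerivAt_id s).const_mul c).neg).exp
    simp only [id, mul_one] at this
    rw [mul_comm]; exact this
  have hEc : ContDiff ℝ 1 fun s : ℝ => Real.exp (-(c * s)) := by fun_prop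
  have hkc : ContDiff ℝ 1 fun s : ℝ => k * s := by fun_prop
  -- The derivative of g is nonpositive almost everywhere, since the exponential factor is at most 1
  -- for s ≥ 0. Absolute continuity then makes g(t) ≤ g(0).
  set g : ℝ → ℝ := fun s => f s * Real.exp (-(c * s)) - k * s with hg
  have hgac : AbsolutelyContinuousOnInterval g 0 t :=
    (hfl.absolutelyContinuousOnInterval.mul
      hEc.contDiffOn.absolutelyContinuousOnInterval).sub
      hkc.contDiffOn.absolutelyContinuousOnInterval
  have hint : ∫ s in (0 : ℝ)..t, deriv g s ≤ 0 := by
    rw [intervalIntegral.integral_of_le ht.1]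
    refine integral_nonpos_of_ae ?_
    rw [EventuallyLE, ae_restrict_iff' measurableSet_Ioc]
    have hne : ∀ᵐ s : ℝ, s ≠ T := by
      have := (measure_singleton T : volume ({T} : Set ℝ) = 0)
      exact compl_mem_ae_iff.2 this
    filter_upwards [hd, hne] with s hs hsT hmem
    obtain ⟨d, h1, h2⟩ := hs ⟨hmem.1, lt_of_le_of_ne (hmem.2.trans ht.2) hsT⟩
    have h3 : HasDerivAt g (d * Real.exp (-(c * s)) + f s * (-c * Real.exp (-(c * s))) - k) s := by
      have h6 : HasDerivAt (fun s => k * s) k s := by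
        simpa using (hasDerivAt_id s).const_mul k
      exact (h1.mul (hE s)).sub h6
    rw [h3.deriv]
    have h4 : Real.exp (-(c * s)) ≤ 1 :=
      Real.exp_le_one_iff.2 (by have := mul_nonneg hc hmem.1.le; linarith)
    have h5 := Real.exp_pos (-(c * s))
    simp only [Pi.zero_apply]
    nlinarith
  rw [hgac.integral_deriv_eq_sub] at hint
  simp only [hg, mul_zero, neg_zero, Real.exp_zero, mul_one, sub_zero] at hint
  have h6 : f t * Real.exp (-(c * t)) ≤ f 0 + k * t := by linarith
  have h7 := mul_le_mul_of_nonneg_right h6 (Real.exp_pos (c * t)).le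
  rwa [mul_assoc, ← Real.exp_add, neg_add_cancel, Real.exp_zero, mul_one] at h7

/-- Stability of approximate solutions. -/
lemma ApproxSol.stability {T M ε ε' : ℝ} {w w₁ w₂ w₃ v v₁ v₂ v₃ : ℝ → ℝ → ℝ}
    (hε : 0 ≤ ε) (hε' : 0 ≤ ε')
    (hw : ApproxSol T M ε w w₁ w₂ w₃) (hv : ApproxSol T M ε' v v₁ v₂ v₃) {t : ℝ}
    (ht : t ∈ Icc 0 T) : ‖L2 (w t) - L2 (v t)‖ ^ 2
      ≤ (‖L2 (w 0) - L2 (v 0)‖ ^ 2 + 4 * M * (ε + ε') * T) * Real.exp (2 * M * T) := by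
  have hM : 0 ≤ M := (hw.pack t ht).nonneg
  set E : ℝ → H := fun s => L2 (w s) - L2 (v s) with hE
  have hEb : ∀ s ∈ Icc 0 T, ‖E s‖ ≤ 2 * M := fun s hs =>
    (norm_sub_le _ _).trans (by linarith [(hw.pack s hs).n₀, (hv.pack s hs).n₀])
  have hEl : ∀ s ∈ Icc 0 T, ∀ r ∈ Icc 0 T, ‖E s - E r‖ ≤ 2 * M * |s - r| := fun s hs r hr => by
    have e : E s - E r = (L2 (w s) - L2 (w r)) - (L2 (v s) - L2 (v r)) := by simp only [hE]; abel
    rw [e]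
    exact (norm_sub_le _ _).trans (by linarith [hw.lip s hs r hr, hv.lip s hs r hr])
  have := gronwall_of_lipschitz (f := fun s => ‖E s‖ ^ 2) (T := T) (c := 2 * M)
    (k := 4 * M * (ε + ε')) (L := 8 * M ^ 2) (by positivity) (by positivity) (by positivity)
    (fun s hs r hr => by
      have h1 := hEl s hs r hr
      have h2 := abs_norm_sub_norm_le (E s) (E r)
      have h3 : ‖E s‖ ^ 2 - ‖E r‖ ^ 2 = (‖E s‖ - ‖E r‖) * (‖E s‖ + ‖E r‖) := by ring
      rw [h3, abs_mul, abs_of_nonneg (by positivity : 0 ≤ ‖E s‖ + ‖E r‖)]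
      calc |‖E s‖ - ‖E r‖| * (‖E s‖ + ‖E r‖) ≤ (2 * M * |s - r|) * (2 * M + 2 * M) := by
            gcongr
            · exact h2.trans h1
            · exact hEb s hs
            · exact hEb r hr
        _ = _ := by ring) ?_ ht
  · refine this.trans ?_
    have hT : t ≤ T := ht.2
    have ht0 : 0 ≤ t := ht.1
    have hT0 : 0 ≤ T := ht0.trans hT
    gcongr
  · filter_upwards [hw.eqn, hv.eqn] with s h1 h2 hs
    obtain ⟨z, d1, e1⟩ := h1 hs
    obtain ⟨z', d2, e2⟩ := h2 hs
    have hs' : s ∈ Icc 0 T := Ioo_subset_Icc_self hs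
    have pw := hw.pack s hs'
    have pv := hv.pack s hs'
    -- The difference of the two families has three derivatives with norms at most 2M, so it is an
    -- admissible test function. With the factor 2 from the derivative of the square this gives the
    -- error 4M(ε + ε').
    have hp := pw.sub pv
    have hd : HasDerivAt E (z - z') s := d1.sub d2
    refine ⟨_, hd.norm_sq, ?_⟩
    have f1 := abs_le.1 (e1 _ _ _ _ _ hp)
    have f2 := abs_le.1 (e2 _ _ _ _ _ hp)
    have f3 := pw.flux_sub_self_le pv
    have e : ⟪E s, z - z'⟫_ℝ = ⟪z, L2 fun x => w s x - v s x⟫_ℝ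
        - ⟪z', L2 fun x => w s x - v s x⟫_ℝ := by
      rw [real_inner_comm, inner_sub_left, L2_sub pw.w₁.left pv.w₁.left]
    rw [e]
    have hEs : ‖E s‖ = ‖L2 (w s) - L2 (v s)‖ := rfl
    rw [hEs]
    nlinarith

end KdV
end

noncomputable section

namespace KdV

open scoped InnerProductSpace

variable {h : ℝ}

/-! ### Consistency of the space discretization -/

/-- The threefold average in the definition of the smooth interpolation. -/
def A3 (h : ℝ) (f : ℝ → ℝ) : ℝ → ℝ := A 0 h (A (-h) 0 (A (-h) h f))

lemma W.A3 (hh : 0 < h) {f g : ℝ → ℝ} (hw : W f g) : W (A3 h f) (A3 h g) :=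
  ((hw.A (by linarith)).A (by linarith)).A hh

lemma W.norm_A3_sub_le (hh : 0 < h) {f g : ℝ → ℝ} (hw : W f g) :
    ‖L2 (KdV.A3 h f) - L2 f‖ ≤ 6 * h * ‖L2 g‖ := by
  have w1 := hw.A (show -h < h by linarith)
  have w2 := w1.A (show -h < 0 by linarith)
  have b1 := hw.norm_A_sub_le (show -h < h by linarith) le_rfl le_rfl
  have b2 := w1.norm_A_sub_le (show -h < 0 by linarith) (c := h) le_rfl hh.le
  have b3 := w2.norm_A_sub_le hh (c := h) (by linarith) le_rfl
  have n1 := norm_A_le hw.right (show -h < h by linarith)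
  have n2 := (norm_A_le w1.right (show -h < 0 by linarith)).trans n1
  have e : L2 (KdV.A3 h f) - L2 f
      = (L2 (KdV.A3 h f) - L2 (KdV.A (-h) 0 (KdV.A (-h) h f)))
      + (L2 (KdV.A (-h) 0 (KdV.A (-h) h f)) - L2 (KdV.A (-h) h f))
      + (L2 (KdV.A (-h) h f) - L2 f) := by abel
  rw [e]
  refine (norm_add₃_le).trans ?_
  calc _ ≤ 2 * h * ‖L2 g‖ + 2 * h * ‖L2 g‖ + 2 * h * ‖L2 g‖ := by
        gcongr
        · exact b3.trans (by gcongr)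
        · exact b2.trans (by gcongr)
    _ = _ := by ring

/-! ### Bounds for the discrete nonlinearity -/

lemma Grid.norm_Bl_le (hh : 0 < h) (v : Grid) :
    √h * ‖Grid.Bl h v v‖ ≤ 2 * Grid.N h v ^ 2 := by
  have h1 := Grid.norm_mul_le (mul_nonneg zero_le_two (Grid.N_nonneg v))
    (Grid.abs_av_le (Grid.abs_apply_le_N hh v)) (Grid.dC h v)
  have h2 := Grid.norm_dC_le (h := h) v
  have h3 := Grid.norm_dP_le_N hh v
  have h4 := Grid.N_nonneg (h := h) v
  calc √h * ‖Grid.Bl h v v‖ ≤ √h * (2 * Grid.N h v * ‖Grid.dP h v‖) := by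
        gcongr; exact h1.trans (by gcongr)
    _ = 2 * Grid.N h v * (√h * ‖Grid.dP h v‖) := by ring
    _ ≤ 2 * Grid.N h v * Grid.N h v := by gcongr
    _ = _ := by ring

lemma Grid.dP_mul (a w : Grid) : Grid.dP h (Grid.mul a w)
    = Grid.mul (Grid.shift 1 a) (Grid.dP h w) + Grid.mul (Grid.dP h a) w := by
  ext j
  simp only [Grid.dP_apply, Grid.mul_apply, lp.coeFn_add, Pi.add_apply, Grid.shift_apply]
  ring

/-- The first difference of the nonlinearity is needed because replacing a step function by its
smooth interpolation costs h times that difference. -/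
lemma Grid.norm_dP_Bl_le (hh : 0 < h) (v : Grid) :
    √h * ‖Grid.dP h (Grid.Bl h v v)‖ ≤ 4 * Grid.N h v ^ 2 := by
  have h4 := Grid.N_nonneg (h := h) v
  have h1 := Grid.norm_mul_le (a := Grid.shift 1 (Grid.av v)) (mul_nonneg zero_le_two h4)
    (fun j => by rw [Grid.shift_apply]; exact Grid.abs_av_le (Grid.abs_apply_le_N hh v) _)
    (Grid.dP h (Grid.dC h v))
  have h2 := Grid.norm_mul_le (a := Grid.dP h (Grid.av v)) (mul_nonneg zero_le_two h4)
    (fun j => by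
      rw [Grid.dP_av]; exact Grid.abs_av_le (Grid.abs_dP_le_N hh v) _) (Grid.dC h v)
  have h5 := Grid.norm_dC_le (h := h) v
  have h6 := Grid.norm_dP_dC_le (h := h) v
  rw [Grid.Bl, Grid.dP_mul]
  calc _ ≤ √h * (2 * Grid.N h v * ‖Grid.d2 h v‖ + 2 * Grid.N h v * ‖Grid.dP h v‖) := by
        gcongr
        refine (norm_add_le _ _).trans (add_le_add (h1.trans (by gcongr)) (h2.trans (by gcongr)))
    _ = 2 * Grid.N h v * (√h * ‖Grid.d2 h v‖) + 2 * Grid.N h v * (√h * ‖Grid.dP h v‖) := by ring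
    _ ≤ 2 * Grid.N h v * Grid.N h v + 2 * Grid.N h v * Grid.N h v := by
        gcongr
        · exact Grid.norm_d2_le_N hh v
        · exact Grid.norm_dP_le_N hh v
    _ = _ := by ring

lemma Grid.norm_av_sub_le (hh : 0 < h) (v : Grid) : ‖Grid.av v - v‖ ≤ h * ‖Grid.dP h v‖ := by
  have e : Grid.av v - v = (h / 3) • (Grid.dP h v - Grid.dM h v) := by
    ext j
    simp only [lp.coeFn_sub, Pi.sub_apply, Grid.av_apply, lp.coeFn_smul, Pi.smul_apply,
      Grid.dP_apply, Grid.dM_apply, smul_eq_mul]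
    field_simp; ring
  rw [e, norm_smul, Real.norm_of_nonneg (by positivity)]
  have := norm_sub_le (Grid.dP h v) (Grid.dM h v)
  rw [Grid.norm_dM] at this
  calc _ ≤ h / 3 * (‖Grid.dP h v‖ + ‖Grid.dP h v‖) := by gcongr
    _ ≤ _ := by nlinarith [mul_nonneg hh.le (norm_nonneg (Grid.dP h v))]

lemma L2_step_sub (hh : 0 < h) (u v : Grid) :
    L2 (step h u) - L2 (step h v) = L2 (step h (u - v : Grid)) := by
  rw [← L2_sub (memLp_step hh u) (memLp_step hh v)]; rfl

/-- The discrete nonlinearity approximates the continuous one. -/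
lemma norm_smooth_Bl_sub_le (hh : 0 < h) (v : Grid) :
    ‖L2 (smooth h (Grid.Bl h v v)) - L2 (fun x => smooth h v x * smooth₁ h v x)‖
      ≤ 46 * h * Grid.N h v ^ 2 := by
  set Q := Grid.N h v with hQ
  have hQ0 : 0 ≤ Q := Grid.N_nonneg v
  have p := pack_smooth hh v
  have hdP := Grid.norm_dP_le_N hh v
  have hd2 := Grid.norm_d2_le_N hh v
  rw [← hQ] at p hdP hd2
  have ms := memLp_step hh (Grid.Bl h v v)
  have mdC := memLp_step hh (Grid.dC h v)
  have mav := memLp_step hh (Grid.av v)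
  -- The three errors below enter with the constants 24, 2 · 7 and 2 · 4, where the factors 2 come
  -- from sup norm bounds of the cofactors; the sum is 46.
  have b1 : ‖L2 (smooth h (Grid.Bl h v v)) - L2 (step h (Grid.Bl h v v))‖ ≤ 24 * h * Q ^ 2 := by
    refine (norm_smooth_sub_step_le hh _).trans ?_
    have := Grid.norm_dP_Bl_le hh v
    nlinarith
  have b2 : ‖L2 (step h (Grid.av v)) - L2 (smooth h v)‖ ≤ 7 * h * Q := by
    have c1 := norm_smooth_sub_step_le hh v
    have c2 : ‖L2 (step h (Grid.av v)) - L2 (step h v)‖ ≤ h * (√h * ‖Grid.dP h v‖) := by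
      rw [L2_step_sub hh, KdV.norm_step hh]
      have := mul_le_mul_of_nonneg_left (Grid.norm_av_sub_le hh v) (Real.sqrt_nonneg h)
      linarith
    have c3 := norm_sub_le_norm_sub_add_norm_sub (L2 (step h (Grid.av v))) (L2 (step h v))
      (L2 (smooth h v))
    rw [norm_sub_rev (L2 (step h v))] at c3
    nlinarith
  have b3 : ‖L2 (step h (Grid.dC h v)) - L2 (smooth₁ h v)‖ ≤ 4 * h * Q := by
    rw [norm_sub_rev]
    refine (norm_smooth₁_sub_step_le hh v).trans ?_
    gcongr
  have m1 : MemLp (fun x => step h (Grid.dC h v) x * (step h (Grid.av v) x - smooth h v x)) 2 volume :=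
    memLp_bdd_mul (measurable_step _ _).aestronglyMeasurable (mav.sub p.w₁.left)
      (fun x => Grid.abs_dC_le_N hh v _)
  have m2 : MemLp (fun x => smooth h v x * (step h (Grid.dC h v) x - smooth₁ h v x)) 2 volume :=
    memLp_bdd_mul p.w₁.continuous.aestronglyMeasurable (mdC.sub p.w₂.left) p.abs_le
  have e : L2 (step h (Grid.Bl h v v)) - L2 (fun x => smooth h v x * smooth₁ h v x)
      = L2 (fun x => step h (Grid.dC h v) x * (step h (Grid.av v) x - smooth h v x))
        + L2 (fun x => smooth h v x * (step h (Grid.dC h v) x - smooth₁ h v x)) := by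
    rw [← L2_sub ms p.memLp_mul, ← L2_add m1 m2]
    congr 1; ext x
    have : step h (Grid.Bl h v v) x = step h (Grid.av v) x * step h (Grid.dC h v) x := rfl
    rw [this]; ring
  have n1 := norm_L2_bdd_mul_le (measurable_step h (Grid.dC h v)).aestronglyMeasurable
    (mav.sub p.w₁.left) (fun x => Grid.abs_dC_le_N hh v _)
  have n2 := norm_L2_bdd_mul_le p.w₁.continuous.aestronglyMeasurable (mdC.sub p.w₂.left) p.abs_le
  have f1 : L2 (step h (Grid.av v) - smooth h v) = L2 (step h (Grid.av v)) - L2 (smooth h v) :=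
    L2_sub mav p.w₁.left
  have f2 : L2 (step h (Grid.dC h v) - smooth₁ h v) = L2 (step h (Grid.dC h v)) - L2 (smooth₁ h v) :=
    L2_sub mdC p.w₂.left
  rw [f1] at n1; rw [f2] at n2
  have n1' := n1.trans (mul_le_mul_of_nonneg_left b2 (by positivity))
  have n2' := n2.trans (mul_le_mul_of_nonneg_left b3 (by positivity))
  have t := norm_sub_le_norm_sub_add_norm_sub (L2 (smooth h (Grid.Bl h v v)))
    (L2 (step h (Grid.Bl h v v))) (L2 (fun x => smooth h v x * smooth₁ h v x))
  rw [e] at t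
  have t2 := norm_add_le (L2 (fun x => step h (Grid.dC h v) x * (step h (Grid.av v) x - smooth h v x)))
    (L2 (fun x => smooth h v x * (step h (Grid.dC h v) x - smooth₁ h v x)))
  simp only [Pi.sub_apply] at n1' n2'
  nlinarith

/-- Consistency of the spatial discretization in weak form. -/
lemma abs_inner_smooth_add_flux_le (hh : 0 < h) (v : Grid) {M' : ℝ} {p p₁ p₂ p₃ : ℝ → ℝ}
    (hp : Pack M' p p₁ p₂ p₃) :
    |⟪L2 (smooth h (Grid.Bl h v v + Grid.d3 h v : Grid)), L2 p⟫_ℝ + flux (smooth h v) p₁ p₃|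
      ≤ (46 * Grid.N h v ^ 2 + 6 * Grid.N h v) * h * M' := by
  have q := pack_smooth hh v
  have hM' := hp.nonneg
  have hQ0 : 0 ≤ Grid.N h v := Grid.N_nonneg v
  have e1 : L2 (smooth h (Grid.Bl h v v + Grid.d3 h v : Grid))
      = L2 (smooth h (Grid.Bl h v v)) + L2 (smooth h (Grid.d3 h v)) :=
    (smoothL h hh).map_add _ _
  have e2 := q.inner_eq_flux hp
  rw [L2_add q.memLp_mul q.w₃.right, inner_add_left] at e2
  -- The smooth interpolation of the third difference is the threefold average of the third
  -- derivative of `smooth h v`. Averaging commutes with differentiation, so all derivatives move to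
  -- p. What remains is the average minus the identity on `smooth h v`, of order h in L² although no
  -- fourth derivative is available.
  have wA : ⟪L2 (smooth h (Grid.d3 h v)), L2 p⟫_ℝ = -∫ x, A3 h (smooth h v) x * p₃ x := by
    rw [inner_L2 (memLp_smooth hh _) hp.w₁.left]
    have : smooth h (Grid.d3 h v) = A3 h (step h (Grid.d3 h v)) := rfl
    rw [this, (q.w₃.A3 hh).integral_mul hp.w₁, (q.w₂.A3 hh).integral_mul hp.w₂,
      (q.w₁.A3 hh).integral_mul hp.w₃, neg_neg]
  have wB : ⟪L2 (step h (Grid.d3 h v)), L2 p⟫_ℝ = -∫ x, smooth h v x * p₃ x := by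
    rw [inner_L2 q.w₃.right hp.w₁.left, q.integral_third hp]
  rw [← inner_L2 (q.w₁.A3 hh).left hp.w₃.right] at wA
  rw [← inner_L2 q.w₁.left hp.w₃.right] at wB
  have key : ⟪L2 (smooth h (Grid.Bl h v v + Grid.d3 h v : Grid)), L2 p⟫_ℝ + flux (smooth h v) p₁ p₃
      = ⟪L2 (smooth h (Grid.Bl h v v)) - L2 (fun x => smooth h v x * smooth₁ h v x), L2 p⟫_ℝ
        - ⟪L2 (A3 h (smooth h v)) - L2 (smooth h v), L2 p₃⟫_ℝ := by
    rw [e1, inner_add_left, inner_sub_left, inner_sub_left, wA]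
    rw [wB] at e2
    linarith
  rw [key]
  have i1 := abs_real_inner_le_norm
    (L2 (smooth h (Grid.Bl h v v)) - L2 (fun x => smooth h v x * smooth₁ h v x)) (L2 p)
  have i2 := abs_real_inner_le_norm (L2 (A3 h (smooth h v)) - L2 (smooth h v)) (L2 p₃)
  have j1 := i1.trans (mul_le_mul (norm_smooth_Bl_sub_le hh v) hp.n₀ (norm_nonneg _)
    (by positivity))
  have j2 := i2.trans (mul_le_mul ((q.w₁.norm_A3_sub_le hh).trans
    (mul_le_mul_of_nonneg_left q.n₁ (by positivity))) hp.n₃ (norm_nonneg _) (by positivity))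
  refine (abs_sub _ _).trans ?_
  linarith

/-! ### Interpolation in time -/

/-- The piecewise affine interpolation in time of a sequence of grid functions. -/
def Grid.path (dt : ℝ) (u : ℕ → Grid) (t : ℝ) : Grid :=
  u ⌊t / dt⌋₊ + ((t - ⌊t / dt⌋₊ * dt) / dt) • (u (⌊t / dt⌋₊ + 1) - u ⌊t / dt⌋₊)

lemma floor_mul_le {dt : ℝ} (hdt : 0 < dt) {t : ℝ} (ht : 0 ≤ t) : ⌊t / dt⌋₊ * dt ≤ t := by
  rw [← le_div_iff₀ hdt]; exact Nat.floor_le (by positivity)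

lemma lt_floor_add_one_mul {dt : ℝ} (hdt : 0 < dt) (t : ℝ) : t < (⌊t / dt⌋₊ + 1) * dt := by
  rw [← div_lt_iff₀ hdt]; exact Nat.lt_floor_add_one _

lemma Grid.path_zero (dt : ℝ) (u : ℕ → Grid) : Grid.path dt u 0 = u 0 := by
  simp [Grid.path]

lemma norm_add_smul_sub_sq_le {E : Type*} [NormedAddCommGroup E] [InnerProductSpace ℝ E]
    (a b : E) {θ : ℝ} (h0 : 0 ≤ θ) (h1 : θ ≤ 1) :
    ‖a + θ • (b - a)‖ ^ 2 ≤ (1 - θ) * ‖a‖ ^ 2 + θ * ‖b‖ ^ 2 := by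
  have e : a + θ • (b - a) = (1 - θ) • a + θ • b := by module
  have h2 : ‖a + θ • (b - a)‖ ≤ (1 - θ) * ‖a‖ + θ * ‖b‖ := by
    rw [e]
    refine (norm_add_le _ _).trans ?_
    rw [norm_smul, norm_smul, Real.norm_of_nonneg h0, Real.norm_of_nonneg (by linarith)]
  have h3 := pow_le_pow_left₀ (norm_nonneg _) h2 2
  nlinarith [mul_nonneg (mul_nonneg h0 (sub_nonneg.2 h1)) (sq_nonneg (‖a‖ - ‖b‖))]

lemma Grid.N_add_smul_sub_le (hh : 0 < h) {u v : Grid} {c θ : ℝ} (hc : 0 ≤ c) (h0 : 0 ≤ θ)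
    (h1 : θ ≤ 1) (hu : Grid.N h u ≤ c) (hv : Grid.N h v ≤ c) :
    Grid.N h (u + θ • (v - u)) ≤ c := by
  refine (abs_le_of_sq_le_sq' ?_ hc).2
  have a1 := pow_le_pow_left₀ (Grid.N_nonneg u) hu 2
  have a2 := pow_le_pow_left₀ (Grid.N_nonneg v) hv 2
  rw [Grid.N_sq hh] at *
  simp only [map_add, map_smul, map_sub]
  have b1 := norm_add_smul_sub_sq_le u v h0 h1
  have b2 := norm_add_smul_sub_sq_le (Grid.d2 h u) (Grid.d2 h v) h0 h1
  have b3 := norm_add_smul_sub_sq_le (Grid.d3 h u) (Grid.d3 h v) h0 h1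
  calc _ ≤ h * (((1 - θ) * ‖u‖ ^ 2 + θ * ‖v‖ ^ 2) + ((1 - θ) * ‖Grid.d2 h u‖ ^ 2
        + θ * ‖Grid.d2 h v‖ ^ 2) + ((1 - θ) * ‖Grid.d3 h u‖ ^ 2 + θ * ‖Grid.d3 h v‖ ^ 2)) := by
        gcongr
    _ = (1 - θ) * (h * (‖u‖ ^ 2 + ‖Grid.d2 h u‖ ^ 2 + ‖Grid.d3 h u‖ ^ 2))
        + θ * (h * (‖v‖ ^ 2 + ‖Grid.d2 h v‖ ^ 2 + ‖Grid.d3 h v‖ ^ 2)) := by ring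
    _ ≤ (1 - θ) * c ^ 2 + θ * c ^ 2 := by
        have : 0 ≤ 1 - θ := by linarith
        gcongr
    _ = c ^ 2 := by ring

lemma path_param {dt : ℝ} (hdt : 0 < dt) {t : ℝ} (ht : 0 ≤ t) :
    0 ≤ (t - ⌊t / dt⌋₊ * dt) / dt ∧ (t - ⌊t / dt⌋₊ * dt) / dt ≤ 1 := by
  have h1 := floor_mul_le hdt ht
  have h2 := lt_floor_add_one_mul hdt t
  exact ⟨div_nonneg (by linarith) hdt.le, (div_le_one hdt).2 (by linarith)⟩

/-- The interpolation in time is Lipschitz continuous. -/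
lemma Grid.norm_path_sub_le {dt : ℝ} (hdt : 0 < dt) {u : ℕ → Grid} {T L : ℝ}
    (hu : ∀ n : ℕ, n * dt ≤ T → ‖u (n + 1) - u n‖ ≤ L * dt) {s t : ℝ} (hs : s ∈ Icc 0 T)
    (ht : t ∈ Icc 0 T) : ‖Grid.path dt u s - Grid.path dt u t‖ ≤ L * |s - t| := by
  wlog hst : s ≤ t generalizing s t
  · rw [norm_sub_rev, abs_sub_comm]; exact this ht hs (le_of_not_ge hst)
  have hm1 := floor_mul_le hdt hs.1
  have hm2 := lt_floor_add_one_mul hdt s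
  have hn1 := floor_mul_le hdt ht.1
  have hn2 := lt_floor_add_one_mul hdt t
  have hmn : ⌊s / dt⌋₊ ≤ ⌊t / dt⌋₊ := Nat.floor_mono (by gcongr)
  unfold Grid.path
  set m := ⌊s / dt⌋₊
  set n := ⌊t / dt⌋₊
  have hnT : n * dt ≤ T := hn1.trans ht.2
  have bm := hu m (hm1.trans hs.2)
  have bn := hu n hnT
  have hL : 0 ≤ L := by
    by_contra hL
    have := (norm_nonneg _).trans bm
    nlinarith
  rw [abs_sub_comm, abs_of_nonneg (sub_nonneg.2 hst)]
  rcases hmn.eq_or_lt with hmn | hmn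
  · rw [← hmn] at bn ⊢
    rw [add_sub_add_left_eq_sub, ← sub_smul, norm_smul, ← sub_div]
    rw [sub_sub_sub_cancel_right, Real.norm_eq_abs, abs_div, abs_sub_comm,
      abs_of_nonneg (sub_nonneg.2 hst), abs_of_pos hdt]
    calc _ ≤ (t - s) / dt * (L * dt) := by
          gcongr
      _ = _ := by field_simp
  · have c2 : dist (u (m + 1)) (u n) ≤ ∑ i ∈ Finset.Ico (m + 1) n, L * dt :=
      dist_le_Ico_sum_of_dist_le hmn fun {k} _ hk => by
        rw [dist_comm, dist_eq_norm]
        refine hu k (le_trans ?_ hnT)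
        gcongr
    rw [Finset.sum_const, Nat.card_Ico, nsmul_eq_mul, Nat.cast_sub hmn, dist_eq_norm] at c2
    push_cast at c2
    -- The increment is split into the partial steps at both ends and the full steps from node m + 1
    -- to node n.
    have e : u m + ((s - m * dt) / dt) • (u (m + 1) - u m)
        - (u n + ((t - n * dt) / dt) • (u (n + 1) - u n))
        = (u (m + 1) - u n) - (((m + 1) * dt - s) / dt) • (u (m + 1) - u m)
          - ((t - n * dt) / dt) • (u (n + 1) - u n) := by
      have e1 : ((m + 1) * dt - s) / dt = 1 - (s - m * dt) / dt := by field_simp; ring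
      rw [e1]; module
    rw [e]
    have c1 : ‖(((m + 1) * dt - s) / dt) • (u (m + 1) - u m)‖ ≤ L * ((m + 1) * dt - s) := by
      rw [norm_smul, Real.norm_of_nonneg (div_nonneg (by linarith) hdt.le)]
      calc _ ≤ ((m + 1) * dt - s) / dt * (L * dt) := by
            gcongr
        _ = _ := by field_simp
    have c3 : ‖((t - n * dt) / dt) • (u (n + 1) - u n)‖ ≤ L * (t - n * dt) := by
      rw [norm_smul, Real.norm_of_nonneg (div_nonneg (by linarith) hdt.le)]
      calc _ ≤ (t - n * dt) / dt * (L * dt) := by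
            gcongr
        _ = _ := by field_simp
    have d1 := norm_sub_le ((u (m + 1) - u n) - (((m + 1) * dt - s) / dt) • (u (m + 1) - u m))
      (((t - n * dt) / dt) • (u (n + 1) - u n))
    have d2 := norm_sub_le (u (m + 1) - u n) ((((m + 1) * dt - s) / dt) • (u (m + 1) - u m))
    linarith

/-! ### The scheme yields approximate solutions -/

/-- Bound for the approximations and their time derivatives. -/
def bnd (ρ : ℝ) : ℝ := 2 * (4 * ρ) ^ 2 + 4 * ρ

/-- Constant in the consistency error. -/
def errConst (ρ : ℝ) : ℝ :=
  46 * (4 * ρ) ^ 2 + 6 * (4 * ρ) + (2 * bnd ρ + 1) * bnd ρ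

lemma Grid.Step.sub_eq {dt : ℝ} {u u' : Grid} (hs : Grid.Step h dt u u') :
    u' - u = -(dt • (Grid.Bl h ((2⁻¹ : ℝ) • (u + u')) ((2⁻¹ : ℝ) • (u + u'))
    + Grid.d3 h ((2⁻¹ : ℝ) • (u + u')))) := by
  nth_rw 1 [hs]; abel

section

variable {dt ρ : ℝ} {u : ℕ → Grid}

lemma Grid.norm_rhs_le (hh : 0 < h) {w : Grid} (hw : Grid.N h w ≤ 4 * ρ) :
    √h * ‖Grid.Bl h w w + Grid.d3 h w‖ ≤ bnd ρ := by
  have h0 := Grid.N_nonneg (h := h) w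
  have h1 := Grid.norm_Bl_le hh w
  have h2 := Grid.norm_d3_le_N hh w
  have h3 := mul_le_mul_of_nonneg_left (norm_add_le (Grid.Bl h w w) (Grid.d3 h w))
    (Real.sqrt_nonneg h)
  unfold bnd
  nlinarith

lemma Grid.norm_steps_sub_le (hh : 0 < h) (hdt : 0 < dt) (hρ : 0 < ρ) (hdt' : dt ≤ lifespan ρ)
    (h0 : Grid.N h (u 0) ≤ ρ) (hs : Grid.Steps h dt (lifespan ρ) u) (n : ℕ)
    (hn : n * dt ≤ lifespan ρ) : √h * ‖u (n + 1) - u n‖ ≤ bnd ρ * dt := by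
  obtain ⟨-, -, h1, -⟩ := Grid.steps_bounds hh hdt hρ hdt' h0 hs n hn
  rw [(hs n hn).sub_eq, norm_neg, norm_smul, Real.norm_of_nonneg hdt.le]
  have := Grid.norm_rhs_le hh h1
  nlinarith

lemma Grid.N_path_le (hh : 0 < h) (hdt : 0 < dt) (hρ : 0 < ρ) (hdt' : dt ≤ lifespan ρ)
    (h0 : Grid.N h (u 0) ≤ ρ) (hs : Grid.Steps h dt (lifespan ρ) u) {t : ℝ}
    (ht : t ∈ Icc 0 (lifespan ρ)) : Grid.N h (Grid.path dt u t) ≤ 2 * ρ := by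
  obtain ⟨h1, h2, -⟩ := Grid.steps_bounds hh hdt hρ hdt' h0 hs _
    ((floor_mul_le hdt ht.1).trans ht.2)
  obtain ⟨h3, h4⟩ := path_param hdt ht.1
  exact Grid.N_add_smul_sub_le hh (by positivity) h3 h4 h1 h2

lemma hasDerivAt_smooth_path (hh : 0 < h) (hdt : 0 < dt) {t : ℝ} (ht : 0 ≤ t)
    (hne : ∀ n : ℕ, t ≠ n * dt) :
    HasDerivAt (fun s => L2 (smooth h (Grid.path dt u s)))
      (dt⁻¹ • smoothL h hh (u (⌊t / dt⌋₊ + 1) - u ⌊t / dt⌋₊)) t := by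
  set n := ⌊t / dt⌋₊ with hn
  have h1 : n * dt < t := lt_of_le_of_ne (floor_mul_le hdt ht) (hne n).symm
  have h2 := lt_floor_add_one_mul hdt t
  have ev : (fun s => L2 (smooth h (Grid.path dt u s))) =ᶠ[𝓝 t]
      fun s => smoothL h hh (u n) + ((s - n * dt) / dt) • smoothL h hh (u (n + 1) - u n) := by
    filter_upwards [Ioo_mem_nhds h1 h2] with s hs
    have : ⌊s / dt⌋₊ = n := by
      rw [Nat.floor_eq_iff (div_nonneg ((by positivity : (0 : ℝ) ≤ n * dt).trans hs.1.le) hdt.le),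
        le_div_iff₀ hdt, div_lt_iff₀ hdt]
      exact ⟨hs.1.le, hs.2⟩
    rw [Grid.path, this, ← map_smul, ← map_add]; rfl
  refine HasDerivAt.congr_of_eventuallyEq ?_ ev
  have h3 : HasDerivAt (fun s : ℝ => (s - n * dt) / dt) (dt⁻¹) t := by
    simpa using ((hasDerivAt_id t).sub_const (n * dt)).div_const dt
  exact (h3.smul_const _).const_add _

/-- The scheme yields an approximate solution. -/
theorem approxSol_smooth_path (hh : 0 < h) (hdt : 0 < dt) (hρ : 0 < ρ) (hdt' : dt ≤ lifespan ρ)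
    (h0 : Grid.N h (u 0) ≤ ρ) (hs : Grid.Steps h dt (lifespan ρ) u) :
    ApproxSol (lifespan ρ) (bnd ρ) (errConst ρ * (h + dt))
      (fun t => smooth h (Grid.path dt u t)) (fun t => smooth₁ h (Grid.path dt u t))
      (fun t => smooth₂ h (Grid.path dt u t))
      (fun t => step h (Grid.d3 h (Grid.path dt u t))) where
  pack t ht := (pack_smooth hh _).mono ((Grid.N_path_le hh hdt hρ hdt' h0 hs ht).trans
    (by unfold bnd; nlinarith))
  lip s hs' t ht := by
    have e : L2 (smooth h (Grid.path dt u s)) - L2 (smooth h (Grid.path dt u t))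
        = L2 (smooth h (Grid.path dt u s - Grid.path dt u t : Grid)) :=
      ((smoothL h hh).map_sub _ _).symm
    have hr : 0 < √h := Real.sqrt_pos.2 hh
    have := Grid.norm_path_sub_le hdt (L := bnd ρ / √h) (fun n hn => by
      rw [div_mul_eq_mul_div, le_div_iff₀ hr, mul_comm]
      exact Grid.norm_steps_sub_le hh hdt hρ hdt' h0 hs n hn) hs' ht
    rw [e]
    refine (norm_smooth_le hh _).trans ?_
    rw [div_mul_eq_mul_div, le_div_iff₀ hr] at this
    linarith
  eqn := by
    -- The nodes, where the path has corners, form a null set.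
    have hcount : (range fun n : ℕ => (n : ℝ) * dt).Countable := countable_range _
    filter_upwards [hcount.ae_notMem volume] with t ht hmem
    have htI : t ∈ Icc 0 (lifespan ρ) := Ioo_subset_Icc_self hmem
    refine ⟨_, hasDerivAt_smooth_path hh hdt hmem.1.le fun n hn => ht ⟨n, hn.symm⟩,
      fun M' p p₁ p₂ p₃ hp => ?_⟩
    have hnT := (floor_mul_le hdt htI.1).trans htI.2
    obtain ⟨θ0, θ1⟩ := path_param hdt htI.1
    have hN := Grid.N_path_le hh hdt hρ hdt' h0 hs htI
    unfold Grid.path at hN ⊢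
    set n := ⌊t / dt⌋₊
    set θ := (t - n * dt) / dt
    obtain ⟨-, -, h1, -⟩ := Grid.steps_bounds hh hdt hρ hdt' h0 hs n hnT
    have hd := Grid.norm_steps_sub_le hh hdt hρ hdt' h0 hs n hnT
    have ez : dt⁻¹ • smoothL h hh (u (n + 1) - u n) = -L2 (smooth h
        (Grid.Bl h ((2⁻¹ : ℝ) • (u n + u (n + 1))) ((2⁻¹ : ℝ) • (u n + u (n + 1)))
          + Grid.d3 h ((2⁻¹ : ℝ) • (u n + u (n + 1))) : Grid)) := by
      rw [(hs n hnT).sub_eq, map_neg, map_smul, smul_neg, smul_smul, inv_mul_cancel₀ hdt.ne',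
        one_smul]; rfl
    rw [ez, inner_neg_left]
    have c1 := abs_inner_smooth_add_flux_le hh ((2⁻¹ : ℝ) • (u n + u (n + 1))) hp
    set w := (2⁻¹ : ℝ) • (u n + u (n + 1)) with hw
    have pw := (pack_smooth hh w).mono (h1.trans (by unfold bnd; nlinarith : 4 * ρ ≤ bnd ρ))
    have pv := (pack_smooth hh (u n + θ • (u (n + 1) - u n))).mono
      (hN.trans (by unfold bnd; nlinarith : 2 * ρ ≤ bnd ρ))
    have c2 := pw.abs_flux_sub_le pv hp
    have hM' := hp.nonneg
    have hb : 0 ≤ bnd ρ := pw.nonneg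
    -- The time derivative is determined by the midpoint w, whereas the flux is taken at the current
    -- point of the path. The two points differ by at most one increment, whose norm is of order Δt,
    -- and the flux is Lipschitz in L².
    have c3 : ‖L2 (smooth h w) - L2 (smooth h (u n + θ • (u (n + 1) - u n) : Grid))‖
        ≤ bnd ρ * dt := by
      have e : L2 (smooth h w) - L2 (smooth h (u n + θ • (u (n + 1) - u n) : Grid))
          = L2 (smooth h ((2⁻¹ - θ) • (u (n + 1) - u n) : Grid)) := by
        refine ((smoothL h hh).map_sub _ _).symm.trans ?_
        have : w - (u n + θ • (u (n + 1) - u n)) = (2⁻¹ - θ) • (u (n + 1) - u n) := by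
          rw [hw]; module
        rw [this]; rfl
      rw [e]
      refine (norm_smooth_le hh _).trans ?_
      rw [norm_smul]
      have : ‖2⁻¹ - θ‖ ≤ 1 := by
        rw [Real.norm_eq_abs, abs_le]; constructor <;> norm_num <;> linarith
      calc _ = ‖2⁻¹ - θ‖ * (√h * ‖u (n + 1) - u n‖) := by ring
        _ ≤ 1 * (bnd ρ * dt) := by gcongr
        _ = _ := one_mul _
    have c4 := c2.trans (by gcongr : _ ≤ (2 * bnd ρ + 1) * (bnd ρ * dt) * M')
    have hNw := Grid.N_nonneg (h := h) w
    have c5 := c1.trans (by gcongr :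
      _ ≤ (46 * (4 * ρ) ^ 2 + 6 * (4 * ρ)) * h * M')
    rw [abs_le] at c4 c5 ⊢
    have x1 : 0 ≤ (46 * (4 * ρ) ^ 2 + 6 * (4 * ρ)) * dt * M' := by positivity
    have x2 : 0 ≤ (2 * bnd ρ + 1) * bnd ρ * h * M' := by positivity
    unfold errConst
    constructor <;> nlinarith

end

end KdV
end

noncomputable section

namespace KdV

open scoped InnerProductSpace

/-! ### Weak limits in `H³` -/

/-- Weak sequential compactness of balls, along ultrafilters. -/
lemma exists_weak_limit {ι : Type*} (l : Ultrafilter ι) {F : ι → H} {M : ℝ}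
    (hF : ∀ i, ‖F i‖ ≤ M) : ∃ G : H, ‖G‖ ≤ M ∧
      ∀ p : H, Tendsto (fun i => ⟪F i, p⟫_ℝ) l (𝓝 ⟪G, p⟫_ℝ) := by
  let D : ι → WeakDual ℝ H := fun i =>
    StrongDual.toWeakDual ((InnerProductSpace.toDual ℝ H) (F i))
  have hc := WeakDual.isCompact_closedBall (𝕜 := ℝ) (E := H) (0 : StrongDual ℝ H) M
  obtain ⟨ψ, hψ, hl⟩ := hc.ultrafilter_le_nhds (l.map D) (by
    rw [le_principal_iff]
    refine mem_map.2 (univ_mem' fun i => ?_)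
    simp only [mem_preimage, Metric.mem_closedBall, dist_zero_right]
    change ‖(InnerProductSpace.toDual ℝ H) (F i)‖ ≤ M
    rw [LinearIsometryEquiv.norm_map]; exact hF i)
  refine ⟨(InnerProductSpace.toDual ℝ H).symm (WeakDual.toStrongDual ψ), ?_, fun p => ?_⟩
  · rw [LinearIsometryEquiv.norm_map]
    simpa [dist_zero_right] using hψ
  · rw [InnerProductSpace.toDual_symm_apply]
    have h1 : Tendsto D l (𝓝 ψ) := hl
    have h2 := ((WeakDual.eval_continuous p).tendsto ψ).comp h1
    exact h2

lemma HasWeakDeriv.iff_inner {k : ℕ} {f g : ℝ → ℝ} (hf : MemLp f 2 volume)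
    (hg : MemLp g 2 volume) : HasWeakDeriv k f g ↔
      ∀ φ : ℝ → ℝ, ContDiff ℝ (⊤ : ℕ∞) φ → HasCompactSupport φ →
        ⟪L2 f, L2 (iteratedDeriv k φ)⟫_ℝ = (-1) ^ k * ⟪L2 g, L2 φ⟫_ℝ := by
  have key : ∀ φ : ℝ → ℝ, ContDiff ℝ (⊤ : ℕ∞) φ → HasCompactSupport φ →
      MemLp (iteratedDeriv k φ) 2 volume := by
    induction k with
    | zero => intro φ h1 h2; rw [iteratedDeriv_zero]; exact memLp_test h1 h2
    | succ k ih =>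
      intro φ h1 h2
      rw [iteratedDeriv_succ']
      exact ih _ (contDiff_deriv h1) h2.deriv
  constructor
  · intro h φ h1 h2
    rw [inner_L2 hf (key φ h1 h2), inner_L2 hg (memLp_test h1 h2)]; exact h φ h1 h2
  · intro h φ h1 h2
    rw [← inner_L2 hf (key φ h1 h2), ← inner_L2 hg (memLp_test h1 h2)]; exact h φ h1 h2

lemma HasWeakDeriv.congr {k : ℕ} {f f' g : ℝ → ℝ} (h : HasWeakDeriv k f g)
    (hf : f =ᵐ[volume] f') : HasWeakDeriv k f' g := fun φ h1 h2 => by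
  rw [← h φ h1 h2]
  exact integral_congr_ae (hf.mono fun x hx => by simp only [hx])

/-- Limits in `L²` of functions bounded in `H³` are bounded in `H³`. -/
lemma Pack.exists_limit {M : ℝ} {f f₁ f₂ f₃ : ℕ → ℝ → ℝ}
    (h : ∀ k, Pack M (f k) (f₁ k) (f₂ k) (f₃ k)) {F : H}
    (hF : Tendsto (fun k => L2 (f k)) atTop (𝓝 F)) :
    ∃ g g₁ g₂ g₃, Pack M g g₁ g₂ g₃ ∧ L2 g = F := by
  have hM := (h 0).nonneg
  -- An ultrafilter finer than `atTop` replaces the extraction of weakly convergent subsequences.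
  -- The strong limit F then identifies each weak limit as a weak derivative of F.
  have hl : ((Filter.hyperfilter ℕ : Ultrafilter ℕ) : Filter ℕ) ≤ atTop :=
    Nat.hyperfilter_le_atTop
  have lim : ∀ (k : ℕ) (e : ℕ → ℝ → ℝ), (∀ i, MemLp (e i) 2 volume) → (∀ i, ‖L2 (e i)‖ ≤ M) →
      (∀ i, HasWeakDeriv k (f i) (e i)) →
      ∃ G : ℝ → ℝ, MemLp G 2 volume ∧ HasWeakDeriv k F G ∧
        eLpNorm G 2 volume ≤ ENNReal.ofReal M := by
    intro k e hm hn hw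
    obtain ⟨G, hG, hlim⟩ := exists_weak_limit (Filter.hyperfilter ℕ) hn
    refine ⟨G, Lp.memLp G, ?_, ?_⟩
    · rw [HasWeakDeriv.iff_inner (Lp.memLp F) (Lp.memLp G), L2_coe, L2_coe]
      intro φ h1 h2
      have t1 := (hF.mono_left hl).inner (𝕜 := ℝ)
        (tendsto_const_nhds (x := L2 (iteratedDeriv k φ)))
      have t2 := (hlim (L2 φ)).const_mul ((-1) ^ k)
      refine tendsto_nhds_unique t1 (t2.congr fun i => ?_)
      exact ((HasWeakDeriv.iff_inner (h i).w₁.left (hm i)).1 (hw i) φ h1 h2).symm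
    · rw [eLpNorm_eq_norm_L2 (Lp.memLp G), L2_coe]
      exact ENNReal.ofReal_le_ofReal hG
  obtain ⟨G1, m1, w1, n1⟩ := lim 1 f₁ (fun i => (h i).w₂.left) (fun i => (h i).n₁)
    (fun i => (h i).hasWeakDeriv.1)
  obtain ⟨g, hg, W1⟩ := w1.exists_W (Lp.memLp F) m1
  have hgm : MemLp g 2 volume := W1.left
  have hb : H3Bound M g := by
    refine ⟨hgm, fun k hk => ?_⟩
    have : ∃ G : ℝ → ℝ, MemLp G 2 volume ∧ HasWeakDeriv k F G ∧
        eLpNorm G 2 volume ≤ ENNReal.ofReal M := by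
      interval_cases k
      · exact lim 0 f (fun i => (h i).w₁.left) (fun i => (h i).n₀) fun i => HasWeakDeriv.zero _
      · exact ⟨G1, m1, w1, n1⟩
      · exact lim 2 f₂ (fun i => (h i).w₃.left) (fun i => (h i).n₂)
          (fun i => (h i).hasWeakDeriv.2.1)
      · exact lim 3 f₃ (fun i => (h i).w₃.right) (fun i => (h i).n₃)
          (fun i => (h i).hasWeakDeriv.2.2)
    obtain ⟨G, a, b, c⟩ := this
    exact ⟨G, a, b.congr hg, c⟩
  obtain ⟨g₁, g₂, g₃, hp⟩ := hb.exists_pack hM W1.continuous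
  exact ⟨g, g₁, g₂, g₃, hp, by rw [← L2_congr hg, L2_coe]⟩

/-! ### Measurability of weakly continuous functions -/

/-- A closed ball is an intersection of half spaces, so its preimage under a weakly continuous map
is closed. By separability every open set is a countable union of closed balls. -/
lemma measurable_of_weaklyContinuous [MeasurableSpace H] [BorelSpace H] {g : ℝ → H}
    (hg : ∀ p : H, Continuous fun t => ⟪g t, p⟫_ℝ) : Measurable g := by
  have : Fact ((2 : ENNReal) ≠ ⊤) := ⟨by norm_num⟩
  have hball : ∀ (c : H) (r : ℝ), 0 ≤ r → IsClosed {t | ‖g t - c‖ ≤ r} := by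
    intro c r hr
    have e : {t | ‖g t - c‖ ≤ r} = ⋂ p : H, {t | ⟪g t, p⟫_ℝ - ⟪c, p⟫_ℝ ≤ r * ‖p‖} := by
      ext t
      simp only [mem_ofPred_eq, mem_iInter, ← inner_sub_left]
      constructor
      · intro h p
        exact (real_inner_le_norm _ _).trans (by gcongr)
      · intro h
        have := h (g t - c)
        rw [real_inner_self_eq_norm_sq] at this
        by_contra hlt
        rw [not_le] at hlt
        nlinarith [hr.trans_lt hlt]
    rw [e]
    exact isClosed_iInter fun p => isClosed_le ((hg p).sub continuous_const) continuous_const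
  refine measurable_of_isOpen fun O hO => ?_
  have hcov : ∀ x : O, ∃ r > 0, Metric.closedBall (x : H) r ⊆ O := fun x =>
    (Metric.nhds_basis_closedBall.mem_iff).1 (hO.mem_nhds x.2)
  choose r hr hsub using hcov
  obtain ⟨T, hT, hU⟩ := TopologicalSpace.isOpen_iUnion_countable
    (fun x : O => Metric.ball (x : H) (r x)) fun x => Metric.isOpen_ball
  have e : O = ⋃ x ∈ T, Metric.closedBall (x : H) (r x) := by
    refine Subset.antisymm (fun y hy => ?_) (iUnion₂_subset fun x _ => hsub x)
    have : y ∈ ⋃ x : O, Metric.ball (x : H) (r x) :=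
      mem_iUnion.2 ⟨⟨y, hy⟩, Metric.mem_ball_self (hr _)⟩
    rw [← hU] at this
    obtain ⟨x, hx, hxy⟩ := mem_iUnion₂.1 this
    exact mem_iUnion₂.2 ⟨x, hx, Metric.ball_subset_closedBall hxy⟩
  rw [e, preimage_iUnion₂]
  refine MeasurableSet.biUnion hT fun x _ => ?_
  have : g ⁻¹' Metric.closedBall (x : H) (r x) = {t | ‖g t - x‖ ≤ r x} := by
    ext t; simp [dist_eq_norm]
  rw [this]
  exact (hball _ _ (hr x).le).measurableSet

lemma aestronglyMeasurable_of_weaklyContinuous {g : ℝ → H}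
    (hg : ∀ p : H, Continuous fun t => ⟪g t, p⟫_ℝ) : AEStronglyMeasurable g volume := by
  have : Fact ((2 : ENNReal) ≠ ⊤) := ⟨by norm_num⟩
  borelize H
  exact (measurable_of_weaklyContinuous hg).aestronglyMeasurable

/-! ### Solutions -/

lemma exists_pack_test {φ : ℝ → ℝ} (h1 : ContDiff ℝ (⊤ : ℕ∞) φ) (h2 : HasCompactSupport φ) :
    ∃ M φ₁ φ₂ φ₃, Pack M φ φ₁ φ₂ φ₃ := by
  have w1 := W_test h1 h2
  have w2 := W_test (contDiff_deriv h1) h2.deriv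
  have w3 := W_test (contDiff_deriv (contDiff_deriv h1)) h2.deriv.deriv
  refine ⟨‖L2 φ‖ + ‖L2 (deriv φ)‖ + ‖L2 (deriv (deriv φ))‖ + ‖L2 (deriv (deriv (deriv φ)))‖,
    _, _, _, ⟨w1, w2, w3, ?_, ?_, ?_, ?_⟩⟩ <;>
  linarith [norm_nonneg (L2 φ), norm_nonneg (L2 (deriv φ)), norm_nonneg (L2 (deriv (deriv φ))),
    norm_nonneg (L2 (deriv (deriv (deriv φ))))]

/-- The right-hand side of the equation. -/
def rhs (f f₁ f₃ : ℝ → ℝ) : H := -L2 fun x => f x * f₁ x + f₃ x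

lemma Pack.inner_rhs {M M' : ℝ} {f f₁ f₂ f₃ p p₁ p₂ p₃ : ℝ → ℝ} (h : Pack M f f₁ f₂ f₃)
    (hp : Pack M' p p₁ p₂ p₃) : ⟪rhs f f₁ f₃, L2 p⟫_ℝ = flux f p₁ p₃ := by
  rw [rhs, inner_neg_left, h.inner_eq_flux hp, neg_neg]

lemma Pack.norm_rhs_le {M : ℝ} {f f₁ f₂ f₃ : ℝ → ℝ} (h : Pack M f f₁ f₂ f₃) :
    ‖rhs f f₁ f₃‖ ≤ 2 * M * M + M := by
  have hM := h.nonneg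
  rw [rhs, norm_neg, L2_add h.memLp_mul h.w₃.right]
  refine (norm_add_le _ _).trans (add_le_add ?_ h.n₃)
  exact (norm_L2_bdd_mul_le h.w₁.continuous.aestronglyMeasurable h.w₁.right h.abs_le).trans
    (by gcongr; exact h.n₁)

lemma Pack.eq_of_L2_eq {M M' : ℝ} {f f₁ f₂ f₃ g g₁ g₂ g₃ : ℝ → ℝ} (hf : Pack M f f₁ f₂ f₃)
    (hg : Pack M' g g₁ g₂ g₃) (h : L2 f = L2 g) : f = g :=
  (hf.w₁.continuous.ae_eq_iff_eq volume hg.w₁.continuous).1 (L2_inj hf.w₁.left hg.w₁.left h)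

/-- A strong solution of the equation, given together with its derivatives. -/
structure Sol (T M : ℝ) (U U₁ U₂ U₃ : ℝ → ℝ → ℝ) : Prop where
  pack : ∀ t ∈ Icc 0 T, Pack M (U t) (U₁ t) (U₂ t) (U₃ t)
  lip : ∀ s ∈ Icc 0 T, ∀ t ∈ Icc 0 T, ‖L2 (U s) - L2 (U t)‖ ≤ M * |s - t|
  eqn : ∀ᵐ t, t ∈ Ioo 0 T → HasDerivAt (fun s => L2 (U s)) (rhs (U t) (U₁ t) (U₃ t)) t

lemma Sol.approxSol {T M : ℝ} {U U₁ U₂ U₃ : ℝ → ℝ → ℝ} (h : Sol T M U U₁ U₂ U₃) :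
    ApproxSol T M 0 U U₁ U₂ U₃ where
  pack := h.pack
  lip := h.lip
  eqn := by
    filter_upwards [h.eqn] with t ht hmem
    refine ⟨_, ht hmem, fun M' p p₁ p₂ p₃ hp => ?_⟩
    rw [(h.pack t (Ioo_subset_Icc_self hmem)).inner_rhs hp, sub_self, abs_zero, zero_mul]

lemma Sol.mono {T M M' : ℝ} {U U₁ U₂ U₃ : ℝ → ℝ → ℝ} (h : Sol T M U U₁ U₂ U₃) (hM : M ≤ M') :
    Sol T M' U U₁ U₂ U₃ where
  pack t ht := (h.pack t ht).mono hM
  lip s hs t ht := (h.lip s hs t ht).trans (by gcongr)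
  eqn := h.eqn

/-- Uniqueness of solutions. -/
lemma Sol.unique {T M M' : ℝ} {U U₁ U₂ U₃ V V₁ V₂ V₃ : ℝ → ℝ → ℝ} (hU : Sol T M U U₁ U₂ U₃)
    (hV : Sol T M' V V₁ V₂ V₃) (h0 : U 0 = V 0) {t : ℝ} (ht : t ∈ Icc 0 T) : U t = V t := by
  have a := hU.mono (le_max_left M M')
  have b := hV.mono (le_max_right M M')
  have := a.approxSol.stability le_rfl le_rfl b.approxSol ht
  rw [h0, sub_self, norm_zero] at this
  simp only [ne_eq, OfNat.ofNat_ne_zero, not_false_eq_true, zero_pow, add_zero, mul_zero,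
    zero_mul] at this
  have h1 : L2 (U t) - L2 (V t) = 0 := by
    rw [← norm_eq_zero]; exact pow_eq_zero_iff (two_ne_zero) |>.1 (le_antisymm this (sq_nonneg _))
  exact (a.pack t ht).eq_of_L2_eq (b.pack t ht) (sub_eq_zero.1 h1)

/-- Pointwise differences are controlled by differences in `L²`. -/
lemma Pack.sq_sub_le {M M' : ℝ} {f f₁ f₂ f₃ g g₁ g₂ g₃ : ℝ → ℝ} (hf : Pack M f f₁ f₂ f₃)
    (hg : Pack M' g g₁ g₂ g₃) (x : ℝ) :
    (f x - g x) ^ 2 ≤ 2 * (M + M') * ‖L2 f - L2 g‖ := by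
  have hp := hf.sub hg
  have h1 := hp.w₁.sq_le x
  have h2 := hp.n₁
  rw [L2_sub hf.w₁.left hg.w₁.left] at h1
  refine h1.trans ?_
  calc _ ≤ 2 * ‖L2 f - L2 g‖ * (M + M') := by gcongr
    _ = _ := by ring

lemma Pack.abs_sub_le {M : ℝ} {f f₁ f₂ f₃ : ℝ → ℝ} (h : Pack M f f₁ f₂ f₃) (x y : ℝ) :
    |f x - f y| ≤ 2 * M * |x - y| := by
  rw [h.w₁.ftc]
  exact intervalIntegral.norm_integral_le_of_norm_le_const (f := f₁) fun z _ => h.abs_le₁ z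

lemma Sol.continuousOn {T M : ℝ} {U U₁ U₂ U₃ : ℝ → ℝ → ℝ} (h : Sol T M U U₁ U₂ U₃) :
    ContinuousOn (Function.uncurry fun x t => U t x) (univ ×ˢ Icc 0 T) := by
  rintro ⟨x, t⟩ ⟨-, ht⟩
  have ht : t ∈ Icc 0 T := ht
  have hM := (h.pack t ht).nonneg
  have key : ∀ᶠ q : ℝ × ℝ in 𝓝[univ ×ˢ Icc 0 T] (x, t), |U q.2 q.1 - U t x|
      ≤ √(4 * M ^ 2 * |q.2 - t|) + 2 * M * |q.1 - x| := by
    filter_upwards [self_mem_nhdsWithin] with q hq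
    have hq2 : q.2 ∈ Icc 0 T := hq.2
    have b1 := (h.pack q.2 hq2).sq_sub_le (h.pack t ht) q.1
    have b2 := (h.pack t ht).abs_sub_le q.1 x
    have b3 := h.lip q.2 hq2 t ht
    have b4 : |U q.2 q.1 - U t q.1| ≤ √(4 * M ^ 2 * |q.2 - t|) := by
      refine Real.le_sqrt_of_sq_le ?_
      rw [sq_abs]
      refine b1.trans ?_
      calc _ ≤ 2 * (M + M) * (M * |q.2 - t|) := by gcongr
        _ = _ := by ring
    exact (_root_.abs_sub_le _ (U t q.1) _).trans (add_le_add b4 b2)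
  have lim : Tendsto (fun q : ℝ × ℝ => √(4 * M ^ 2 * |q.2 - t|) + 2 * M * |q.1 - x|)
      (𝓝[univ ×ˢ Icc 0 T] (x, t)) (𝓝 0) := by
    have hc : Continuous fun q : ℝ × ℝ => √(4 * M ^ 2 * |q.2 - t|) + 2 * M * |q.1 - x| := by
      fun_prop
    have := hc.tendsto (x, t)
    simp only [sub_self, abs_zero, mul_zero, Real.sqrt_zero, add_zero] at this
    exact this.mono_left nhdsWithin_le_nhds
  have := squeeze_zero' (Eventually.of_forall fun _ => abs_nonneg _) key lim
  rw [ContinuousWithinAt, tendsto_iff_dist_tendsto_zero]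
  exact this

lemma Sol.isSolution {T M : ℝ} {U U₁ U₂ U₃ : ℝ → ℝ → ℝ} (h : Sol T M U U₁ U₂ U₃) :
    IsSolution T (U 0) fun x t => U t x where
  continuousOn := h.continuousOn
  initial _ := rfl
  bounded := ⟨M, fun t ht => (h.pack t ht).h3Bound⟩
  lipschitz := ⟨M, fun s hs t ht => by
    have m := (h.pack s hs).w₁.left.sub (h.pack t ht).w₁.left
    have e := eLpNorm_eq_norm_L2 m
    have e2 : L2 (U s - U t) = L2 (U s) - L2 (U t) :=
      L2_sub (h.pack s hs).w₁.left (h.pack t ht).w₁.left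
    rw [e2] at e
    exact e.trans_le (ENNReal.ofReal_le_ofReal (h.lip s hs t ht))⟩
  equation := by
    rw [ae_restrict_iff' measurableSet_Ioo]
    filter_upwards [h.eqn] with t ht hmem
    have htI := Ioo_subset_Icc_self hmem
    have hp := h.pack t htI
    refine ⟨U₁ t, U₃ t, hp.w₂.left, hp.hasWeakDeriv.1, hp.w₃.right, hp.hasWeakDeriv.2.2, ?_⟩
    have hd := (hasDerivAt_iff_tendsto_slope.1 (ht hmem))
    rw [tendsto_iff_norm_sub_tendsto_zero] at hd
    have h2 := ENNReal.tendsto_ofReal hd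
    rw [ENNReal.ofReal_zero] at h2
    refine h2.congr' ?_
    filter_upwards [mem_nhdsWithin_of_mem_nhds (Ioo_mem_nhds hmem.1 hmem.2)] with s hs
    have hps := h.pack s (Ioo_subset_Icc_self hs)
    have m1 := hps.w₁.left.sub hp.w₁.left
    have m2 := hp.memLp_mul.add hp.w₃.right
    have m3 := (m1.const_mul ((s - t)⁻¹)).add m2
    have e : (fun x => (U s x - U t x) / (s - t) - (-(U t x * U₁ t x + U₃ t x)))
        = fun x => (s - t)⁻¹ * (U s x - U t x) + (U t x * U₁ t x + U₃ t x) := by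
      ext x; ring
    have m4 : MemLp (fun x => (s - t)⁻¹ * (U s x - U t x) + (U t x * U₁ t x + U₃ t x)) 2 volume := m3
    rw [e, eLpNorm_eq_norm_L2 m4]
    congr 2
    have e3 : L2 (fun x => (s - t)⁻¹ * (U s x - U t x) + (U t x * U₁ t x + U₃ t x))
        = L2 (fun x => (s - t)⁻¹ * (U s x - U t x)) + L2 (fun x => U t x * U₁ t x + U₃ t x) :=
      L2_add (m1.const_mul _) m2
    have e4 : L2 (fun x => (s - t)⁻¹ * (U s x - U t x))
        = (s - t)⁻¹ • L2 (fun x => U s x - U t x) := L2_const_mul m1 _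
    rw [e3, e4, L2_sub hps.w₁.left hp.w₁.left, slope_def_module, rhs, sub_neg_eq_add]

/-- At each time the weak derivatives are represented by a `Pack` for the continuous function V(·,
t), and the derivatives in the equation agree with these almost everywhere. This brings an arbitrary
solution into the form to which stability applies. -/
lemma IsSolution.exists_sol {T : ℝ} {u₀ : ℝ → ℝ} {V : ℝ → ℝ → ℝ} (h : IsSolution T u₀ V) :
    ∃ M V₁ V₂ V₃, Sol T M (fun t x => V x t) V₁ V₂ V₃ := by
  obtain ⟨M, hM⟩ := h.bounded
  obtain ⟨L, hL⟩ := h.lipschitz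
  set K := max (max M L) 0 with hK
  have hK0 : 0 ≤ K := le_max_right _ _
  have hMK : M ≤ K := (le_max_left _ _).trans (le_max_left _ _)
  have hLK : L ≤ K := (le_max_right _ _).trans (le_max_left _ _)
  have hex : ∀ t, ∃ f₁ f₂ f₃, t ∈ Icc 0 T → Pack K (fun x => V x t) f₁ f₂ f₃ := by
    intro t
    by_cases ht : t ∈ Icc 0 T
    · have hc : Continuous fun x => V x t := by
        have := h.continuousOn.comp_continuous (f := fun x : ℝ => (x, t)) (by fun_prop)
          (fun x => ⟨mem_univ _, ht⟩)
        exact this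
      have hb : H3Bound K fun x => V x t := ⟨(hM t ht).1, fun k hk => by
        obtain ⟨g, a, b, c⟩ := (hM t ht).2 k hk
        exact ⟨g, a, b, c.trans (ENNReal.ofReal_le_ofReal hMK)⟩⟩
      obtain ⟨f₁, f₂, f₃, hp⟩ := hb.exists_pack hK0 hc
      exact ⟨f₁, f₂, f₃, fun _ => hp⟩
    · exact ⟨0, 0, 0, fun h => absurd h ht⟩
  choose V₁ V₂ V₃ hp using hex
  refine ⟨K, V₁, V₂, V₃, hp, fun s hs t ht => ?_, ?_⟩
  · rw [← L2_sub (hp s hs).w₁.left (hp t ht).w₁.left]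
    exact norm_L2_le (by positivity) ((hL s hs t ht).trans
      (ENNReal.ofReal_le_ofReal (by gcongr)))
  · have := h.equation
    rw [ae_restrict_iff' measurableSet_Ioo] at this
    filter_upwards [this] with t ht hmem
    obtain ⟨p, r, hpm, hpw, hrm, hrw, hlim⟩ := ht hmem
    have q := hp t (Ioo_subset_Icc_self hmem)
    have ep := hpw.ae_eq q.hasWeakDeriv.1 hpm q.w₂.left
    have er := hrw.ae_eq q.hasWeakDeriv.2.2 hrm q.w₃.right
    rw [hasDerivAt_iff_tendsto_slope, tendsto_iff_norm_sub_tendsto_zero]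
    have h2 := (ENNReal.tendsto_toReal ENNReal.zero_ne_top).comp hlim
    rw [ENNReal.toReal_zero] at h2
    refine h2.congr' ?_
    filter_upwards [mem_nhdsWithin_of_mem_nhds (Ioo_mem_nhds hmem.1 hmem.2)] with s hs
    have qs := hp s (Ioo_subset_Icc_self hs)
    have m1 := qs.w₁.left.sub q.w₁.left
    have m2 := q.memLp_mul.add q.w₃.right
    have e : (fun x => (V x s - V x t) / (s - t) - (-(V x t * p x + r x)))
        =ᵐ[volume] fun x => (s - t)⁻¹ * (V x s - V x t) + (V x t * V₁ t x + V₃ t x) := by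
      filter_upwards [ep, er] with x h1 h2
      rw [h1, h2]; ring
    have m4 : MemLp (fun x => (s - t)⁻¹ * (V x s - V x t) + (V x t * V₁ t x + V₃ t x)) 2 volume :=
      (m1.const_mul ((s - t)⁻¹)).add m2
    rw [Function.comp_apply, eLpNorm_congr_ae e, ← norm_L2 m4]
    congr 1
    have e3 : L2 (fun x => (s - t)⁻¹ * (V x s - V x t) + (V x t * V₁ t x + V₃ t x))
        = L2 (fun x => (s - t)⁻¹ * (V x s - V x t)) + L2 (fun x => V x t * V₁ t x + V₃ t x) :=
      L2_add (m1.const_mul _) m2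
    have e4 : L2 (fun x => (s - t)⁻¹ * (V x s - V x t))
        = (s - t)⁻¹ • L2 (fun x => V x s - V x t) := L2_const_mul m1 _
    rw [e3, e4, L2_sub qs.w₁.left q.w₁.left, slope_def_module, rhs, sub_neg_eq_add]

/-- Uniqueness in the class of solutions. -/
lemma Sol.isSolution_unique {T M : ℝ} {U U₁ U₂ U₃ V : ℝ → ℝ → ℝ} (hU : Sol T M U U₁ U₂ U₃)
    (hV : IsSolution T (U 0) V) (x : ℝ) {t : ℝ} (ht : t ∈ Icc 0 T) : V x t = U t x := by
  obtain ⟨M', V₁, V₂, V₃, h⟩ := hV.exists_sol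
  have := hU.unique h (by ext y; exact (hV.initial y).symm) ht
  rw [this]

end KdV
end

noncomputable section

namespace KdV

open scoped InnerProductSpace

/-! ### Existence of solutions as limits of approximate solutions -/

/-- The primitive of a bounded weakly continuous function. -/
lemma primitive_of_weaklyContinuous {g : ℝ → H} {B : ℝ}
    (hg : ∀ p : H, Continuous fun t => ⟪g t, p⟫_ℝ) (hB : ∀ t, ‖g t‖ ≤ B) :
    (∀ᵐ t, HasDerivAt (fun s => ∫ r in (0 : ℝ)..s, g r) (g t) t) ∧
      ∀ s t, ‖(∫ r in (0 : ℝ)..s, g r) - ∫ r in (0 : ℝ)..t, g r‖ ≤ B * |s - t| := by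
  have hm := aestronglyMeasurable_of_weaklyContinuous hg
  have hloc : LocallyIntegrable g volume :=
    (locallyIntegrable_const B).mono hm (Eventually.of_forall fun t =>
      (hB t).trans (le_abs_self B))
  have hi : ∀ a b, IntervalIntegrable g volume a b := fun a b =>
    intervalIntegrable_iff.2 ((hloc.integrableOn_isCompact isCompact_uIcc).mono_set
      uIoc_subset_uIcc)
  refine ⟨?_, fun s t => ?_⟩
  · filter_upwards [LocallyIntegrable.ae_hasDerivAt_integral hloc] with t ht using ht 0
  · rw [intervalIntegral.integral_interval_sub_left (hi _ _) (hi _ _)]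
    exact intervalIntegral.norm_integral_le_of_norm_le_const fun r _ => hB r

/-- Limits of approximate solutions whose errors tend to zero are solutions. -/
theorem exists_sol_of_approxSol {T M : ℝ} (hT : 0 ≤ T) {ε : ℕ → ℝ} {w w₁ w₂ w₃ : ℕ → ℝ → ℝ → ℝ}
    (hw : ∀ k, ApproxSol T M (ε k) (w k) (w₁ k) (w₂ k) (w₃ k)) (hε0 : ∀ k, 0 ≤ ε k)
    (hε : Tendsto ε atTop (𝓝 0)) {N : ℝ} {u₀ f₁ f₂ f₃ : ℝ → ℝ} (hu₀ : Pack N u₀ f₁ f₂ f₃)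
    (h0 : Tendsto (fun k => L2 (w k 0)) atTop (𝓝 (L2 u₀))) :
    ∃ U U₁ U₂ U₃, Sol T (2 * M * M + M) U U₁ U₂ U₃ ∧ U 0 = u₀ := by
  have h0I : (0 : ℝ) ∈ Icc 0 T := ⟨le_rfl, hT⟩
  have hM : 0 ≤ M := ((hw 0).pack 0 h0I).nonneg
  -- Stability makes the family Cauchy in L² at each time, so strong convergence needs no
  -- compactness.
  have stab : ∀ t ∈ Icc 0 T, ∀ k l, ‖L2 (w k t) - L2 (w l t)‖ ^ 2
      ≤ (‖L2 (w k 0) - L2 (w l 0)‖ ^ 2 + 4 * M * (ε k + ε l) * T) * Real.exp (2 * M * T) :=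
    fun t ht k l => (hw k).stability (hε0 k) (hε0 l) (hw l) ht
  have hlim : ∀ t ∈ Icc 0 T, ∃ G : H, Tendsto (fun k => L2 (w k t)) atTop (𝓝 G) := by
    intro t ht
    refine cauchySeq_tendsto_of_complete ?_
    have hc := h0.cauchySeq
    rw [cauchySeq_iff_tendsto_dist_atTop_0] at hc ⊢
    have hε2 : Tendsto (fun n : ℕ × ℕ => ε n.1 + ε n.2) atTop (𝓝 (0 + 0)) := by
      rw [← prod_atTop_atTop_eq]
      exact (hε.comp tendsto_fst).add (hε.comp tendsto_snd)
    have h1 : Tendsto (fun n : ℕ × ℕ => √((dist (L2 (w n.1 0)) (L2 (w n.2 0)) ^ 2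
        + 4 * M * (ε n.1 + ε n.2) * T) * Real.exp (2 * M * T))) atTop (𝓝 0) := by
      have := ((((hc.pow 2).add ((hε2.const_mul (4 * M)).mul_const T)).mul_const
        (Real.exp (2 * M * T)))).sqrt
      simpa using this
    refine squeeze_zero (fun _ => dist_nonneg) (fun n => ?_) h1
    refine Real.le_sqrt_of_sq_le ?_
    rw [dist_eq_norm, dist_eq_norm]
    exact stab t ht n.1 n.2
  have hex : ∀ t, ∃ g g₁ g₂ g₃ : ℝ → ℝ, t ∈ Icc 0 T → Pack M g g₁ g₂ g₃ ∧
      Tendsto (fun k => L2 (w k t)) atTop (𝓝 (L2 g)) := by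
    intro t
    by_cases ht : t ∈ Icc 0 T
    · obtain ⟨G, hG⟩ := hlim t ht
      obtain ⟨g, g₁, g₂, g₃, hp, he⟩ := Pack.exists_limit (fun k => (hw k).pack t ht) hG
      exact ⟨g, g₁, g₂, g₃, fun _ => ⟨hp, by rwa [he]⟩⟩
    · exact ⟨0, 0, 0, 0, fun h => absurd h ht⟩
  choose U U₁ U₂ U₃ hU using hex
  have pk : ∀ t ∈ Icc 0 T, Pack M (U t) (U₁ t) (U₂ t) (U₃ t) := fun t ht => (hU t ht).1
  have tl : ∀ t ∈ Icc 0 T, Tendsto (fun k => L2 (w k t)) atTop (𝓝 (L2 (U t))) :=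
    fun t ht => (hU t ht).2
  have hUlip : ∀ s ∈ Icc 0 T, ∀ t ∈ Icc 0 T, ‖L2 (U s) - L2 (U t)‖ ≤ M * |s - t| :=
    fun s hs t ht => le_of_tendsto ((tl s hs).sub (tl t ht)).norm
      (Eventually.of_forall fun k => (hw k).lip s hs t ht)
  -- the distance to the limit is uniformly small in time
  set η : ℕ → ℝ := fun k => √((‖L2 (w k 0) - L2 u₀‖ ^ 2 + 4 * M * ε k * T)
    * Real.exp (2 * M * T)) with hη
  have hη0 : Tendsto η atTop (𝓝 0) := by
    have h1 : Tendsto (fun k => ‖L2 (w k 0) - L2 u₀‖) atTop (𝓝 0) :=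
      tendsto_iff_norm_sub_tendsto_zero.1 h0
    have := (((h1.pow 2).add ((hε.const_mul (4 * M)).mul_const T)).mul_const
        (Real.exp (2 * M * T))).sqrt
    simpa using this
  have hwU : ∀ k, ∀ t ∈ Icc 0 T, ‖L2 (w k t) - L2 (U t)‖ ≤ η k := by
    intro k t ht
    refine Real.le_sqrt_of_sq_le ?_
    refine le_of_tendsto_of_tendsto ((tendsto_const_nhds.sub (tl t ht)).norm.pow 2) ?_
      (Eventually.of_forall fun l => stab t ht k l)
    have h1 : Tendsto (fun l => ‖L2 (w k 0) - L2 (w l 0)‖ ^ 2) atTop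
        (𝓝 (‖L2 (w k 0) - L2 u₀‖ ^ 2)) := (tendsto_const_nhds.sub h0).norm.pow 2
    have h2 : Tendsto (fun l => 4 * M * (ε k + ε l) * T) atTop (𝓝 (4 * M * (ε k + 0) * T)) :=
      ((tendsto_const_nhds.add hε).const_mul _).mul_const _
    rw [add_zero] at h2
    exact (h1.add h2).mul_const _
  -- the right-hand side, extended to all times
  set c : ℝ → ℝ := fun t => projIcc 0 T hT t with hc
  have hcI : ∀ t, c t ∈ Icc 0 T := fun t => (projIcc 0 T hT t).2
  have hcc : Continuous c := continuous_subtype_val.comp continuous_projIcc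
  have hct : ∀ t ∈ Icc 0 T, c t = t := fun t ht => by simp [hc, projIcc_of_mem hT ht]
  set g : ℝ → H := fun t => rhs (U (c t)) (U₁ (c t)) (U₃ (c t)) with hg
  have hgb : ∀ t, ‖g t‖ ≤ 2 * M * M + M := fun t => (pk _ (hcI t)).norm_rhs_le
  -- Third derivatives of U are bounded in L² but not known to depend continuously on time in norm.
  -- Against test functions the right-hand side is the flux, which is Lipschitz in L², and
  -- boundedness extends weak continuity to all p.
  have hgw : ∀ p : H, Continuous fun t => ⟪g t, p⟫_ℝ := by
    intro p
    rw [continuous_iff_continuousAt]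
    intro t
    refine tendsto_inner_of_test (Eventually.of_forall hgb) (fun φ h1 h2 => ?_) p
    obtain ⟨M', φ₁, φ₂, φ₃, hφ⟩ := exists_pack_test h1 h2
    simp only [hg, (pk _ (hcI _)).inner_rhs hφ]
    rw [tendsto_iff_norm_sub_tendsto_zero]
    have hM' := hφ.nonneg
    have hb : ∀ s, ‖flux (U (c s)) φ₁ φ₃ - flux (U (c t)) φ₁ φ₃‖
        ≤ (2 * M + 1) * (M * |c s - c t|) * M' := fun s =>
      ((pk _ (hcI s)).abs_flux_sub_le (pk _ (hcI t)) hφ).trans (by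
        gcongr; exact hUlip _ (hcI s) _ (hcI t))
    refine squeeze_zero (fun _ => norm_nonneg _) hb ?_
    have hcont : Continuous fun s => (2 * M + 1) * (M * |c s - c t|) * M' := by fun_prop
    simpa using hcont.tendsto t
  obtain ⟨hE1, hE2⟩ := primitive_of_weaklyContinuous hgw hgb
  set E : ℝ → H := fun s => ∫ r in (0 : ℝ)..s, g r with hE
  have hE0 : E 0 = 0 := intervalIntegral.integral_same
  -- the integral equation
  have hint : ∀ t ∈ Icc 0 T, L2 (U t) = L2 (U 0) + E t := by
    intro t ht
    rw [← sub_eq_zero]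
    refine eq_zero_of_inner_test fun φ h1 h2 => ?_
    obtain ⟨M', φ₁, φ₂, φ₃, hφ⟩ := exists_pack_test h1 h2
    have hM' := hφ.nonneg
    have key : ∀ k, |⟪L2 (w k t) - (L2 (w k 0) + E t), L2 φ⟫_ℝ|
        ≤ (ε k + (2 * M + 1) * η k) * M' * t := by
      intro k
      have hη' : 0 ≤ η k := Real.sqrt_nonneg _
      -- Gronwall's inequality with c = 0 integrates a one-sided bound; the signs σ = ±1 give the
      -- absolute value.
      have one : ∀ σ : ℝ, |σ| = 1 → σ * ⟪L2 (w k t) - (L2 (w k 0) + E t), L2 φ⟫_ℝ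
          ≤ (ε k + (2 * M + 1) * η k) * M' * t := by
        intro σ hσ
        have hεk := hε0 k
        have := gronwall_of_lipschitz
          (f := fun s => σ * ⟪L2 (w k s) - (L2 (w k 0) + E s), L2 φ⟫_ℝ) (T := T) (c := 0)
          (k := (ε k + (2 * M + 1) * η k) * M')
          (L := (M + (2 * M * M + M)) * M') le_rfl (by positivity) (by positivity) ?_ ?_ ht
        · simpa [hE0] using this
        · intro r hr s hs
          rw [← mul_sub, abs_mul, hσ, one_mul, ← inner_sub_left]
          refine (abs_real_inner_le_norm _ _).trans ?_
          have e : L2 (w k r) - (L2 (w k 0) + E r) - (L2 (w k s) - (L2 (w k 0) + E s))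
              = (L2 (w k r) - L2 (w k s)) - (E r - E s) := by abel
          rw [e]
          have b := (norm_sub_le (L2 (w k r) - L2 (w k s)) (E r - E s)).trans
            (add_le_add ((hw k).lip r hr s hs) (hE2 r s))
          calc _ ≤ (M * |r - s| + (2 * M * M + M) * |r - s|) * M' := by
                gcongr; exact hφ.n₀
            _ = _ := by ring
        · filter_upwards [(hw k).eqn, hE1] with s hs1 hs2 hs
          obtain ⟨z, hz, hflux⟩ := hs1 hs
          have hsI := Ioo_subset_Icc_self hs
          have hd : HasDerivAt (fun s => L2 (w k s) - (L2 (w k 0) + E s)) (z - g s) s :=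
            hz.sub (hs2.const_add _)
          have hd2 := (hd.inner ℝ (hasDerivAt_const s (L2 φ))).const_mul σ
          refine ⟨_, hd2, ?_⟩
          rw [inner_zero_right, zero_add, zero_mul, zero_add]
          refine (le_abs_self _).trans ?_
          rw [abs_mul, hσ, one_mul, inner_sub_left]
          have e : ⟪g s, L2 φ⟫_ℝ = flux (U s) φ₁ φ₃ := by
            simp only [hg, hct s hsI]; exact (pk s hsI).inner_rhs hφ
          rw [e]
          have f1 := hflux _ _ _ _ _ hφ
          have f2 := ((hw k).pack s hsI).abs_flux_sub_le (pk s hsI) hφ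
          have f3 : (2 * M + 1) * ‖L2 (w k s) - L2 (U s)‖ * M' ≤ (2 * M + 1) * η k * M' := by
            gcongr; exact hwU k s hsI
          have f4 := _root_.abs_sub_le ⟪z, L2 φ⟫_ℝ (flux (w k s) φ₁ φ₃) (flux (U s) φ₁ φ₃)
          linarith
      rw [abs_le]
      constructor
      · have := one (-1) (by norm_num); linarith
      · have := one 1 (by norm_num); linarith
    have l1 : Tendsto (fun k => |⟪L2 (w k t) - (L2 (w k 0) + E t), L2 φ⟫_ℝ|) atTop
        (𝓝 |⟪L2 (U t) - (L2 (U 0) + E t), L2 φ⟫_ℝ|) :=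
      (((tl t ht).sub ((tl 0 h0I).add_const (E t))).inner (𝕜 := ℝ) tendsto_const_nhds).abs
    have l2 : Tendsto (fun k => (ε k + (2 * M + 1) * η k) * M' * t) atTop (𝓝 0) := by
      have := ((hε.add (hη0.const_mul (2 * M + 1))).mul_const M').mul_const t
      simpa using this
    have := le_of_tendsto_of_tendsto l1 l2 (Eventually.of_forall key)
    exact abs_eq_zero.1 (le_antisymm this (abs_nonneg _))
  refine ⟨U, U₁, U₂, U₃, ⟨fun t ht => (pk t ht).mono (by nlinarith), fun s hs t ht =>
    (hUlip s hs t ht).trans (by gcongr; nlinarith), ?_⟩, ?_⟩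
  -- Lebesgue differentiation of the integral equation.
  · filter_upwards [hE1] with t ht hmem
    have htI := Ioo_subset_Icc_self hmem
    have e : rhs (U t) (U₁ t) (U₃ t) = g t := by simp only [hg, hct t htI]
    rw [e]
    refine (ht.const_add (L2 (U 0))).congr_of_eventuallyEq ?_
    filter_upwards [Ioo_mem_nhds hmem.1 hmem.2] with s hs
    exact hint s (Ioo_subset_Icc_self hs)
  · exact (pk 0 h0I).eq_of_L2_eq hu₀ (tendsto_nhds_unique (tl 0 h0I) h0)

end KdV
end

noncomputable section

namespace KdV

open scoped InnerProductSpace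

variable {h : ℝ}

/-! ### Sampling -/

lemma memL2_of_memLp_step (hh : 0 < h) {v : ℤ → ℝ} (hv : MemLp (step h v) 2 volume) :
    MemL2 v := by
  have h1 : ∑' j, ENNReal.ofReal (h * v j ^ 2) = eLpNorm (step h v) 2 volume ^ 2 := by
    rw [lintegral_enorm_sq_eq, lintegral_eq_tsum_cell hh]
    refine tsum_congr fun j => ?_
    have : ∀ x ∈ cell h j, ‖step h v x‖ₑ ^ 2 = ENNReal.ofReal (v j ^ 2) := fun x hx => by
      rw [step, (mem_cell_iff hh).1 hx, Real.enorm_eq_ofReal_abs,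
        ← ENNReal.ofReal_pow (abs_nonneg _), sq_abs]
    rw [setLIntegral_congr_fun (measurableSet_cell j) this, setLIntegral_const, volume_cell,
      ← ENNReal.ofReal_mul (sq_nonneg _), mul_comm]
  have h2 : ∑' j, ENNReal.ofReal (h * v j ^ 2) ≠ ⊤ := by
    rw [h1]; exact ENNReal.pow_ne_top hv.2.ne
  have h3 := ENNReal.summable_toReal h2
  have h4 : Summable fun j => h * v j ^ 2 := h3.congr fun j =>
    ENNReal.toReal_ofReal (by positivity)
  exact (summable_mul_left_iff hh.ne').1 h4

lemma step_sample (hh : 0 < h) {f g : ℝ → ℝ} (hw : W f g) (x : ℝ) :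
    |step h (sample h f) x - f x| ≤ 2 * h * A (-h) h (fun z => |g z|) x := by
  obtain ⟨h1, h2⟩ := mem_cell_floor hh x
  exact hw.abs_sub_le ⟨by linarith, by linarith⟩

lemma memLp_step_sample (hh : 0 < h) {f g : ℝ → ℝ} (hw : W f g) :
    MemLp (step h (sample h f)) 2 volume := by
  have hm := memLp_A (memLp_abs hw.right) (show -h < h by linarith)
  have h1 : MemLp (fun x => step h (sample h f) x - f x) 2 volume := by
    refine (hm.const_mul (2 * h)).mono
      ((measurable_step _ _).aestronglyMeasurable.sub hw.left.1) (Eventually.of_forall fun x => ?_)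
    exact (step_sample hh hw x).trans (le_abs_self _)
  have := h1.add hw.left
  refine this.ae_eq (Eventually.of_forall fun x => ?_)
  simp

lemma memL2_sample (hh : 0 < h) {f g : ℝ → ℝ} (hw : W f g) : MemL2 (sample h f) :=
  memL2_of_memLp_step hh (memLp_step_sample hh hw)

lemma norm_step_sample_sub_le (hh : 0 < h) {f g : ℝ → ℝ} (hw : W f g) :
    ‖L2 (step h (sample h f)) - L2 f‖ ≤ 2 * h * ‖L2 g‖ := by
  have m := memLp_step_sample hh hw
  rw [← L2_sub m hw.left]
  exact norm_L2_le_of_abs_le_A (m.sub hw.left) hw.right hh (step_sample hh hw)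

lemma norm_sample_le (hh : 0 < h) {f g : ℝ → ℝ} (hw : W f g) :
    √h * ‖Grid.mk (sample h f) (memL2_sample hh hw)‖ ≤ ‖L2 f‖ + 2 * h * ‖L2 g‖ := by
  rw [← norm_step hh]
  have h1 := norm_step_sample_sub_le hh hw
  have h2 := norm_le_norm_add_norm_sub' (L2 (step h (sample h f))) (L2 f)
  exact h2.trans (by gcongr)

lemma gridNorm_sample_le (hh : 0 < h) {f g : ℝ → ℝ} (hw : W f g) :
    gridNorm h (sample h f) ≤ ‖L2 f‖ + 2 * h * ‖L2 g‖ := by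
  have := gridNorm_coe (dx := h) (Grid.mk (sample h f) (memL2_sample hh hw))
  exact this.trans_le (norm_sample_le hh hw)

lemma norm_shift_L2 {f : ℝ → ℝ} (hf : MemLp f 2 volume) (c : ℝ) :
    ‖L2 fun x => f (x + c)‖ = ‖L2 f‖ := by
  rw [norm_L2 (memLp_shift hf c), norm_L2 hf]
  congr 1
  exact eLpNorm_comp_measurePreserving (f := fun x => x + c) hf.1
    (measurePreserving_add_right volume c)

/-- The derivative of an average is at most of the size of the inverse width. -/
lemma norm_deriv_A_le {f : ℝ → ℝ} (hf : MemLp f 2 volume) {a b : ℝ} (hab : a < b) :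
    ‖L2 fun x => (b - a)⁻¹ * (f (x + b) - f (x + a))‖ ≤ (b - a)⁻¹ * (2 * ‖L2 f‖) := by
  have mb := memLp_shift hf b
  have ma := memLp_shift hf a
  have e : L2 (fun x => (b - a)⁻¹ * (f (x + b) - f (x + a)))
      = (b - a)⁻¹ • (L2 (fun x => f (x + b)) - L2 fun x => f (x + a)) := by
    rw [← L2_sub mb ma, ← L2_const_mul (f := fun x => f (x + b) - f (x + a)) (mb.sub ma)]
  have hba : 0 ≤ (b - a)⁻¹ := inv_nonneg.2 (by linarith)
  rw [e, norm_smul, Real.norm_of_nonneg hba]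
  have := norm_sub_le (L2 fun x => f (x + b)) (L2 fun x => f (x + a))
  rw [norm_shift_L2 hf, norm_shift_L2 hf] at this
  gcongr; linarith

/-- By the fundamental theorem of calculus a difference quotient of samples is a sample of an
averaged derivative, so iterated differences are again samples. -/
lemma Dp_sample {f g : ℝ → ℝ} (hw : W f g) : Dp h (sample h f) = sample h (A 0 h g) := by
  ext j
  simp only [Dp, sample, A, ← hw.ftc]
  push_cast
  rw [show (j + 1 : ℝ) * h = j * h + h by ring]
  simp only [sub_zero, add_zero]; ring

lemma Dm_sample {f g : ℝ → ℝ} (hw : W f g) : Dm h (sample h f) = sample h (A (-h) 0 g) := by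
  ext j
  simp only [Dm, sample, A, ← hw.ftc]
  push_cast
  rw [show (j - 1 : ℝ) * h = j * h + -h by ring]
  simp only [zero_sub, neg_neg, add_zero]; ring

lemma Dc_sample {f g : ℝ → ℝ} (hw : W f g) : Dc h (sample h f) = sample h (A (-h) h g) := by
  ext j
  simp only [Dc, Dp, Dm, sample, A, ← hw.ftc]
  push_cast
  rw [show (j - 1 : ℝ) * h = j * h + -h by ring, show (j + 1 : ℝ) * h = j * h + h by ring,
    sub_neg_eq_add, ← two_mul, mul_inv]
  ring

/-- The discrete norms of samples are bounded. -/
lemma h3Norm_sample_le (hh : 0 < h) (hh1 : h ≤ 1) {M : ℝ} {f f₁ f₂ f₃ : ℝ → ℝ}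
    (hp : Pack M f f₁ f₂ f₃) : h3Norm h (sample h f) ≤ 14 * M := by
  have hM := hp.nonneg
  have l1 : 0 < h := hh
  have l2 : -h < 0 := by linarith
  have l3 : -h < h := by linarith
  have g0 := gridNorm_sample_le hh hp.w₁
  have g1 := gridNorm_sample_le hh (hp.w₂.A l1)
  have g2 := gridNorm_sample_le hh ((hp.w₃.A l2).A l1)
  have m1 := memLp_A hp.w₃.right l1
  have m2 := memLp_A m1 l3
  -- No fourth derivative is available for the samples of the averaged third one. But the average is
  -- itself differentiable, with derivative of size 2/h, and the factor 2h in the sampling bound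
  -- absorbs this.
  have g3 := gridNorm_sample_le hh (W_A m2 l2)
  have e3 : Dm h (Dc h (Dp h (sample h f)))
      = sample h (A (-h) 0 (A (-h) h (A 0 h f₃))) := by
    rw [Dp_sample hp.w₁, Dc_sample (hp.w₂.A l1), Dm_sample ((hp.w₃.A l1).A l3)]
  rw [h3Norm, e3, Dp_sample hp.w₁, Dm_sample hp.w₁, Dp_sample (hp.w₂.A l2)]
  have n1 := norm_A_le hp.w₂.left l1
  have n2 := norm_A_le hp.w₃.left l1
  have n3 := (norm_A_le (memLp_A hp.w₃.left l2) l1).trans (norm_A_le hp.w₃.left l2)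
  have n4 := (norm_A_le (memLp_A hp.w₃.right l2) l1).trans (norm_A_le hp.w₃.right l2)
  have n5 := ((norm_A_le m2 l2).trans (norm_A_le m1 l3)).trans (norm_A_le hp.w₃.right l1)
  have n6 := (norm_A_le m1 l3).trans (norm_A_le hp.w₃.right l1)
  have n7 := norm_deriv_A_le m2 l2
  have n8 : 2 * h * ‖L2 fun x => (0 - -h)⁻¹ * (A (-h) h (A 0 h f₃) (x + 0)
      - A (-h) h (A 0 h f₃) (x + -h))‖ ≤ 4 * M := by
    calc _ ≤ 2 * h * ((0 - -h)⁻¹ * (2 * ‖L2 (A (-h) h (A 0 h f₃))‖)) := by gcongr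
      _ = 4 * ‖L2 (A (-h) h (A 0 h f₃))‖ := by
          rw [zero_sub, neg_neg]; field_simp; ring
      _ ≤ 4 * M := by linarith [hp.n₃]
  have q : ∀ {y : ℝ}, 0 ≤ y → y ≤ M → 2 * h * y ≤ 2 * M := fun h0 h1 => by nlinarith
  have q1 := q (norm_nonneg (L2 f₁)) hp.n₁
  have q2 := q (norm_nonneg _) (n2.trans hp.n₂)
  have q3 := q (norm_nonneg _) (n4.trans hp.n₃)
  -- The four norms contribute 3M, 3M, 3M and 5M.
  linarith [hp.n₀, hp.n₁, hp.n₂, hp.n₃]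

lemma Grid.N_le_h3Norm (hh : 0 < h) (v : Grid) : Grid.N h v ≤ h3Norm h v := by
  rw [h3Norm, ← Grid.coe_d2, ← Grid.coe_d3, ← Grid.coe_dP, gridNorm_coe, gridNorm_coe,
    gridNorm_coe, gridNorm_coe]
  have p0 : 0 ≤ √h * ‖v‖ := by positivity
  have p1 : 0 ≤ √h * ‖Grid.dP h v‖ := by positivity
  have p2 : 0 ≤ √h * ‖Grid.d2 h v‖ := by positivity
  have p3 : 0 ≤ √h * ‖Grid.d3 h v‖ := by positivity
  refine (abs_le_of_sq_le_sq' ?_ (by positivity)).2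
  have e : Grid.N h v ^ 2 = (√h * ‖v‖) ^ 2 + (√h * ‖Grid.d2 h v‖) ^ 2
      + (√h * ‖Grid.d3 h v‖) ^ 2 := by
    rw [Grid.N_sq hh, mul_pow, mul_pow, mul_pow, Real.sq_sqrt hh.le]; ring
  rw [e]
  nlinarith [mul_nonneg p0 p1, mul_nonneg p0 p2, mul_nonneg p0 p3, mul_nonneg p1 p2,
    mul_nonneg p1 p3, mul_nonneg p2 p3]

/-- The smooth interpolation of samples approximates the function. -/
lemma norm_smooth_sample_sub_le (hh : 0 < h) {f g : ℝ → ℝ} (hw : W f g) {v : Grid}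
    (hv : (v : ℤ → ℝ) = sample h f) {c : ℝ} (hc : Grid.N h v ≤ c) :
    ‖L2 (smooth h v) - L2 f‖ ≤ h * (6 * c + 2 * ‖L2 g‖) := by
  have h1 := norm_smooth_sub_step_le hh v
  have h2 := norm_step_sample_sub_le hh hw
  rw [← hv] at h2
  have h3 := (Grid.norm_dP_le_N hh v).trans hc
  have h4 := norm_sub_le_norm_sub_add_norm_sub (L2 (smooth h v)) (L2 (step h v)) (L2 f)
  nlinarith

end KdV
end

noncomputable section

namespace KdV

open scoped InnerProductSpace

variable {h : ℝ}

/-! ### Piecewise cubic interpolation -/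

/-- The piecewise cubic function with given one-sided derivatives at the left ends of the cells. -/
def poly (h : ℝ) (a b c d : ℤ → ℝ) (x : ℝ) : ℝ :=
  a ⌊x / h⌋ + (x - ⌊x / h⌋ * h) * b ⌊x / h⌋ + 1 / 2 * (x - ⌊x / h⌋ * h) ^ 2 * c ⌊x / h⌋
    + 1 / 6 * (x - ⌊x / h⌋ * h) ^ 3 * d ⌊x / h⌋

lemma spaceInterp_eq_poly (v : Grid) :
    spaceInterp h v = poly h v (Grid.dP h v) (Grid.d2 h v) (Grid.d3 h v) := by
  rw [Grid.coe_dP, Grid.coe_d2, Grid.coe_d3']; rfl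

lemma spaceInterp_add_smul (u v : Grid) (θ : ℝ) (x : ℝ) :
    spaceInterp h (u + θ • v : Grid) x = spaceInterp h u x + θ * spaceInterp h v x := by
  rw [spaceInterp_eq_poly, spaceInterp_eq_poly, spaceInterp_eq_poly]
  simp only [poly, map_add, map_smul, lp.coeFn_add, Pi.add_apply,
    lp.coeFn_smul, Pi.smul_apply, smul_eq_mul]
  ring

lemma spaceInterp_sub (u v : Grid) (x : ℝ) :
    spaceInterp h (u - v : Grid) x = spaceInterp h u x - spaceInterp h v x := by
  have := spaceInterp_add_smul (h := h) u v (-1) x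
  rw [neg_one_smul, ← sub_eq_add_neg] at this
  rw [this]; ring

lemma measurable_poly (a b c d : ℤ → ℝ) : Measurable (poly h a b c d) := by
  have m := fun v : ℤ → ℝ => measurable_step h v
  have mx : Measurable fun x : ℝ => x - ⌊x / h⌋ * h :=
    measurable_id.sub ((m fun j => (j : ℝ)).mul_const h)
  exact (((m a).add (mx.mul (m b))).add (((mx.pow_const 2).const_mul _).mul (m c))).add
    (((mx.pow_const 3).const_mul _).mul (m d))

lemma cell_param (hh : 0 < h) (x : ℝ) : 0 ≤ x - ⌊x / h⌋ * h ∧ x - ⌊x / h⌋ * h ≤ h := by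
  obtain ⟨h1, h2⟩ := mem_cell_floor hh x
  exact ⟨by linarith, by linarith⟩

lemma abs_poly_le (hh : 0 < h) (a b c d : ℤ → ℝ) (x : ℝ) :
    |poly h a b c d x| ≤ |a ⌊x / h⌋| + h * |b ⌊x / h⌋| + h ^ 2 * |c ⌊x / h⌋|
      + h ^ 3 * |d ⌊x / h⌋| := by
  obtain ⟨h1, h2⟩ := cell_param hh x
  unfold poly
  set ξ := x - ⌊x / h⌋ * h
  have p2 : ξ ^ 2 ≤ h ^ 2 := pow_le_pow_left₀ h1 h2 2
  have p3 : ξ ^ 3 ≤ h ^ 3 := pow_le_pow_left₀ h1 h2 3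
  have q2 : 0 ≤ ξ ^ 2 := by positivity
  have q3 : 0 ≤ ξ ^ 3 := by positivity
  refine (abs_add_le _ _).trans (add_le_add ((abs_add_le _ _).trans (add_le_add
    ((abs_add_le _ _).trans (add_le_add le_rfl ?_)) ?_)) ?_)
  · rw [abs_mul, abs_of_nonneg h1]; gcongr
  · rw [abs_mul, abs_mul, abs_of_nonneg q2, abs_of_pos (by norm_num : (0 : ℝ) < 1 / 2)]
    gcongr; linarith
  · rw [abs_mul, abs_mul, abs_of_nonneg q3, abs_of_pos (by norm_num : (0 : ℝ) < 1 / 6)]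
    gcongr; linarith

lemma eLpNorm_le_of_abs_le_step (hh : 0 < h) {F : ℝ → ℝ} {a b c d : Grid} {C : ℝ}
    (hF : ∀ᵐ x, |F x| ≤ |a ⌊x / h⌋| + h * |b ⌊x / h⌋| + h ^ 2 * |c ⌊x / h⌋|
      + h ^ 3 * |d ⌊x / h⌋|)
    (hC : √h * ‖a‖ + h * (√h * ‖b‖) + h ^ 2 * (√h * ‖c‖) + h ^ 3 * (√h * ‖d‖) ≤ C) :
    eLpNorm F 2 volume ≤ ENNReal.ofReal C := by
  have m := fun v : Grid => memLp_abs (memLp_step hh v)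
  have m1 : MemLp (fun x => |step h a x| + h * |step h b x|) 2 volume :=
    (m a).add ((m b).const_mul h)
  have m2 : MemLp (fun x => |step h a x| + h * |step h b x| + h ^ 2 * |step h c x|) 2 volume :=
    m1.add ((m c).const_mul _)
  have m3 : MemLp (fun x => |step h a x| + h * |step h b x| + h ^ 2 * |step h c x|
      + h ^ 3 * |step h d x|) 2 volume := m2.add ((m d).const_mul _)
  have n : ∀ (v : Grid) (r : ℝ), 0 ≤ r → ‖L2 fun x => r * |step h v x|‖ = r * (√h * ‖v‖) :=
    fun v r hr => by
      rw [L2_const_mul (m v), norm_smul, norm_L2_abs (memLp_step hh v), norm_step hh,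
        Real.norm_of_nonneg hr]
  have e : ‖L2 fun x => |step h a x| + h * |step h b x| + h ^ 2 * |step h c x|
      + h ^ 3 * |step h d x|‖ ≤ C := by
    rw [L2_add m2 ((m d).const_mul _), L2_add m1 ((m c).const_mul _),
      L2_add (m a) ((m b).const_mul _)]
    refine le_trans ?_ hC
    refine (norm_add_le _ _).trans (add_le_add ((norm_add_le _ _).trans (add_le_add
      ((norm_add_le _ _).trans (add_le_add ?_ ?_)) ?_)) ?_)
    · rw [norm_L2_abs (memLp_step hh a), norm_step hh]
    · exact (n b h hh.le).le
    · exact (n c _ (by positivity)).le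
    · exact (n d _ (by positivity)).le
  refine (eLpNorm_mono_ae (g := fun x => |step h a x| + h * |step h b x| + h ^ 2 * |step h c x|
      + h ^ 3 * |step h d x|) ?_).trans ?_
  · filter_upwards [hF] with x hx
    exact hx.trans (le_abs_self _)
  · rw [eLpNorm_eq_norm_L2 m3]
    exact ENNReal.ofReal_le_ofReal e

lemma memLp_poly (hh : 0 < h) (a b c d : Grid) : MemLp (poly h a b c d) 2 volume :=
  ⟨(measurable_poly _ _ _ _).aestronglyMeasurable,
    (eLpNorm_le_of_abs_le_step hh (Eventually.of_forall (abs_poly_le hh a b c d)) le_rfl).trans_lt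
      ENNReal.ofReal_lt_top⟩

lemma hasDerivAt_poly (hh : 0 < h) (a b c d : ℤ → ℝ) {j : ℤ} {x : ℝ}
    (hx : x ∈ Ioo (j * h) ((j + 1) * h)) :
    HasDerivAt (poly h a b c d) (poly h b c d 0 x) x := by
  have fl : ∀ y ∈ Ioo (j * h) ((j + 1) * h), ⌊y / h⌋ = j := fun y hy =>
    (mem_cell_iff hh).1 (Ioo_subset_Ico_self hy)
  have ev : poly h a b c d =ᶠ[𝓝 x] fun y => a j + (y - j * h) * b j
      + 1 / 2 * (y - j * h) ^ 2 * c j + 1 / 6 * (y - j * h) ^ 3 * d j := by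
    filter_upwards [Ioo_mem_nhds hx.1 hx.2] with y hy
    simp only [poly, fl y hy]
  refine HasDerivAt.congr_of_eventuallyEq ?_ ev
  have h1 : HasDerivAt (fun y : ℝ => y - j * h) 1 x := (hasDerivAt_id x).sub_const _
  have := (((h1.mul_const (b j)).const_add (a j)).add
    (((h1.pow 2).const_mul (1 / 2)).mul_const (c j))).add
    (((h1.pow 3).const_mul (1 / 6)).mul_const (d j))
  convert! this using 1
  simp only [poly, fl x hx, Pi.zero_apply]
  push_cast
  ring

lemma ae_mem_interior (hh : 0 < h) : ∀ᵐ x : ℝ, ∃ j : ℤ, x ∈ Ioo (j * h) ((j + 1) * h) := by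
  have hcount : (range fun j : ℤ => (j : ℝ) * h).Countable := countable_range _
  filter_upwards [hcount.ae_notMem volume] with x hx
  obtain ⟨h1, h2⟩ := mem_cell_floor hh x
  exact ⟨_, lt_of_le_of_ne h1 fun he => hx ⟨_, he⟩, h2⟩

lemma deriv_poly_eventuallyEq (hh : 0 < h) (a b c d : ℤ → ℝ) {j : ℤ} {x : ℝ}
    (hx : x ∈ Ioo (j * h) ((j + 1) * h)) :
    deriv (poly h a b c d) =ᶠ[𝓝 x] poly h b c d 0 := by
  filter_upwards [Ioo_mem_nhds hx.1 hx.2] with y hy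
  exact (hasDerivAt_poly hh a b c d hy).deriv

lemma iteratedDeriv_three_poly (hh : 0 < h) (a b c d : ℤ → ℝ) {j : ℤ} {x : ℝ}
    (hx : x ∈ Ioo (j * h) ((j + 1) * h)) :
    iteratedDeriv 3 (poly h a b c d) x = d ⌊x / h⌋ := by
  rw [iteratedDeriv_succ', (deriv_poly_eventuallyEq hh a b c d hx).iteratedDeriv_eq,
    iteratedDeriv_succ', (deriv_poly_eventuallyEq hh b c d 0 hx).iteratedDeriv_eq,
    iteratedDeriv_one, (deriv_poly_eventuallyEq hh c d 0 0 hx).eq_of_nhds]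
  simp [poly]

lemma eLpNorm_deriv_spaceInterp_le (hh : 0 < h) (hh1 : h ≤ 1) (v : Grid) :
    eLpNorm (fun x => deriv (spaceInterp h v) x) 2 volume ≤ ENNReal.ofReal (3 * Grid.N h v) := by
  rw [spaceInterp_eq_poly]
  refine eLpNorm_le_of_abs_le_step hh (a := Grid.dP h v) (b := Grid.d2 h v) (c := Grid.d3 h v)
    (d := 0) ?_ ?_
  · filter_upwards [ae_mem_interior hh] with x hx
    obtain ⟨j, hj⟩ := hx
    rw [(hasDerivAt_poly hh _ _ _ _ hj).deriv]
    exact abs_poly_le hh _ _ _ 0 x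
  · have h1 := Grid.norm_dP_le_N hh v
    have h2 := Grid.norm_d2_le_N hh v
    have h3 := Grid.norm_d3_le_N hh v
    have h0 := Grid.N_nonneg (h := h) v
    have h4 : h ^ 2 ≤ 1 := pow_le_one₀ hh.le hh1
    rw [norm_zero, mul_zero, mul_zero, add_zero]
    have a1 := mul_le_mul hh1 h2 (by positivity) zero_le_one
    have a2 := mul_le_mul h4 h3 (by positivity) zero_le_one
    linarith

lemma eLpNorm_iteratedDeriv_spaceInterp_le (hh : 0 < h) (v : Grid) :
    eLpNorm (fun x => iteratedDeriv 3 (spaceInterp h v) x) 2 volume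
      ≤ ENNReal.ofReal (Grid.N h v) := by
  rw [spaceInterp_eq_poly]
  refine eLpNorm_le_of_abs_le_step hh (a := Grid.d3 h v) (b := 0) (c := 0) (d := 0) ?_ ?_
  · filter_upwards [ae_mem_interior hh] with x hx
    obtain ⟨j, hj⟩ := hx
    rw [iteratedDeriv_three_poly hh _ _ _ _ hj]
    simp
  · simpa using Grid.norm_d3_le_N hh v

lemma Grid.norm_dP_le (hh : 0 < h) (v : Grid) : h * ‖Grid.dP h v‖ ≤ 2 * ‖v‖ := by
  have e : h • Grid.dP h v = Grid.shift 1 v - v := by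
    ext j; simp; field_simp
  have := norm_sub_le (Grid.shift 1 v) v
  rw [← e, norm_smul, Real.norm_of_nonneg hh.le, Grid.norm_shift] at this
  linarith

lemma Grid.norm_d2_le (hh : 0 < h) (v : Grid) : h ^ 2 * ‖Grid.d2 h v‖ ≤ 4 * ‖v‖ := by
  have h1 := Grid.norm_dP_le hh (Grid.dM h v)
  have h2 := Grid.norm_dP_le hh v
  rw [Grid.norm_dM] at h1
  have e : Grid.d2 h v = Grid.dP h (Grid.dM h v) := rfl
  rw [e]
  nlinarith

lemma Grid.norm_d3_le (hh : 0 < h) (v : Grid) : h ^ 3 * ‖Grid.d3 h v‖ ≤ 8 * ‖v‖ := by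
  have h1 := (mul_le_mul_of_nonneg_left (Grid.norm_dC_le (h := h) (Grid.d2 h v)) hh.le).trans
    (Grid.norm_dP_le hh (Grid.d2 h v))
  have h2 := Grid.norm_d2_le hh v
  have e : Grid.d3 h v = Grid.dC h (Grid.d2 h v) := rfl
  rw [e]
  have := mul_le_mul_of_nonneg_left h1 (sq_nonneg h)
  nlinarith

/-- An inverse estimate: h, h² and h³ times the differences are bounded by 2, 4 and 8 times v
itself, and 15 = 1 + 2 + 4 + 8. It serves for difference quotients in time, which are bounded in ℓ²
only. -/
lemma eLpNorm_spaceInterp_le (hh : 0 < h) (v : Grid) :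
    eLpNorm (spaceInterp h v) 2 volume ≤ ENNReal.ofReal (15 * (√h * ‖v‖)) := by
  rw [spaceInterp_eq_poly]
  refine eLpNorm_le_of_abs_le_step hh (Eventually.of_forall (abs_poly_le hh _ _ _ _)) ?_
  have s := Real.sqrt_nonneg h
  have h1 := mul_le_mul_of_nonneg_left (Grid.norm_dP_le hh v) s
  have h2 := mul_le_mul_of_nonneg_left (Grid.norm_d2_le hh v) s
  have h3 := mul_le_mul_of_nonneg_left (Grid.norm_d3_le hh v) s
  linarith

lemma abs_spaceInterp_sub_step_le (hh : 0 < h) (v : Grid) {c : ℝ}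
    (hc : ∀ j, |Grid.dP h v j| ≤ c) (x : ℝ) : |spaceInterp h v x - step h v x| ≤ 5 * h * c := by
  have h2 : ∀ j, h * |Grid.d2 h v j| ≤ 2 * c := fun j => by
    have e : h * Grid.d2 h v j = Grid.dP h v j - Grid.dP h v (j - 1) := by
      rw [Grid.d2_apply]; simp; field_simp; ring
    rw [← abs_of_pos hh, ← abs_mul, abs_of_pos hh, e]
    exact (abs_sub _ _).trans (by linarith [hc j, hc (j - 1)])
  have h3 : ∀ j, h ^ 2 * |Grid.d3 h v j| ≤ 2 * c := fun j => by
    have e : Grid.d3 h v j = (Grid.d2 h v (j + 1) - Grid.d2 h v (j - 1)) / (2 * h) := by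
      change Grid.dC h (Grid.d2 h v) j = _
      rw [Grid.dC_apply]
    have e2 : h ^ 2 * Grid.d3 h v j = (h * Grid.d2 h v (j + 1) - h * Grid.d2 h v (j - 1)) / 2 := by
      rw [e]; field_simp
    rw [← abs_of_pos (pow_pos hh 2), ← abs_mul, e2, abs_div, abs_of_pos (two_pos : (0 : ℝ) < 2)]
    have := abs_sub (h * Grid.d2 h v (j + 1)) (h * Grid.d2 h v (j - 1))
    rw [abs_mul, abs_mul, abs_of_pos hh] at this
    linarith [h2 (j + 1), h2 (j - 1)]
  have e : spaceInterp h v x - step h v x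
      = poly h (fun _ => 0) (Grid.dP h v) (Grid.d2 h v) (Grid.d3 h v) x := by
    rw [spaceInterp_eq_poly]; simp only [poly, step]; ring
  rw [e]
  refine (abs_poly_le hh _ _ _ _ x).trans ?_
  have a1 := mul_le_mul_of_nonneg_left (hc ⌊x / h⌋) hh.le
  have a2 := mul_le_mul_of_nonneg_left (h2 ⌊x / h⌋) hh.le
  have a3 := mul_le_mul_of_nonneg_left (h3 ⌊x / h⌋) hh.le
  rw [abs_zero]
  linarith

lemma abs_spaceInterp_sub_smooth_le (hh : 0 < h) (v : Grid) (x : ℝ) :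
    |spaceInterp h v x - smooth h v x| ≤ 22 * h * Grid.N h v := by
  have hc := Grid.abs_dP_le_N hh v
  have h1 := abs_spaceInterp_sub_step_le hh v hc x
  have h2 := abs_smooth_sub_le hh v hc x
  rw [abs_sub_comm] at h2
  have := _root_.abs_sub_le (spaceInterp h v x) (step h v x) (smooth h v x)
  linarith

/-! ### Integrals of piecewise cubic functions -/

lemma integral_cubic_sq (a b c d h : ℝ) :
    ∫ s in (0 : ℝ)..h, (a + s * b + 1 / 2 * s ^ 2 * c + 1 / 6 * s ^ 3 * d) ^ 2
      = h * (a * a) + h ^ 2 * (a * b) + h ^ 3 / 3 * (b * b + a * c)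
        + h ^ 4 * (1 / 4 * (b * c) + 1 / 12 * (a * d))
        + h ^ 5 * (1 / 20 * (c * c) + 1 / 15 * (b * d)) + h ^ 6 / 36 * (c * d)
        + h ^ 7 / 252 * (d * d) := by
  have hd : ∀ s ∈ uIcc 0 h, HasDerivAt (fun s : ℝ => s * (a * a) + s ^ 2 * (a * b)
        + s ^ 3 * ((b * b + a * c) / 3) + s ^ 4 * (1 / 4 * (b * c) + 1 / 12 * (a * d))
        + s ^ 5 * (1 / 20 * (c * c) + 1 / 15 * (b * d)) + s ^ 6 * (c * d / 36)
        + s ^ 7 * (d * d / 252))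
      ((a + s * b + 1 / 2 * s ^ 2 * c + 1 / 6 * s ^ 3 * d) ^ 2) s := by
    intro s _
    have p := fun (n : ℕ) (r : ℝ) => (hasDerivAt_pow n s).mul_const r
    have := ((((((((hasDerivAt_id s).mul_const (a * a)).add (p 2 (a * b))).add
      (p 3 ((b * b + a * c) / 3))).add (p 4 (1 / 4 * (b * c) + 1 / 12 * (a * d)))).add
      (p 5 (1 / 20 * (c * c) + 1 / 15 * (b * d)))).add (p 6 (c * d / 36))).add
      (p 7 (d * d / 252)))
    convert! this using 1
    push_cast
    ring
  rw [intervalIntegral.integral_eq_sub_of_hasDerivAt hd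
    ((by fun_prop : Continuous fun s : ℝ =>
      (a + s * b + 1 / 2 * s ^ 2 * c + 1 / 6 * s ^ 3 * d) ^ 2).intervalIntegrable _ _)]
  ring

lemma integral_poly_sq (hh : 0 < h) (a b c d : Grid) :
    ∫ x, poly h a b c d x ^ 2
      = h * ⟪a, a⟫_ℝ + h ^ 2 * ⟪a, b⟫_ℝ + h ^ 3 / 3 * (⟪b, b⟫_ℝ + ⟪a, c⟫_ℝ)
        + h ^ 4 * (1 / 4 * ⟪b, c⟫_ℝ + 1 / 12 * ⟪a, d⟫_ℝ)
        + h ^ 5 * (1 / 20 * ⟪c, c⟫_ℝ + 1 / 15 * ⟪b, d⟫_ℝ) + h ^ 6 / 36 * ⟪c, d⟫_ℝ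
        + h ^ 7 / 252 * ⟪d, d⟫_ℝ := by
  have hi : IntegrableOn (fun x => poly h a b c d x ^ 2) (⋃ j, cell h j) volume :=
    ((memLp_poly hh a b c d).integrable_sq).integrableOn
  have hcell : ∀ j, ∫ x in cell h j, poly h a b c d x ^ 2
      = h * (a j * a j) + h ^ 2 * (a j * b j) + h ^ 3 / 3 * (b j * b j + a j * c j)
        + h ^ 4 * (1 / 4 * (b j * c j) + 1 / 12 * (a j * d j))
        + h ^ 5 * (1 / 20 * (c j * c j) + 1 / 15 * (b j * d j)) + h ^ 6 / 36 * (c j * d j)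
        + h ^ 7 / 252 * (d j * d j) := by
    intro j
    have e1 : ∫ x in cell h j, poly h a b c d x ^ 2 = ∫ x in cell h j,
        (a j + (x - j * h) * b j + 1 / 2 * (x - j * h) ^ 2 * c j
          + 1 / 6 * (x - j * h) ^ 3 * d j) ^ 2 :=
      setIntegral_congr_fun (measurableSet_cell j) fun x hx => by
        simp only [poly, (mem_cell_iff hh).1 hx]
    rw [e1, cell, integral_Ico_eq_integral_Ioc, ← intervalIntegral.integral_of_le (by nlinarith),
      intervalIntegral.integral_comp_sub_right (fun s => (a j + s * b j + 1 / 2 * s ^ 2 * c j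
        + 1 / 6 * s ^ 3 * d j) ^ 2), ← integral_cubic_sq, sub_self,
      show (j + 1 : ℝ) * h - j * h = h by ring]
  have s := fun u v : Grid => Grid.hasSum_inner u v
  have hs := (((((((s a a).mul_left h).add ((s a b).mul_left (h ^ 2))).add
    (((s b b).add (s a c)).mul_left (h ^ 3 / 3))).add
    ((((s b c).mul_left (1 / 4)).add ((s a d).mul_left (1 / 12))).mul_left (h ^ 4))).add
    ((((s c c).mul_left (1 / 20)).add ((s b d).mul_left (1 / 15))).mul_left (h ^ 5))).add
    ((s c d).mul_left (h ^ 6 / 36))).add ((s d d).mul_left (h ^ 7 / 252))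
  rw [← setIntegral_univ, ← iUnion_cell hh, integral_iUnion (fun j => measurableSet_cell j)
    (pairwise_disjoint_cell hh) hi, ← hs.tsum_eq]
  exact tsum_congr hcell

/-- Expand ‖v + h D₊v‖ = ‖v‖, the invariance of the norm under the shift. -/
lemma Grid.inner_dP_self (hh : 0 < h) (v : Grid) :
    ⟪v, Grid.dP h v⟫_ℝ = -(h / 2) * ‖Grid.dP h v‖ ^ 2 := by
  have e : Grid.shift 1 v = v + h • Grid.dP h v := by
    ext j
    simp only [Grid.shift_apply, lp.coeFn_add, Pi.add_apply, lp.coeFn_smul, Pi.smul_apply,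
      Grid.dP_apply, smul_eq_mul]
    field_simp; ring
  have h1 : ‖Grid.shift 1 v‖ ^ 2 = ‖v‖ ^ 2 := by rw [Grid.norm_shift]
  rw [e, norm_add_sq_real, real_inner_smul_right, norm_smul, Real.norm_of_nonneg hh.le] at h1
  have h2 : h * (⟪v, Grid.dP h v⟫_ℝ + h / 2 * ‖Grid.dP h v‖ ^ 2) = 0 := by nlinarith
  have := (mul_eq_zero.1 h2).resolve_left hh.ne'
  linarith

lemma Grid.abs_inner_le_of (hh : 0 < h) {a b : Grid} {N : ℝ} (ha : √h * ‖a‖ ≤ N)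
    (hb : √h * ‖b‖ ≤ N) : |h * ⟪a, b⟫_ℝ| ≤ N ^ 2 := by
  have h1 := abs_real_inner_le_norm a b
  rw [abs_mul, abs_of_pos hh]
  have h2 := mul_le_mul ha hb (by positivity) ((by positivity : 0 ≤ √h * ‖a‖).trans ha)
  calc h * |⟪a, b⟫_ℝ| ≤ h * (‖a‖ * ‖b‖) := by gcongr
    _ = (√h * ‖a‖) * (√h * ‖b‖) := by
        have := Real.mul_self_sqrt hh.le
        nlinarith
    _ ≤ _ := by rw [sq]; exact h2

/-- The interpolation is smaller in `L²` than the grid function by a term of second order. -/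
lemma integral_spaceInterp_sq_le (hh : 0 < h) (hh1 : h ≤ 1) (v : Grid) :
    ∫ x, spaceInterp h v x ^ 2
      ≤ (√h * ‖v‖) ^ 2 - h ^ 2 / 2 * (√h * ‖Grid.dP h v‖) ^ 2 + h ^ 3 * Grid.N h v ^ 2 := by
  rw [spaceInterp_eq_poly, integral_poly_sq hh, mul_pow, mul_pow, Real.sq_sqrt hh.le]
  have n0 := Grid.norm_le_N hh v
  have n1 := Grid.norm_dP_le_N hh v
  have n2 := Grid.norm_d2_le_N hh v
  have n3 := Grid.norm_d3_le_N hh v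
  have b12 := (abs_le.1 (Grid.abs_inner_le_of hh n1 n2)).2
  have b03 := (abs_le.1 (Grid.abs_inner_le_of hh n0 n3)).2
  have b22 := (abs_le.1 (Grid.abs_inner_le_of hh n2 n2)).2
  have b13 := (abs_le.1 (Grid.abs_inner_le_of hh n1 n3)).2
  have b23 := (abs_le.1 (Grid.abs_inner_le_of hh n2 n3)).2
  have b33 := (abs_le.1 (Grid.abs_inner_le_of hh n3 n3)).2
  -- The term h²⟨v, D₊v⟩ equals -(h³/2)‖D₊v‖², and the two terms with factor h³/3 cancel. All others
  -- are of higher order in h and bounded by the energy.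
  have e1 := Grid.inner_dP_self hh v
  have e2 : ⟪v, Grid.d2 h v⟫_ℝ = -‖Grid.dP h v‖ ^ 2 := by rw [Grid.norm_dP_sq, neg_neg]
  rw [e1, e2, real_inner_self_eq_norm_sq v, real_inner_self_eq_norm_sq (Grid.dP h v)]
  set X := Grid.N h v ^ 2
  have hX : 0 ≤ X := sq_nonneg _
  have h3 : 0 < h ^ 3 := by positivity
  have l4 : h ^ 4 ≤ h ^ 3 := pow_le_pow_of_le_one hh.le hh1 (by norm_num)
  have l5 : h ^ 5 ≤ h ^ 3 := pow_le_pow_of_le_one hh.le hh1 (by norm_num)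
  have l6 : h ^ 6 ≤ h ^ 3 := pow_le_pow_of_le_one hh.le hh1 (by norm_num)
  have c12 := mul_le_mul_of_nonneg_left b12 h3.le
  have c03 := mul_le_mul_of_nonneg_left b03 h3.le
  have p4 : 0 ≤ h ^ 4 := by positivity
  have p5 : 0 ≤ h ^ 5 := by positivity
  have p6 : 0 ≤ h ^ 6 := by positivity
  have c22 := (mul_le_mul_of_nonneg_left b22 p4).trans (mul_le_mul_of_nonneg_right l4 hX)
  have c13 := (mul_le_mul_of_nonneg_left b13 p4).trans (mul_le_mul_of_nonneg_right l4 hX)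
  have c23 := (mul_le_mul_of_nonneg_left b23 p5).trans (mul_le_mul_of_nonneg_right l5 hX)
  have c33 := (mul_le_mul_of_nonneg_left b33 p6).trans (mul_le_mul_of_nonneg_right l6 hX)
  have hX3 : 0 ≤ h ^ 3 * X := by positivity
  linarith

end KdV
end

noncomputable section

namespace KdV

open scoped InnerProductSpace

variable {h : ℝ}

/-! ### Accuracy of the trapezoidal rule -/

/-- Taylor's formula with integral remainder. -/
lemma Pack.abs_taylor_le {M : ℝ} {f f₁ f₂ f₃ : ℝ → ℝ} (hp : Pack M f f₁ f₂ f₃) {r x y : ℝ}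
    (hy : |y - x| ≤ r) : |f y - (f x + f₁ x * (y - x) + 1 / 2 * f₂ x * (y - x) ^ 2)|
      ≤ 2 * r * A (-r) r (fun z => |f₃ z|) x * r ^ 2 := by
  have hr : 0 ≤ r := (abs_nonneg _).trans hy
  set κ := 2 * r * A (-r) r (fun z => |f₃ z|) x with hκ
  have mem : ∀ z ∈ uIcc x y, |z - x| ≤ r := fun z hz =>
    (abs_sub_left_of_mem_uIcc hz).trans hy
  -- The oscillation of the second derivative is at most κ; integrating twice over an interval of
  -- length at most r gives κ r².
  have b2 : ∀ z, |z - x| ≤ r → |f₂ z - f₂ x| ≤ κ := fun z hz => by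
    have := _root_.abs_le.1 hz
    exact hp.w₃.abs_sub_le ⟨by linarith [this.1], by linarith [this.2]⟩
  have b1 : ∀ z, |z - x| ≤ r → |f₁ z - (f₁ x + f₂ x * (z - x))| ≤ κ * r := fun z hz => by
    have hi := memLp_intervalIntegrable hp.w₂.right x z
    have e : f₁ z - (f₁ x + f₂ x * (z - x)) = ∫ s in x..z, (f₂ s - f₂ x) := by
      rw [intervalIntegral.integral_sub hi intervalIntegrable_const, ← hp.w₂.ftc,
        intervalIntegral.integral_const, smul_eq_mul]; ring
    rw [e, ← Real.norm_eq_abs]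
    have hκ0 : 0 ≤ κ := (abs_nonneg _).trans (b2 z hz)
    refine (intervalIntegral.norm_integral_le_of_norm_le_const (C := κ) fun s hs => ?_).trans ?_
    · exact b2 s ((abs_sub_left_of_mem_uIcc (uIoc_subset_uIcc hs)).trans hz)
    · gcongr
  have hi := memLp_intervalIntegrable hp.w₁.right x y
  have hpoly : ∫ s in x..y, (f₁ x + f₂ x * (s - x)) = f₁ x * (y - x) + 1 / 2 * f₂ x * (y - x) ^ 2 := by
    have hd : ∀ s ∈ uIcc x y, HasDerivAt (fun s => f₁ x * (s - x) + 1 / 2 * f₂ x * (s - x) ^ 2)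
        (f₁ x + f₂ x * (s - x)) s := fun s _ => by
      have h1 : HasDerivAt (fun s : ℝ => s - x) 1 s := (hasDerivAt_id s).sub_const _
      have := (h1.const_mul (f₁ x)).add ((h1.pow 2).const_mul (1 / 2 * f₂ x))
      convert! this using 1
      push_cast; ring
    rw [intervalIntegral.integral_eq_sub_of_hasDerivAt hd
      ((by fun_prop : Continuous fun s => f₁ x + f₂ x * (s - x)).intervalIntegrable _ _)]
    ring
  have e : f y - (f x + f₁ x * (y - x) + 1 / 2 * f₂ x * (y - x) ^ 2)
      = ∫ s in x..y, (f₁ s - (f₁ x + f₂ x * (s - x))) := by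
    rw [intervalIntegral.integral_sub hi
      ((by fun_prop : Continuous fun s => f₁ x + f₂ x * (s - x)).intervalIntegrable _ _),
      ← hp.w₁.ftc, hpoly]; ring
  rw [e, ← Real.norm_eq_abs]
  have hκ0 : 0 ≤ κ := (abs_nonneg _).trans (b2 x (by simpa using hr))
  refine (intervalIntegral.norm_integral_le_of_norm_le_const (C := κ * r) fun s hs => ?_).trans ?_
  · exact b1 s (mem s (uIoc_subset_uIcc hs))
  · rw [sq, ← mul_assoc]; gcongr

/-- The piecewise quadratic interpolation. -/
def quad (h : ℝ) (v : Grid) : ℝ → ℝ :=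
  poly h v (Grid.dP h v - (h / 2) • Grid.d2 h v : Grid) (Grid.d2 h v) (0 : Grid)

lemma abs_lagrange_le {s : ℝ} (s0 : 0 ≤ s) (s1 : s ≤ 1) :
    |s * (s - 1) / 2| ≤ 1 ∧ |1 - s ^ 2| ≤ 1 ∧ |s * (s + 1) / 2| ≤ 1 := by
  refine ⟨?_, ?_, ?_⟩ <;> rw [_root_.abs_le] <;> constructor <;> nlinarith

/-- Quadratic interpolation reproduces quadratic polynomials. -/
lemma lagrange_identity (hh : h ≠ 0) (s p q r e₀ e₁ e₂ : ℝ) :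
    (e₀ + (p + q * -(s * h) + 1 / 2 * r * (-(s * h)) ^ 2)) + s * h
      * (((e₁ + (p + q * (h - s * h) + 1 / 2 * r * (h - s * h) ^ 2))
        - (e₀ + (p + q * -(s * h) + 1 / 2 * r * (-(s * h)) ^ 2))) / h - h / 2
        * (((e₁ + (p + q * (h - s * h) + 1 / 2 * r * (h - s * h) ^ 2))
        - 2 * (e₀ + (p + q * -(s * h) + 1 / 2 * r * (-(s * h)) ^ 2))
        + (e₂ + (p + q * (-h - s * h) + 1 / 2 * r * (-h - s * h) ^ 2))) / h ^ 2))
      + 1 / 2 * (s * h) ^ 2 * (((e₁ + (p + q * (h - s * h) + 1 / 2 * r * (h - s * h) ^ 2))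
        - 2 * (e₀ + (p + q * -(s * h) + 1 / 2 * r * (-(s * h)) ^ 2))
        + (e₂ + (p + q * (-h - s * h) + 1 / 2 * r * (-h - s * h) ^ 2))) / h ^ 2) - p
      = e₂ * (s * (s - 1) / 2) + e₀ * (1 - s ^ 2) + e₁ * (s * (s + 1) / 2) := by
  field_simp
  ring

/-- On each cell `quad` is the Lagrange interpolation at x_{j-1}, x_j and x_{j+1}. It reproduces the
Taylor polynomial at x, so only the remainders at the three nodes survive. -/
lemma abs_quad_sub_le (hh : 0 < h) {M : ℝ} {f f₁ f₂ f₃ : ℝ → ℝ} (hp : Pack M f f₁ f₂ f₃)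
    {v : Grid} (hv : (v : ℤ → ℝ) = sample h f) (x : ℝ) :
    |quad h v x - f x| ≤ 48 * h ^ 3 * A (-(2 * h)) (2 * h) (fun z => |f₃ z|) x := by
  obtain ⟨h0, h1⟩ := cell_param hh x
  set j := ⌊x / h⌋ with hj
  set ξ := x - j * h with hξ
  -- The nodes lie within 2h of x. Each remainder is at most 16h³ times the average, and three of
  -- them make 48.
  set κ := 2 * (2 * h) * A (-(2 * h)) (2 * h) (fun z => |f₃ z|) x * (2 * h) ^ 2 with hκ
  set e : ℝ → ℝ := fun y => f y - (f x + f₁ x * (y - x) + 1 / 2 * f₂ x * (y - x) ^ 2) with he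
  have a0 : |e (j * h)| ≤ κ := hp.abs_taylor_le (by
    rw [abs_le]; constructor <;> linarith)
  have a1 : |e (j * h + h)| ≤ κ := hp.abs_taylor_le (by
    rw [abs_le]; constructor <;> linarith)
  have a2 : |e (j * h - h)| ≤ κ := hp.abs_taylor_le (by
    rw [abs_le]; constructor <;> linarith)
  have v0 : v j = f (j * h) := by rw [hv]; rfl
  have v1 : v (j + 1) = f (j * h + h) := by
    rw [hv, sample]; push_cast; congr 1; ring
  have v2 : v (j - 1) = f (j * h - h) := by
    rw [hv, sample]; push_cast; congr 1; ring
  set s := ξ / h with hs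
  have s0 : 0 ≤ s := by positivity
  have s1 : s ≤ 1 := (div_le_one hh).2 h1
  have hx : x = j * h + s * h := by rw [hs, div_mul_cancel₀ _ hh.ne', hξ]; ring
  have key : quad h v x - f x = e (j * h - h) * (s * (s - 1) / 2) + e (j * h) * (1 - s ^ 2)
      + e (j * h + h) * (s * (s + 1) / 2) := by
    have hq : quad h v x = v j + ξ * ((v (j + 1) - v j) / h
        - h / 2 * ((v (j + 1) - 2 * v j + v (j - 1)) / h ^ 2))
        + 1 / 2 * ξ ^ 2 * ((v (j + 1) - 2 * v j + v (j - 1)) / h ^ 2) := by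
      simp only [quad, poly, ← hj, lp.coeFn_sub, Pi.sub_apply, lp.coeFn_smul, Pi.smul_apply,
        Grid.dP_apply, Grid.d2_apply, smul_eq_mul, lp.coeFn_zero, Pi.zero_apply, mul_zero,
        add_zero, ← hξ]
    have hξ' : ξ = s * h := by rw [hs, div_mul_cancel₀ _ hh.ne']
    have q : ∀ y, f y = e y + (f x + f₁ x * (y - x) + 1 / 2 * f₂ x * (y - x) ^ 2) := fun y => by
      simp only [he]; ring
    rw [hq, v0, v1, v2, q (j * h), q (j * h + h), q (j * h - h), hξ']
    have d0 : (j : ℝ) * h - x = -(s * h) := by rw [hx]; ring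
    have d1 : (j : ℝ) * h + h - x = h - s * h := by rw [hx]; ring
    have d2 : (j : ℝ) * h - h - x = -h - s * h := by rw [hx]; ring
    rw [d0, d1, d2]
    exact lagrange_identity hh.ne' _ _ _ _ _ _ _
  rw [key]
  have hκ0 : 0 ≤ κ := (abs_nonneg _).trans a0
  obtain ⟨c2, c0, c1⟩ := abs_lagrange_le s0 s1
  have b : ∀ {p q : ℝ}, |p| ≤ κ → |q| ≤ 1 → |p * q| ≤ κ := fun hp hq => by
    rw [abs_mul]
    calc _ ≤ κ * 1 := mul_le_mul hp hq (abs_nonneg _) hκ0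
      _ = κ := mul_one _
  refine ((abs_add_three _ _ _).trans (add_le_add (add_le_add (b a2 c2) (b a0 c0))
    (b a1 c1))).trans_eq ?_
  rw [hκ]; ring

lemma memLp_quad (hh : 0 < h) (v : Grid) : MemLp (quad h v) 2 volume := memLp_poly hh _ _ _ _

lemma norm_quad_sub_le (hh : 0 < h) {M : ℝ} {f f₁ f₂ f₃ : ℝ → ℝ} (hp : Pack M f f₁ f₂ f₃)
    {v : Grid} (hv : (v : ℤ → ℝ) = sample h f) : ‖L2 (quad h v) - L2 f‖ ≤ 48 * h ^ 3 * M := by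
  have m := memLp_quad hh v
  have m3 := hp.w₃.right
  rw [← L2_sub m hp.w₁.left]
  have h2 : (0 : ℝ) < 2 * h := by positivity
  have mA := memLp_A (memLp_abs m3) (show -(2 * h) < 2 * h by linarith)
  have h1 := norm_L2_mono (m.sub hp.w₁.left) (mA.const_mul (48 * h ^ 3))
    (fun x => (abs_quad_sub_le hh hp hv x).trans (le_abs_self _))
  rw [L2_const_mul mA, norm_smul, Real.norm_of_nonneg (by positivity)] at h1
  have h3 := norm_A_le (memLp_abs m3) (show -(2 * h) < 2 * h by linarith)
  rw [norm_L2_abs m3] at h3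
  exact h1.trans (by gcongr; exact h3.trans hp.n₃)

/-- The slope in `quad` is the central difference, whose pairing with v vanishes, so the loss of
second order seen for the cubic interpolation is absent. The terms with factor h³/3 cancel to
leading order, and the rest is bounded by h³N². -/
lemma norm_sq_le_quad (hh : 0 < h) (v : Grid) :
    (√h * ‖v‖) ^ 2 ≤ ‖L2 (quad h v)‖ ^ 2 + h ^ 3 * Grid.N h v ^ 2 := by
  rw [norm_L2_sq (memLp_quad hh v), quad, integral_poly_sq hh, mul_pow, Real.sq_sqrt hh.le]
  have n1 := Grid.norm_dP_le_N hh v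
  have n2 := Grid.norm_d2_le_N hh v
  have b12 := (abs_le.1 (Grid.abs_inner_le_of hh n1 n2)).2
  have e1 := Grid.inner_dP_self hh v
  have e2 : ⟪v, Grid.d2 h v⟫_ℝ = -‖Grid.dP h v‖ ^ 2 := by rw [Grid.norm_dP_sq, neg_neg]
  simp only [inner_sub_left, inner_sub_right, real_inner_smul_left, real_inner_smul_right,
    inner_zero_right]
  rw [e1, e2, real_inner_self_eq_norm_sq v, real_inner_self_eq_norm_sq (Grid.dP h v),
    real_inner_self_eq_norm_sq (Grid.d2 h v), real_inner_comm (Grid.dP h v) (Grid.d2 h v)]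
  set X := Grid.N h v ^ 2
  have hX : 0 ≤ X := sq_nonneg _
  have c12 := mul_le_mul_of_nonneg_left b12 (by positivity : 0 ≤ h ^ 3)
  have hX3 : 0 ≤ h ^ 3 * X := by positivity
  have p5 : 0 ≤ h ^ 5 * ‖Grid.d2 h v‖ ^ 2 := by positivity
  rw [real_inner_comm] at c12
  rw [real_inner_comm (Grid.d2 h v) (Grid.dP h v)] at *
  nlinarith

/-- The trapezoidal sum of the squares exceeds the integral by a term of third order at most. -/
lemma norm_sample_sq_le (hh : 0 < h) (hh1 : h ≤ 1) {M : ℝ} {f f₁ f₂ f₃ : ℝ → ℝ}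
    (hp : Pack M f f₁ f₂ f₃) {v : Grid} (hv : (v : ℤ → ℝ) = sample h f) {c : ℝ}
    (hc : Grid.N h v ≤ c) :
    (√h * ‖v‖) ^ 2 ≤ ‖L2 f‖ ^ 2 + h ^ 3 * (c ^ 2 + 2400 * M ^ 2) := by
  have h1 := norm_sq_le_quad hh v
  have h2 := norm_quad_sub_le hh hp hv
  have h3 := norm_le_norm_add_norm_sub' (L2 (quad h v)) (L2 f)
  have hM := hp.nonneg
  -- Expanding the square gives the constants 96 and 48² = 2304, whose sum is 2400.
  have h4 : ‖L2 (quad h v)‖ ^ 2 ≤ (‖L2 f‖ + 48 * h ^ 3 * M) ^ 2 :=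
    pow_le_pow_left₀ (norm_nonneg _) (h3.trans (by gcongr)) 2
  have h5 : Grid.N h v ^ 2 ≤ c ^ 2 := pow_le_pow_left₀ (Grid.N_nonneg v) hc 2
  have h6 : h ^ 3 * Grid.N h v ^ 2 ≤ h ^ 3 * c ^ 2 := by gcongr
  have h7 : h ^ 3 ≤ 1 := pow_le_one₀ hh.le hh1
  have h8 : ‖L2 f‖ * (h ^ 3 * M) ≤ M * (h ^ 3 * M) := by gcongr; exact hp.n₀
  have h9 : h ^ 3 * (h ^ 3 * M ^ 2) ≤ 1 * (h ^ 3 * M ^ 2) := by gcongr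
  have h10 : 0 ≤ h ^ 3 * M ^ 2 := by positivity
  nlinarith

/-! ### Conservation of the `L²` norm by solutions -/

/-- Integration by parts turns both ∫ f² f' and ∫ f f''' into negative multiples of themselves. -/
lemma Pack.inner_rhs_self {M : ℝ} {f f₁ f₂ f₃ : ℝ → ℝ} (h : Pack M f f₁ f₂ f₃) :
    ⟪L2 f, rhs f f₁ f₃⟫_ℝ = 0 := by
  rw [real_inner_comm, h.inner_rhs h, flux]
  have h1 := h.w₁.integral_mul_mul h.w₁
  have h2 := h.integral_third h
  have e1 : ∫ x, f x * f₁ x * f x = ∫ x, f x ^ 2 * f₁ x := by congr 1; ext x; ring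
  have e2 : ∫ x, f₃ x * f x = ∫ x, f x * f₃ x := by congr 1; ext x; ring
  rw [e1] at h1
  rw [e2] at h2
  linarith

lemma Sol.norm_eq {T M : ℝ} {U U₁ U₂ U₃ : ℝ → ℝ → ℝ} (h : Sol T M U U₁ U₂ U₃) {t : ℝ}
    (ht : t ∈ Icc 0 T) : ‖L2 (U t)‖ = ‖L2 (U 0)‖ := by
  have hM := (h.pack t ht).nonneg
  have lip : ∀ s ∈ Icc 0 T, ∀ r ∈ Icc 0 T,
      |‖L2 (U s)‖ ^ 2 - ‖L2 (U r)‖ ^ 2| ≤ 2 * M ^ 2 * |s - r| := by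
    intro s hs r hr
    have h1 := (abs_norm_sub_norm_le (L2 (U s)) (L2 (U r))).trans (h.lip s hs r hr)
    have e : ‖L2 (U s)‖ ^ 2 - ‖L2 (U r)‖ ^ 2
        = (‖L2 (U s)‖ - ‖L2 (U r)‖) * (‖L2 (U s)‖ + ‖L2 (U r)‖) := by ring
    rw [e, abs_mul, abs_of_nonneg (by positivity : 0 ≤ ‖L2 (U s)‖ + ‖L2 (U r)‖)]
    calc _ ≤ (M * |s - r|) * (M + M) := by
          gcongr
          · exact (h.pack s hs).n₀
          · exact (h.pack r hr).n₀
      _ = _ := by ring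
  have hd : ∀ᵐ s, s ∈ Ioo 0 T → HasDerivAt (fun s => ‖L2 (U s)‖ ^ 2) 0 s := by
    filter_upwards [h.eqn] with s hs hmem
    have := (hs hmem).norm_sq
    rwa [(h.pack s (Ioo_subset_Icc_self hmem)).inner_rhs_self, mul_zero] at this
  have g1 := gronwall_of_lipschitz (c := 0) (k := 0) (L := 2 * M ^ 2) le_rfl le_rfl
    (by positivity) lip
    (by filter_upwards [hd] with s hs hmem using ⟨0, hs hmem, by simp⟩) ht
  -- Gronwall's inequality bounds from above only, so equality needs both signs.
  have g2 := gronwall_of_lipschitz (f := fun s => -‖L2 (U s)‖ ^ 2) (c := 0) (k := 0)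
    (L := 2 * M ^ 2) le_rfl le_rfl (by positivity)
    (fun s hs r hr => by
      rw [← abs_neg]
      refine le_trans (le_of_eq ?_) (lip s hs r hr)
      congr 1; ring)
    (by filter_upwards [hd] with s hs hmem using ⟨-0, (hs hmem).neg, by simp⟩) ht
  simp only [zero_mul, add_zero, Real.exp_zero, mul_one] at g1 g2
  exact (sq_eq_sq₀ (norm_nonneg _) (norm_nonneg _)).1 (by linarith)

/-- Interpolation with the bounded second derivatives turns closeness in L² into closeness of first
derivatives. -/
lemma Pack.norm_deriv_sub_sq_le {M M' : ℝ} {f f₁ f₂ f₃ g g₁ g₂ g₃ : ℝ → ℝ}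
    (hf : Pack M f f₁ f₂ f₃) (hg : Pack M' g g₁ g₂ g₃) :
    ‖L2 f₁ - L2 g₁‖ ^ 2 ≤ (M + M') * ‖L2 f - L2 g‖ := by
  have hp := hf.sub hg
  have h1 := hp.w₁.norm_sq_le hp.w₂
  rw [L2_sub hf.w₁.left hg.w₁.left, L2_sub hf.w₂.left hg.w₂.left] at h1
  refine h1.trans ?_
  rw [mul_comm]
  gcongr
  exact hp.n₂

/-- The spatial derivative of a nonzero solution is bounded away from zero. -/
lemma Sol.exists_lower_bound {T M : ℝ} (hT : 0 ≤ T) {U U₁ U₂ U₃ : ℝ → ℝ → ℝ}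
    (h : Sol T M U U₁ U₂ U₃) (h0 : L2 (U 0) ≠ 0) :
    ∃ c > 0, ∀ t ∈ Icc 0 T, c ≤ ‖L2 (U₁ t)‖ := by
  have hcont : ContinuousOn (fun t => ‖L2 (U₁ t)‖) (Icc 0 T) := by
    refine ContinuousOn.norm fun t ht => ?_
    have hM := (h.pack t ht).nonneg
    rw [ContinuousWithinAt, tendsto_iff_norm_sub_tendsto_zero]
    have hb : ∀ᶠ s in 𝓝[Icc 0 T] t, ‖L2 (U₁ s) - L2 (U₁ t)‖
        ≤ √((M + M) * (M * |s - t|)) := by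
      filter_upwards [self_mem_nhdsWithin] with s hs
      refine Real.le_sqrt_of_sq_le (((h.pack s hs).norm_deriv_sub_sq_le (h.pack t ht)).trans ?_)
      gcongr
      exact h.lip s hs t ht
    refine squeeze_zero' (Eventually.of_forall fun _ => norm_nonneg _) hb ?_
    have hc : Continuous fun s => √((M + M) * (M * |s - t|)) := by fun_prop
    have := hc.tendsto t
    simp only [sub_self, abs_zero, mul_zero, Real.sqrt_zero] at this
    exact this.mono_left nhdsWithin_le_nhds
  obtain ⟨t₀, ht₀, hmin⟩ := isCompact_Icc.exists_isMinOn ⟨0, le_rfl, hT⟩ hcont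
  refine ⟨‖L2 (U₁ t₀)‖, ?_, fun t ht => hmin ht⟩
  -- If the minimum were zero, U t₀ would vanish by the Sobolev inequality, contrary to the
  -- conservation of the L² norm.
  rcases (norm_nonneg (L2 (U₁ t₀))).lt_or_eq with hpos | hz
  · exact hpos
  · exfalso
    have hp := h.pack t₀ ht₀
    have hU : U t₀ = fun _ => 0 := by
      ext x
      have := hp.w₁.sq_le x
      rw [← hz, mul_zero] at this
      exact pow_eq_zero_iff two_ne_zero |>.1 (le_antisymm this (sq_nonneg _))
    have hn := h.norm_eq ht₀
    have hz2 : ‖L2 (U t₀)‖ = 0 := by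
      have e := norm_L2_sq hp.w₁.left
      rw [hU] at e ⊢
      simpa using e
    rw [hz2] at hn
    exact h0 (norm_eq_zero.1 hn.symm)

end KdV
end

noncomputable section

namespace KdV

open scoped InnerProductSpace

variable {h dt T ρ : ℝ}

/-! ### Approximations as sequences in the Hilbert space of grid functions -/

/-- `U` consists of the grid functions of the approximation `u` that are relevant up to time `T`. -/
def Represents (dt T : ℝ) (U : ℕ → Grid) (u : ℕ → ℤ → ℝ) : Prop :=
  ∀ n : ℕ, n * dt ≤ T → (U n : ℤ → ℝ) = u n ∧ (U (n + 1) : ℤ → ℝ) = u (n + 1)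

lemma Grid.coe_half {U : ℕ → Grid} {u : ℕ → ℤ → ℝ} {n : ℕ} (h1 : (U n : ℤ → ℝ) = u n)
    (h2 : (U (n + 1) : ℤ → ℝ) = u (n + 1)) :
    (((2⁻¹ : ℝ) • (U n + U (n + 1)) : Grid) : ℤ → ℝ) = half u n := by
  ext j
  rw [half, ← h1, ← h2, lp.coeFn_smul, lp.coeFn_add, Pi.smul_apply, Pi.add_apply, smul_eq_mul]
  ring

lemma Grid.step_iff_apply {U : ℕ → Grid} {u : ℕ → ℤ → ℝ} {n : ℕ} (h1 : (U n : ℤ → ℝ) = u n)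
    (h2 : (U (n + 1) : ℤ → ℝ) = u (n + 1)) : Grid.Step h dt (U n) (U (n + 1)) ↔
      ∀ j : ℤ, u (n + 1) j = u n j - dt * (avg (half u n) j * Dc h (half u n) j)
        - dt * Dm h (Dc h (Dp h (half u n))) j := by
  unfold Grid.Step
  set w := (2⁻¹ : ℝ) • (U n + U (n + 1)) with hw
  have e : (w : ℤ → ℝ) = half u n := Grid.coe_half h1 h2
  rw [← h1, ← h2, ← e, ← Grid.coe_av, ← Grid.coe_dC, ← Grid.coe_d3]
  have rhs : ∀ j : ℤ, (U n - dt • (Grid.Bl h w w + Grid.d3 h w) : Grid) j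
      = U n j - dt * (Grid.av w j * Grid.dC h w j) - dt * Grid.d3 h w j := fun j => by
    rw [lp.coeFn_sub, Pi.sub_apply, lp.coeFn_smul, Pi.smul_apply, lp.coeFn_add, Pi.add_apply,
      smul_eq_mul, Grid.Bl, Grid.mul_apply]
    ring
  constructor
  · intro heq j
    rw [← rhs]
    exact congrArg (fun v : Grid => v j) heq
  · intro heq
    ext j
    rw [rhs]; exact heq j

lemma IsApproximation.exists_represents {u₀ : ℝ → ℝ} {u : ℕ → ℤ → ℝ}
    (hu : IsApproximation h dt T u₀ u) :
    ∃ U : ℕ → Grid, Represents dt T U u ∧ Grid.Steps h dt T U := by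
  classical
  -- Beyond time T the scheme imposes nothing and square summability may fail; the value zero there
  -- is a dummy.
  let U : ℕ → Grid := fun n => if hn : MemL2 (u n) then Grid.mk (u n) hn else 0
  have hU : ∀ n, MemL2 (u n) → (U n : ℤ → ℝ) = u n := fun n hn => by
    have : U n = Grid.mk (u n) hn := dif_pos hn
    rw [this]; rfl
  have hr : Represents dt T U u := fun n hn => ⟨hU n (hu.memL2 n hn).1, hU _ (hu.memL2 n hn).2⟩
  exact ⟨U, hr, fun n hn => (Grid.step_iff_apply (hr n hn).1 (hr n hn).2).2 (hu.step n hn)⟩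

lemma Grid.Steps.isApproximation {u₀ : ℝ → ℝ} {U : ℕ → Grid} (hU : Grid.Steps h dt T U)
    (h0 : (U 0 : ℤ → ℝ) = sample h u₀) : IsApproximation h dt T u₀ fun n => U n where
  initial := h0
  memL2 n _ := ⟨(U n).memL2, (U (n + 1)).memL2⟩
  step n hn := (Grid.step_iff_apply (u := fun n => (U n : ℤ → ℝ)) rfl rfl).1 (hU n hn)

lemma Represents.interp_eq (hdt : 0 < dt) {U : ℕ → Grid} {u : ℕ → ℤ → ℝ}
    (hU : Represents dt T U u) {t : ℝ} (ht : t ∈ Icc 0 T) (x : ℝ) :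
    interp h dt u x t = spaceInterp h (Grid.path dt U t) x := by
  obtain ⟨h1, h2⟩ := hU ⌊t / dt⌋₊ ((floor_mul_le hdt ht.1).trans ht.2)
  simp only [interp]
  rw [Grid.path, spaceInterp_add_smul, spaceInterp_sub, h1, h2]
  ring

/-- To the right of t the index n stays constant for a while, also when t is a node, so the right
derivative is the slope of the current time interval. -/
lemma derivWithin_interp (hdt : 0 < dt) (u : ℕ → ℤ → ℝ) {t : ℝ} (ht : 0 ≤ t) (x : ℝ) :
    derivWithin (fun s => interp h dt u x s) (Ici t) t
      = (spaceInterp h (u (⌊t / dt⌋₊ + 1)) x - spaceInterp h (u ⌊t / dt⌋₊) x) / dt := by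
  set n := ⌊t / dt⌋₊ with hn
  have h1 := floor_mul_le hdt ht
  have h2 := lt_floor_add_one_mul hdt t
  set q := (spaceInterp h (u (n + 1)) x - spaceInterp h (u n) x) / dt with hq
  have fl : ∀ s ∈ Ico t ((n + 1) * dt), interp h dt u x s
      = spaceInterp h (u n) x + (s - n * dt) * q := fun s hs => by
    have : ⌊s / dt⌋₊ = n := by
      rw [Nat.floor_eq_iff (div_nonneg (ht.trans hs.1) hdt.le), le_div_iff₀ hdt, div_lt_iff₀ hdt]
      exact ⟨h1.trans hs.1, hs.2⟩
    simp only [interp, this, hq]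
  have ev : (fun s => interp h dt u x s) =ᶠ[𝓝[Ici t] t]
      fun s => spaceInterp h (u n) x + (s - n * dt) * q := by
    filter_upwards [Ico_mem_nhdsGE h2] with s hs using fl s hs
  have hd : HasDerivAt (fun s => spaceInterp h (u n) x + (s - n * dt) * q) (1 * q) t :=
    (((hasDerivAt_id t).sub_const _).mul_const q).const_add _
  rw [one_mul] at hd
  exact ((hd.hasDerivWithinAt (s := Ici t)).congr_of_eventuallyEq ev
    (fl t ⟨le_rfl, h2⟩)).derivWithin (uniqueDiffWithinAt_Ici t)

/-! ### Well-posedness and bounds -/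

lemma lifespan_pos (hρ : 0 < ρ) : 0 < lifespan ρ := by unfold lifespan; positivity

lemma bnd_pos (hρ : 0 < ρ) : 0 < bnd ρ := by unfold bnd; positivity

section

variable {u₀ : ℝ → ℝ}

lemma IsApproximation.exists_steps {u : ℕ → ℤ → ℝ} (hh : 0 < h) (hρ : 0 < ρ)
    (h0 : h3Norm h (sample h u₀) ≤ ρ) (hu : IsApproximation h dt (lifespan ρ) u₀ u) :
    ∃ U : ℕ → Grid, Represents dt (lifespan ρ) U u ∧ Grid.Steps h dt (lifespan ρ) U ∧
      (U 0 : ℤ → ℝ) = sample h u₀ ∧ Grid.N h (U 0) ≤ ρ := by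
  obtain ⟨U, hr, hs⟩ := hu.exists_represents
  have e : (U 0 : ℤ → ℝ) = sample h u₀ := by
    rw [(hr 0 (by simpa using (lifespan_pos hρ).le)).1, hu.initial]
  refine ⟨U, hr, hs, e, (Grid.N_le_h3Norm hh (U 0)).trans ?_⟩
  rwa [e]

lemma exists_isApproximation (hh : 0 < h) (hdt : 0 < dt) (hρ : 0 < ρ) (hdt' : dt ≤ lifespan ρ)
    (hu₀ : MemL2 (sample h u₀)) (h0 : h3Norm h (sample h u₀) ≤ ρ) :
    ∃ U : ℕ → Grid, (U 0 : ℤ → ℝ) = sample h u₀ ∧ Grid.N h (U 0) ≤ ρ ∧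
      Grid.Steps h dt (lifespan ρ) U := by
  have hN : Grid.N h (Grid.mk (sample h u₀) hu₀) ≤ ρ := (Grid.N_le_h3Norm hh _).trans h0
  obtain ⟨U, hU0, hU⟩ := Grid.exists_steps hh hdt hρ hdt' _ hN
  exact ⟨U, by rw [hU0]; rfl, by rwa [hU0], hU⟩

lemma IsApproximation.unique {u v : ℕ → ℤ → ℝ} (hh : 0 < h) (hdt : 0 < dt) (hρ : 0 < ρ)
    (hdt' : dt ≤ lifespan ρ) (h0 : h3Norm h (sample h u₀) ≤ ρ)
    (hu : IsApproximation h dt (lifespan ρ) u₀ u) (hv : IsApproximation h dt (lifespan ρ) u₀ v)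
    {n : ℕ} (hn : n * dt ≤ lifespan ρ) : u n = v n ∧ u (n + 1) = v (n + 1) := by
  obtain ⟨U, hr, hs, e, hN⟩ := hu.exists_steps hh hρ h0
  obtain ⟨V, hr', hs', e', hN'⟩ := hv.exists_steps hh hρ h0
  have h00 : U 0 = V 0 := by ext j; rw [e, e']
  obtain ⟨h1, h2⟩ := Grid.steps_unique hh hdt hρ hdt' hN h00 hs hs' n hn
  rw [← (hr n hn).1, ← (hr n hn).2, ← (hr' n hn).1, ← (hr' n hn).2, h1, h2]
  exact ⟨rfl, rfl⟩

lemma IsApproximation.bounds {u : ℕ → ℤ → ℝ} (hh : 0 < h) (hh1 : h ≤ 1) (hdt : 0 < dt)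
    (hρ : 0 < ρ) (hdt' : dt ≤ lifespan ρ) (h0 : h3Norm h (sample h u₀) ≤ ρ)
    (hu : IsApproximation h dt (lifespan ρ) u₀ u) {t : ℝ} (ht : t ∈ Icc 0 (lifespan ρ)) :
    eLpNorm (fun x => deriv (fun y => interp h dt u y t) x) 2 volume
        ≤ ENNReal.ofReal (15 * bnd ρ) ∧
      eLpNorm (fun x => derivWithin (fun s => interp h dt u x s) (Ici t) t) 2 volume
        ≤ ENNReal.ofReal (15 * bnd ρ) ∧
      eLpNorm (fun x => iteratedDeriv 3 (fun y => interp h dt u y t) x) 2 volume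
        ≤ ENNReal.ofReal (15 * bnd ρ) := by
  obtain ⟨U, hr, hs, -, hN⟩ := hu.exists_steps hh hρ h0
  have e : (fun y => interp h dt u y t) = spaceInterp h (Grid.path dt U t) :=
    funext fun y => hr.interp_eq hdt ht y
  have hp := Grid.N_path_le hh hdt hρ hdt' hN hs ht
  have hb : 4 * ρ ≤ bnd ρ := by unfold bnd; nlinarith
  have hn := (floor_mul_le hdt ht.1).trans ht.2
  rw [e]
  refine ⟨(eLpNorm_deriv_spaceInterp_le hh hh1 _).trans (ENNReal.ofReal_le_ofReal (by linarith)),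
    ?_, (eLpNorm_iteratedDeriv_spaceInterp_le hh _).trans
      (ENNReal.ofReal_le_ofReal (by linarith))⟩
  have hd := Grid.norm_steps_sub_le hh hdt hρ hdt' hN hs _ hn
  obtain ⟨r1, r2⟩ := hr _ hn
  -- Interpolation in space is linear, so the time derivative is the interpolation of a difference
  -- quotient in time.
  have e2 : (fun x => derivWithin (fun s => interp h dt u x s) (Ici t) t)
      = spaceInterp h ((0 : Grid) + dt⁻¹ • (U (⌊t / dt⌋₊ + 1) - U ⌊t / dt⌋₊) : Grid) := by
    ext x
    rw [derivWithin_interp hdt u ht.1, spaceInterp_add_smul, spaceInterp_sub, r1, r2]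
    have : spaceInterp h ((0 : Grid) : ℤ → ℝ) x = 0 := by
      have := spaceInterp_sub (h := h) (0 : Grid) (0 : Grid) x
      rwa [sub_zero, sub_self] at this
    rw [this]; ring
  rw [e2, zero_add]
  refine (eLpNorm_spaceInterp_le hh _).trans (ENNReal.ofReal_le_ofReal ?_)
  rw [norm_smul, Real.norm_of_nonneg (inv_nonneg.2 hdt.le)]
  have : √h * (dt⁻¹ * ‖U (⌊t / dt⌋₊ + 1) - U ⌊t / dt⌋₊‖) ≤ bnd ρ := by
    calc _ = dt⁻¹ * (√h * ‖U (⌊t / dt⌋₊ + 1) - U ⌊t / dt⌋₊‖) := by ring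
      _ ≤ dt⁻¹ * (bnd ρ * dt) := by gcongr
      _ = bnd ρ := by field_simp
  linarith

end

end KdV
end

noncomputable section

namespace KdV

open scoped InnerProductSpace

variable {ρ lam : ℝ} {u₀ f₁ f₂ f₃ : ℝ → ℝ} {N : ℝ}

/-! ### Convergence -/

/-- Mesh widths below which the initial data are admissible. -/
lemma exists_mesh_bound (hρ : 0 < ρ) (hlam : 0 < lam)
    (hev : ∀ᶠ dx in 𝓝[>] (0 : ℝ), h3Norm dx (sample dx u₀) ≤ ρ) :
    ∃ δ > 0, δ ≤ 1 ∧ ∀ h dt : ℝ, 0 < h → h ≤ δ → dt ≤ lam * h →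
      dt ≤ lifespan ρ ∧ h3Norm h (sample h u₀) ≤ ρ := by
  obtain ⟨a, ha, hsub⟩ := mem_nhdsGT_iff_exists_Ioc_subset.1 hev
  have hl := lifespan_pos hρ
  refine ⟨min a (min 1 (lifespan ρ / lam)), lt_min ha (lt_min one_pos (by positivity)),
    (min_le_right _ _).trans (min_le_left _ _), fun h dt hh hδ hdt => ⟨?_, ?_⟩⟩
  · have h1 := hδ.trans ((min_le_right _ _).trans (min_le_right _ _))
    rw [le_div_iff₀ hlam] at h1
    linarith
  · exact hsub ⟨hh, hδ.trans (min_le_left _ _)⟩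

lemma Grid.norm_smooth_path_zero_sub_le {h dt : ℝ} (hh : 0 < h) (hu₀ : Pack N u₀ f₁ f₂ f₃)
    {V : ℕ → Grid} (hV : (V 0 : ℤ → ℝ) = sample h u₀) (hN : Grid.N h (V 0) ≤ ρ) :
    ‖L2 (smooth h (Grid.path dt V 0)) - L2 u₀‖ ≤ h * (6 * ρ + 2 * N) := by
  rw [Grid.path_zero]
  refine (norm_smooth_sample_sub_le hh hu₀.w₁ hV hN).trans ?_
  gcongr
  exact hu₀.n₁

lemma errConst_pos (hρ : 0 < ρ) : 0 < errConst ρ := by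
  have := bnd_pos hρ
  unfold errConst; positivity

/-- The solution exists, as a limit of approximations. -/
lemma exists_sol (hρ : 0 < ρ) (hu₀ : Pack N u₀ f₁ f₂ f₃)
    (hev : ∀ᶠ dx in 𝓝[>] (0 : ℝ), h3Norm dx (sample dx u₀) ≤ ρ) :
    ∃ M U U₁ U₂ U₃, Sol (lifespan ρ) M U U₁ U₂ U₃ ∧ U 0 = u₀ := by
  obtain ⟨δ, hδ, -, hmesh⟩ := exists_mesh_bound hρ one_pos hev
  -- One sequence of meshes suffices for existence; it has Δt = Δx = k n.
  set k : ℕ → ℝ := fun n => δ / (n + 1) with hk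
  have hk0 : ∀ n, 0 < k n := fun n => by positivity
  have hkδ : ∀ n, k n ≤ δ := fun n => div_le_self hδ.le (by
    have : (0 : ℝ) ≤ n := n.cast_nonneg
    linarith)
  have hkl : Tendsto k atTop (𝓝 0) := by
    have := (tendsto_one_div_add_atTop_nhds_zero_nat (𝕜 := ℝ)).const_mul δ
    rw [mul_zero] at this
    exact this.congr fun n => by simp only [hk]; ring
  have hm := fun n => hmesh (k n) (k n) (hk0 n) (hkδ n) (by rw [one_mul])
  have hex := fun n => exists_isApproximation (hk0 n) (hk0 n) hρ (hm n).1
    (memL2_sample (hk0 n) hu₀.w₁) (hm n).2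
  choose V hV0 hVN hVs using hex
  have hM := hu₀.nonneg
  refine ⟨_, exists_sol_of_approxSol (lifespan_pos hρ).le
    (fun n => approxSol_smooth_path (hk0 n) (hk0 n) hρ (hm n).1 (hVN n) (hVs n))
    (fun n => ?_) ?_ hu₀ ?_⟩
  · have := errConst_pos hρ
    have := hk0 n
    positivity
  · simpa using (hkl.add hkl).const_mul (errConst ρ)
  · rw [tendsto_iff_norm_sub_tendsto_zero]
    refine squeeze_zero (fun _ => norm_nonneg _)
      (fun n => Grid.norm_smooth_path_zero_sub_le (hk0 n) hu₀ (hV0 n) (hVN n)) ?_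
    simpa using hkl.mul_const (6 * ρ + 2 * N)

/-- Rate of convergence in `L²`. -/
lemma Sol.norm_smooth_path_sub_sq_le (hρ : 0 < ρ) (hlam : 0 < lam) (hu₀ : Pack N u₀ f₁ f₂ f₃)
    {M : ℝ} {U U₁ U₂ U₃ : ℝ → ℝ → ℝ} (hU : Sol (lifespan ρ) M U U₁ U₂ U₃) (h0 : U 0 = u₀) :
    ∃ K, 0 ≤ K ∧ ∀ h dt : ℝ, 0 < h → h ≤ 1 → 0 < dt → dt ≤ lam * h → dt ≤ lifespan ρ →
      ∀ V : ℕ → Grid, (V 0 : ℤ → ℝ) = sample h u₀ → Grid.N h (V 0) ≤ ρ →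
        Grid.Steps h dt (lifespan ρ) V → ∀ t ∈ Icc 0 (lifespan ρ),
          ‖L2 (smooth h (Grid.path dt V t)) - L2 (U t)‖ ^ 2 ≤ K * h := by
  have hN := hu₀.nonneg
  have hE := errConst_pos hρ
  have hb := bnd_pos hρ
  have hT := lifespan_pos hρ
  -- A common bound for the approximation and the solution. The restriction Δt ≤ λh turns h + Δt
  -- into a multiple of h, and h² ≤ h does the same for the squared initial error.
  set B := max (bnd ρ) M with hB
  have hB0 : 0 ≤ B := hb.le.trans (le_max_left _ _)
  refine ⟨((6 * ρ + 2 * N) ^ 2 + 4 * B * (errConst ρ * (1 + lam)) * lifespan ρ)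
    * Real.exp (2 * B * lifespan ρ), by positivity, ?_⟩
  intro h dt hh hh1 hdt hdt1 hdt2 V hV hVN hVs t ht
  have a := (approxSol_smooth_path hh hdt hρ hdt2 hVN hVs).mono (le_max_left _ M) le_rfl
  have b := (hU.mono (le_max_right (bnd ρ) M)).approxSol
  have := a.stability (by positivity) le_rfl b ht
  rw [h0] at this
  have c := Grid.norm_smooth_path_zero_sub_le (dt := dt) hh hu₀ hV hVN
  refine this.trans ?_
  have c2 := pow_le_pow_left₀ (norm_nonneg _) c 2
  have d : ‖L2 (smooth h (Grid.path dt V 0)) - L2 u₀‖ ^ 2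
      + 4 * B * (errConst ρ * (h + dt) + 0) * lifespan ρ
      ≤ ((6 * ρ + 2 * N) ^ 2 + 4 * B * (errConst ρ * (1 + lam)) * lifespan ρ) * h := by
    have e1 : (h * (6 * ρ + 2 * N)) ^ 2 ≤ h * (6 * ρ + 2 * N) ^ 2 := by
      rw [mul_pow]
      gcongr
      nlinarith
    have e2 : 4 * B * (errConst ρ * (h + dt) + 0) * lifespan ρ
        ≤ 4 * B * (errConst ρ * (h + lam * h) + 0) * lifespan ρ := by gcongr
    linarith
  calc _ ≤ (((6 * ρ + 2 * N) ^ 2 + 4 * B * (errConst ρ * (1 + lam)) * lifespan ρ) * h)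
        * Real.exp (2 * B * lifespan ρ) := by gcongr
    _ = _ := by ring

/-- Uniform convergence of the interpolations. -/
lemma Sol.abs_spaceInterp_sub_le (hρ : 0 < ρ) {M : ℝ} {U U₁ U₂ U₃ : ℝ → ℝ → ℝ}
    (hU : Sol (lifespan ρ) M U U₁ U₂ U₃) {h K : ℝ} (hh : 0 < h) {v : Grid}
    (hv : Grid.N h v ≤ 2 * ρ) {t : ℝ} (ht : t ∈ Icc 0 (lifespan ρ))
    (hd : ‖L2 (smooth h v) - L2 (U t)‖ ^ 2 ≤ K * h) (x : ℝ) :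
    |spaceInterp h v x - U t x| ≤ 44 * ρ * h + √(2 * (2 * ρ + M) * √(K * h)) := by
  have hM := (hU.pack t ht).nonneg
  have h1 := abs_spaceInterp_sub_smooth_le hh v x
  have h2 := ((pack_smooth hh v).mono hv).sq_sub_le (hU.pack t ht) x
  have h3 : |smooth h v x - U t x| ≤ √(2 * (2 * ρ + M) * √(K * h)) := by
    refine Real.le_sqrt_of_sq_le ?_
    rw [sq_abs]
    refine h2.trans ?_
    gcongr
    exact Real.le_sqrt_of_sq_le hd
  have h4 : 22 * h * Grid.N h v ≤ 22 * h * (2 * ρ) := by gcongr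
  have := _root_.abs_sub_le (spaceInterp h v x) (smooth h v x) (U t x)
  linarith

/-- Lower bound for the difference quotients of the approximations. -/
lemma Sol.le_norm_dP (hρ : 0 < ρ) {M : ℝ} {U U₁ U₂ U₃ : ℝ → ℝ → ℝ}
    (hU : Sol (lifespan ρ) M U U₁ U₂ U₃) {h K : ℝ} (hh : 0 < h) {v : Grid}
    (hv : Grid.N h v ≤ 2 * ρ) {t : ℝ} (ht : t ∈ Icc 0 (lifespan ρ))
    (hd : ‖L2 (smooth h v) - L2 (U t)‖ ^ 2 ≤ K * h) :
    ‖L2 (U₁ t)‖ - √((2 * ρ + M) * √(K * h)) ≤ √h * ‖Grid.dP h v‖ := by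
  have hM := (hU.pack t ht).nonneg
  have h1 := ((pack_smooth hh v).mono hv).norm_deriv_sub_sq_le (hU.pack t ht)
  have h2 : ‖L2 (smooth₁ h v) - L2 (U₁ t)‖ ≤ √((2 * ρ + M) * √(K * h)) := by
    refine Real.le_sqrt_of_sq_le (h1.trans ?_)
    gcongr
    exact Real.le_sqrt_of_sq_le hd
  have h3 := norm_smooth₁_le hh v
  have h4 := norm_le_norm_add_norm_sub (L2 (smooth₁ h v)) (L2 (U₁ t))
  linarith

lemma Grid.norm_path_le {h dt : ℝ} (hh : 0 < h) (hdt : 0 < dt) (hρ : 0 < ρ)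
    (hdt' : dt ≤ lifespan ρ) {V : ℕ → Grid} (h0 : Grid.N h (V 0) ≤ ρ)
    (hs : Grid.Steps h dt (lifespan ρ) V) {t : ℝ} (ht : t ∈ Icc 0 (lifespan ρ)) :
    ‖Grid.path dt V t‖ ≤ ‖V 0‖ := by
  obtain ⟨-, -, -, h1, h2⟩ := Grid.steps_bounds hh hdt hρ hdt' h0 hs _
    ((floor_mul_le hdt ht.1).trans ht.2)
  obtain ⟨h3, h4⟩ := path_param hdt ht.1
  have := norm_add_smul_sub_sq_le (V ⌊t / dt⌋₊) (V (⌊t / dt⌋₊ + 1)) h3 h4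
  rw [h1, h2] at this
  refine (abs_le_of_sq_le_sq' (?_ : _ ≤ ‖V 0‖ ^ 2) (norm_nonneg _)).2
  unfold Grid.path
  linarith

lemma memLp_spaceInterp {h : ℝ} (hh : 0 < h) (v : Grid) : MemLp (spaceInterp h v) 2 volume := by
  rw [spaceInterp_eq_poly]; exact memLp_poly hh _ _ _ _

/-- The `L²` norm of the interpolation is at most that of the initial data. -/
lemma Sol.exists_norm_spaceInterp_le (hρ : 0 < ρ) (hlam : 0 < lam) (hu₀ : Pack N u₀ f₁ f₂ f₃)
    {M : ℝ} {U U₁ U₂ U₃ : ℝ → ℝ → ℝ} (hU : Sol (lifespan ρ) M U U₁ U₂ U₃) (h0 : U 0 = u₀) :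
    ∃ δ > 0, δ ≤ 1 ∧ ∀ h dt : ℝ, 0 < h → h ≤ δ → 0 < dt → dt ≤ lam * h → dt ≤ lifespan ρ →
      ∀ V : ℕ → Grid, (V 0 : ℤ → ℝ) = sample h u₀ → Grid.N h (V 0) ≤ ρ →
        Grid.Steps h dt (lifespan ρ) V → ∀ t ∈ Icc 0 (lifespan ρ),
          ‖L2 (spaceInterp h (Grid.path dt V t))‖ ≤ ‖L2 u₀‖ := by
  have hT := lifespan_pos hρ
  by_cases hz : L2 u₀ = 0
  · refine ⟨1, one_pos, le_rfl, fun h dt hh hh1 hdt _ hdt2 V hV hVN hVs t ht => ?_⟩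
    have hu : u₀ = fun _ => 0 := by
      ext x
      have := hu₀.w₁.sq_le x
      rw [hz, norm_zero, mul_zero, zero_mul] at this
      exact pow_eq_zero_iff two_ne_zero |>.1 (le_antisymm this (sq_nonneg _))
    have hV0 : V 0 = 0 := by ext j; rw [hV, hu]; rfl
    have h1 := Grid.norm_path_le hh hdt hρ hdt2 hVN hVs ht
    rw [hV0, norm_zero] at h1
    have h2 := eLpNorm_spaceInterp_le hh (Grid.path dt V t)
    have h3 : ‖Grid.path dt V t‖ = 0 := le_antisymm h1 (norm_nonneg _)
    rw [h3, mul_zero, mul_zero] at h2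
    exact (norm_L2_le le_rfl h2).trans (norm_nonneg _)
  -- The gain (h²/2)‖D₊v‖² has to beat the errors of order h³ from sampling and from interpolation,
  -- which are collected in `C`.
  obtain ⟨c, hc, hlow⟩ := hU.exists_lower_bound hT.le (by rwa [h0])
  obtain ⟨K, hK, hconv⟩ := hU.norm_smooth_path_sub_sq_le hρ hlam hu₀ h0
  set C := ρ ^ 2 + 2400 * N ^ 2 + (2 * ρ) ^ 2 with hC
  have hCpos : 0 < C := by positivity
  have hlim : Tendsto (fun h => √((2 * ρ + M) * √(K * h))) (𝓝 0) (𝓝 0) := by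
    have hcont : Continuous fun h => √((2 * ρ + M) * √(K * h)) := by fun_prop
    simpa using hcont.tendsto 0
  obtain ⟨η, hη, hball⟩ := Metric.eventually_nhds_iff.1 (hlim.eventually_lt_const (half_pos hc))
  -- For h ≤ η/2 the scaled norm of D₊v is at least c/2, so the gain is at least h²c²/8, and this is
  -- at least h³C as soon as 8Ch ≤ c².
  refine ⟨min (min 1 (η / 2)) (c ^ 2 / (8 * C)), by positivity,
    (min_le_left _ _).trans (min_le_left _ _), ?_⟩
  intro h dt hh hδ hdt hdt1 hdt2 V hV hVN hVs t ht
  have hh1 : h ≤ 1 := hδ.trans ((min_le_left _ _).trans (min_le_left _ _))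
  have hhη : h ≤ η / 2 := hδ.trans ((min_le_left _ _).trans (min_le_right _ _))
  have hhC : h * (8 * C) ≤ c ^ 2 := by
    rw [← le_div_iff₀ (by positivity)]; exact hδ.trans (min_le_right _ _)
  have hv := Grid.N_path_le hh hdt hρ hdt2 hVN hVs ht
  have b1 := hU.le_norm_dP hρ hh hv ht (hconv h dt hh hh1 hdt hdt1 hdt2 V hV hVN hVs t ht)
  have b2 : √((2 * ρ + M) * √(K * h)) < c / 2 := hball (by
    rw [dist_zero_right, Real.norm_of_nonneg hh.le]; linarith)
  have b3 : c / 2 ≤ √h * ‖Grid.dP h (Grid.path dt V t)‖ := by linarith [hlow t ht]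
  have b4 := integral_spaceInterp_sq_le hh hh1 (Grid.path dt V t)
  rw [← norm_L2_sq (memLp_spaceInterp hh _)] at b4
  have b5 := norm_sample_sq_le hh hh1 hu₀ hV hVN
  have b6 : (√h * ‖Grid.path dt V t‖) ^ 2 ≤ (√h * ‖V 0‖) ^ 2 := by
    have := Grid.norm_path_le hh hdt hρ hdt2 hVN hVs ht
    gcongr
  have b7 := pow_le_pow_left₀ (by positivity) b3 2
  have b8 : h ^ 2 / 2 * (c / 2) ^ 2 ≤ h ^ 2 / 2 * (√h * ‖Grid.dP h (Grid.path dt V t)‖) ^ 2 := by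
    gcongr
  have b9 : Grid.N h (Grid.path dt V t) ^ 2 ≤ (2 * ρ) ^ 2 :=
    pow_le_pow_left₀ (Grid.N_nonneg _) hv 2
  have b10 : h ^ 3 * Grid.N h (Grid.path dt V t) ^ 2 ≤ h ^ 3 * (2 * ρ) ^ 2 := by gcongr
  have b11 : h ^ 2 * (h * (8 * C)) ≤ h ^ 2 * c ^ 2 := by gcongr
  refine (abs_le_of_sq_le_sq' ?_ (norm_nonneg _)).2
  have e : h ^ 3 * C = h ^ 3 * (ρ ^ 2 + 2400 * N ^ 2) + h ^ 3 * (2 * ρ) ^ 2 := by rw [hC]; ring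
  linarith

end KdV
end

/-! ### Assembly of the theorem -/

theorem mainTheorem2 :
    -- the discrete norms of the initial data are bounded as the mesh is refined
    (∀ u₀ : ℝ → ℝ, Continuous u₀ → KdV.MemH3 u₀ →
      ∃ R : ℝ, ∀ᶠ dx in 𝓝[>] (0 : ℝ), KdV.h3Norm dx (KdV.sample dx u₀) ≤ R) ∧
    -- `T` and `C` depend only on a bound `R` for the discrete norm of the initial data
    ∀ R : ℝ, ∃ T > 0, ∃ C > 0, ∀ lam > 0,
      -- well-posedness of the scheme and the bounds with constant `C`
      (∃ δ > 0, ∀ u₀ : ℝ → ℝ, Continuous u₀ → KdV.MemH3 u₀ →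
        ∀ dx dt : ℝ, 0 < dx → dx ≤ δ → 0 < dt → dt ≤ lam * dx →
          KdV.h3Norm dx (KdV.sample dx u₀) ≤ R →
          (∃ u, KdV.IsApproximation dx dt T u₀ u) ∧
          (∀ u v, KdV.IsApproximation dx dt T u₀ u → KdV.IsApproximation dx dt T u₀ v →
            ∀ n : ℕ, n * dt ≤ T → u n = v n ∧ u (n + 1) = v (n + 1)) ∧
          ∀ u, KdV.IsApproximation dx dt T u₀ u → ∀ t ∈ Icc 0 T,
            eLpNorm (fun x => deriv (fun y => KdV.interp dx dt u y t) x) 2 volume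
              ≤ ENNReal.ofReal C ∧
            -- the right derivative in time, which also exists at the nodes
            eLpNorm (fun x => derivWithin (fun s => KdV.interp dx dt u x s) (Ici t) t) 2 volume
              ≤ ENNReal.ofReal C ∧
            eLpNorm (fun x => iteratedDeriv 3 (fun y => KdV.interp dx dt u y t) x) 2 volume
              ≤ ENNReal.ofReal C) ∧
      ∀ u₀ : ℝ → ℝ, Continuous u₀ → KdV.MemH3 u₀ →
        (∀ᶠ dx in 𝓝[>] (0 : ℝ), KdV.h3Norm dx (KdV.sample dx u₀) ≤ R) →
        -- the bound by the norm of the initial data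
        (∃ δ > 0, ∀ dx dt : ℝ, 0 < dx → dx ≤ δ → 0 < dt → dt ≤ lam * dx →
          ∀ u, KdV.IsApproximation dx dt T u₀ u → ∀ t ∈ Icc 0 T,
            eLpNorm (fun x => KdV.interp dx dt u x t) 2 volume ≤ eLpNorm u₀ 2 volume) ∧
        -- uniform convergence to the unique solution
        ∃ U : ℝ → ℝ → ℝ, KdV.IsSolution T u₀ U ∧
          (∀ V : ℝ → ℝ → ℝ, KdV.IsSolution T u₀ V → ∀ x, ∀ t ∈ Icc 0 T, V x t = U x t) ∧
          ∀ ε > 0, ∃ δ > 0, ∀ dx dt : ℝ, 0 < dx → dx ≤ δ → 0 < dt → dt ≤ lam * dx →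
            ∀ u, KdV.IsApproximation dx dt T u₀ u → ∀ x, ∀ t ∈ Icc 0 T,
              |KdV.interp dx dt u x t - U x t| ≤ ε := by
  refine ⟨fun u₀ hc hu => ?_, fun R => ?_⟩
  · obtain ⟨M, f₁, f₂, f₃, hp⟩ := hu.exists_pack hc
    refine ⟨14 * M, ?_⟩
    filter_upwards [Ioc_mem_nhdsGT one_pos] with h hh
    exact KdV.h3Norm_sample_le hh.1 hh.2 hp
  -- The maximum with 1 provides a positive energy bound, and hence a positive life span, also when
  -- R ≤ 0.
  set ρ := max R 1 with hρdef
  have hρ : 0 < ρ := one_pos.trans_le (le_max_right _ _)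
  have hR : R ≤ ρ := le_max_left _ _
  have hb := KdV.bnd_pos hρ
  have hT := KdV.lifespan_pos hρ
  refine ⟨KdV.lifespan ρ, hT, 15 * KdV.bnd ρ, by positivity, fun lam hlam => ⟨?_, ?_⟩⟩
  -- Here λ matters only through Δt ≤ `lifespan ρ`, so T and C are independent of it.
  · refine ⟨min 1 (KdV.lifespan ρ / lam), by positivity,
      fun u₀ hc hu h dt hh hδ hdt hdt1 hn => ?_⟩
    obtain ⟨M, f₁, f₂, f₃, hp⟩ := hu.exists_pack hc
    have hh1 : h ≤ 1 := hδ.trans (min_le_left _ _)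
    have hdt2 : dt ≤ KdV.lifespan ρ := by
      have := hδ.trans (min_le_right _ _)
      rw [le_div_iff₀ hlam] at this
      linarith
    have hn' := hn.trans hR
    refine ⟨?_, fun u v hu hv n hn => hu.unique hh hdt hρ hdt2 hn' hv hn,
      fun u hu t ht => hu.bounds hh hh1 hdt hρ hdt2 hn' ht⟩
    obtain ⟨U, hU0, -, hU⟩ := KdV.exists_isApproximation hh hdt hρ hdt2
      (KdV.memL2_sample hh hp.w₁) hn'
    exact ⟨_, hU.isApproximation hU0⟩
  intro u₀ hc hu hev
  obtain ⟨N, f₁, f₂, f₃, hp⟩ := hu.exists_pack hc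
  have hev' : ∀ᶠ dx in 𝓝[>] (0 : ℝ), KdV.h3Norm dx (KdV.sample dx u₀) ≤ ρ :=
    hev.mono fun dx h => h.trans hR
  obtain ⟨M, U, U₁, U₂, U₃, hU, hU0⟩ := KdV.exists_sol hρ hp hev'
  obtain ⟨δ₀, hδ₀, hδ₀1, hmesh⟩ := KdV.exists_mesh_bound hρ hlam hev'
  refine ⟨?_, fun x t => U t x, by simpa only [hU0] using hU.isSolution,
    fun V hV x t ht => hU.isSolution_unique (by rwa [hU0]) x ht, fun ε hε => ?_⟩
  · obtain ⟨δ, hδ, hδ1, hle⟩ := hU.exists_norm_spaceInterp_le hρ hlam hp hU0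
    refine ⟨min δ₀ δ, lt_min hδ₀ hδ, fun h dt hh hhδ hdt hdt1 u happ t ht => ?_⟩
    obtain ⟨hdt2, hn⟩ := hmesh h dt hh (hhδ.trans (min_le_left _ _)) hdt1
    obtain ⟨V, hr, hs, hV0, hVN⟩ := happ.exists_steps hh hρ hn
    have e : (fun x => KdV.interp h dt u x t) = KdV.spaceInterp h (KdV.Grid.path dt V t) :=
      funext fun x => hr.interp_eq hdt ht x
    rw [e, KdV.eLpNorm_eq_norm_L2 (KdV.memLp_spaceInterp hh _),
      KdV.eLpNorm_eq_norm_L2 hp.w₁.left]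
    exact ENNReal.ofReal_le_ofReal
      (hle h dt hh (hhδ.trans (min_le_right _ _)) hdt hdt1 hdt2 V hV0 hVN hs t ht)
  · obtain ⟨K, hK, hconv⟩ := hU.norm_smooth_path_sub_sq_le hρ hlam hp hU0
    have hlim : Tendsto (fun h => 44 * ρ * h + √(2 * (2 * ρ + M) * √(K * h))) (𝓝 0) (𝓝 0) := by
      have hcont : Continuous fun h => 44 * ρ * h + √(2 * (2 * ρ + M) * √(K * h)) := by fun_prop
      simpa using hcont.tendsto 0
    obtain ⟨η, hη, hball⟩ := Metric.eventually_nhds_iff.1 (hlim.eventually_le_const hε)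
    refine ⟨min δ₀ (η / 2), by positivity, fun h dt hh hhδ hdt hdt1 u happ x t ht => ?_⟩
    have hhδ₀ := hhδ.trans (min_le_left _ _)
    obtain ⟨hdt2, hn⟩ := hmesh h dt hh hhδ₀ hdt1
    obtain ⟨V, hr, hs, hV0, hVN⟩ := happ.exists_steps hh hρ hn
    rw [hr.interp_eq hdt ht]
    refine (hU.abs_spaceInterp_sub_le hρ hh (KdV.Grid.N_path_le hh hdt hρ hdt2 hVN hs ht) ht
      (hconv h dt hh (hhδ₀.trans hδ₀1) hdt hdt1 hdt2 V hV0 hVN hs t ht) x).trans (hball ?_)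
    rw [dist_zero_right, Real.norm_of_nonneg hh.le]
    linarith [hhδ.trans (min_le_right _ _)]
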